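/- Let $K=\prod_{i=1}^{3}(c_i-h_i,\,c_i+h_i)$ with $c\in\mathbb R^3$, $h_1,h_2,h_3>0$, and let $r\ge 2$ be an integer. Write $P_k$ and $\widetilde P_k$ for the polynomials of degree at most $k$ and the homogeneous polynomials of degree $k$ (both $\{0\}$ if $k<0$), and let $\mathbf n_f$, $\boldsymbol\tau_e$ be a unit normal to each face $f$ and a unit tangent to each edge $e$ of $K$, with either orientation. Let $\mathcal S^0_r$ be the space of polynomials in $x_1,x_2,x_3$ of superlinear degree at most $r$ (the degree ignoring variables that enter linearly), and $$\mathcal S^1_{r-1,r}(K)=\operatorname{grad}\mathcal S^0_r+[P_{r-1}]^3\times \mathbf x+\big\{\big(x_2x_3(w_2-w_3),\,x_1x_3(w_3-w_1),\,x_1x_2(w_1-w_2)\big)^{\mathrm T}: w_i\in\widetilde P_{r-1}\text{ independent of }x_i\big\}.$$ Let $B_K=\prod_{i=1}^3(x_i-c_i+h_i)(c_i+h_i-x_i)$ and, for each face $f$, $B_f=B_K/\lambda_f$, where $\lambda_f$ is the affine function vanishing on $f$ whose gradient is minus the outward unit normal of $K$ on $f$. Define $$\mathcal V^{r-2}(K)=B_K\sum_{f}B_f\,\mathcal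 V^{r-2}_f(K),\qquad \mathcal V_f^{r-2}(K)=\Big\{\mathbf q\in[P_{r-2}]^3\times\mathbf n_f:\ \int_K \mathbf q\cdot B_KB_f\mathbf w\,dV=0\ \ \forall\,\mathbf w\in[P_{r-3}]^3\times\mathbf n_f\Big\},$$ the sum running over the six faces $f$ of $K$. **Theorem.** The sum $\mathcal S^{+,1}_{r-1,r}(K)=\mathcal S^1_{r-1,r}(K)+\mathcal V^{r-2}(K)$ is direct, and the following degrees of freedom are unisolvent for $\mathcal S^{+,1}_{r-1,r}(K)$: 1. $\int_e \mathbf u\cdot\boldsymbol\tau_e\,q\,ds$ for all $q\in P_{r-1}(e)$ and all edges $e$ of $K$; 2. $\int_f (\mathbf u\times\mathbf n_f)\cdot\mathbf q\,dA$ for all $\mathbf q\in[P_{r-3}(f)]^2\oplus\operatorname{grad}_f\widetilde P_{r-1}(f)$ and all faces $f$ of $K$; 3. $\int_f (\operatorname{curl}\mathbf u\times\mathbf n_f)\cdot\mathbf q\,dA$ for all $\mathbf q\in[P_{r-2}(f)]^2$ and all faces $f$ of $K$; 4. $\int_K \mathbf u\cdot\mathbf q\,dV$ for all $\mathbf q\in[P_{r-5}(K)]^3\oplus\operatorname{curl}[\widetilde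 P_{r-3}(K)]^3$. That is, for arbitrarily prescribed values of these moments, depending linearly on the test function $q$ or $\mathbf q$ on each edge, on each face and in $K$, there is exactly one $\mathbf u\in\mathcal S^{+,1}_{r-1,r}(K)$ that attains them. In particular $\dim\mathcal S^{+,1}_{r-1,r}(K)$ equals the number of degrees of freedom (the sum of the dimensions of the test spaces over the edges, over the faces for (2) and for (3), and $K$), and in the lowest-order case $r=2$ this number is $48$. -/

import Mathlib

namespace CurlElement

noncomputable section

open MeasureTheory
open scoped Matrix

/-! ### Polynomials and polynomial vector fields -/

/-- Real polynomials in `d` variables. A polynomial on an open box is identified with the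
corresponding element of the polynomial ring; the variables are the coordinates. -/
abbrev Poly (d : ℕ) : Type := MvPolynomial (Fin d) ℝ

/-- Polynomial vector fields with `d` components in `d` variables. -/
abbrev VPoly (d : ℕ) : Type := Fin d → Poly d

/-- `P_k`: polynomials of total degree at most `k`. It is zero for `k < 0`. -/
def P (d : ℕ) (k : ℤ) : Submodule ℝ (Poly d) :=
  MvPolynomial.restrictSupport ℝ {m | ((∑ i, m i : ℕ) : ℤ) ≤ k}

/-- Homogeneous polynomials of degree `k` (together with zero). It is zero for `k < 0`. -/
def PHom (d : ℕ) (k : ℤ) : Submodule ℝ (Poly d) :=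
  MvPolynomial.restrictSupport ℝ {m | ((∑ i, m i : ℕ) : ℤ) = k}

/-- `[P_k]^d`. -/
def VP (d : ℕ) (k : ℤ) : Submodule ℝ (VPoly d) :=
  Submodule.pi Set.univ fun _ => P d k

/-- `d`-tuples of homogeneous polynomials of degree `k`. -/
def VPHom (d : ℕ) (k : ℤ) : Submodule ℝ (VPoly d) :=
  Submodule.pi Set.univ fun _ => PHom d k

/-- The gradient of a polynomial. -/
def grad (d : ℕ) : Poly d →ₗ[ℝ] VPoly d :=
  LinearMap.pi fun i => (MvPolynomial.pderiv i).toLinearMap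

/-- The curl of a polynomial vector field in three variables. -/
def curl : VPoly 3 →ₗ[ℝ] VPoly 3 where
  toFun u :=
    ![MvPolynomial.pderiv 1 (u 2) - MvPolynomial.pderiv 2 (u 1),
      MvPolynomial.pderiv 2 (u 0) - MvPolynomial.pderiv 0 (u 2),
      MvPolynomial.pderiv 0 (u 1) - MvPolynomial.pderiv 1 (u 0)]
  map_add' u v := by
    ext i : 1
    fin_cases i <;> simp <;> ring
  map_smul' a u := by
    ext i : 1
    fin_cases i <;> simp [smul_sub]

/-- The map `u ↦ u × v` for a fixed polynomial vector field `v`. -/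
def crossRight (v : VPoly 3) : VPoly 3 →ₗ[ℝ] VPoly 3 :=
  (crossProduct.flip v).restrictScalars ℝ

/-- The value of a polynomial vector field at a point. -/
def evalV {d : ℕ} (x : Fin d → ℝ) (u : VPoly d) : Fin d → ℝ :=
  fun i => MvPolynomial.eval x (u i)

/-! ### The space `S^1_{r-1,r}` -/

/-- The superlinear degree of a monomial: its degree ignoring variables that enter linearly. -/
def superlinearDegree (m : Fin 3 →₀ ℕ) : ℕ :=
  ∑ i, if m i = 1 then 0 else m i

/-- The serendipity space `S_r^0`: polynomials of superlinear degree at most `r`. -/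
def S0 (r : ℕ) : Submodule ℝ (Poly 3) :=
  MvPolynomial.restrictSupport ℝ {m | superlinearDegree m ≤ r}

/-- Triples `(w_1, w_2, w_3)` in which `w_i` is homogeneous of degree `k` and does not depend
on `x_i`. -/
def W (k : ℤ) : Submodule ℝ (VPoly 3) :=
  Submodule.pi Set.univ fun i =>
    MvPolynomial.restrictSupport ℝ {m | ((∑ j, m j : ℕ) : ℤ) = k ∧ m i = 0}

/-- The map `w ↦ (x_2 x_3 (w_2 - w_3), x_1 x_3 (w_3 - w_1), x_1 x_2 (w_1 - w_2))`. -/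
def wField : VPoly 3 →ₗ[ℝ] VPoly 3 where
  toFun w :=
    ![MvPolynomial.X 1 * MvPolynomial.X 2 * (w 1 - w 2),
      MvPolynomial.X 0 * MvPolynomial.X 2 * (w 2 - w 0),
      MvPolynomial.X 0 * MvPolynomial.X 1 * (w 0 - w 1)]
  map_add' u v := by
    ext i : 1
    fin_cases i <;> simp <;> ring
  map_smul' a u := by
    ext i : 1
    fin_cases i <;> simp [← smul_sub]

/-- `S^1_{r-1,r} = grad S_r^0 + [P_{r-1}]^3 × x + {wField w}`. -/
def S1 (r : ℕ) : Submodule ℝ (VPoly 3) :=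
  (S0 r).map (grad 3) ⊔ (VP 3 ((r : ℤ) - 1)).map (crossRight MvPolynomial.X) ⊔
    (W ((r : ℤ) - 1)).map wField

/-! ### Boxes, their edges and faces -/

/-- The box `∏ (c i - h i, c i + h i)`, a "cube" of a cubical mesh. -/
structure Cube where
  /-- the centre -/
  c : Fin 3 → ℝ
  /-- the half side lengths -/
  h : Fin 3 → ℝ
  h_pos : ∀ i, 0 < h i

/-- A sign, `true` for `+1` and `false` for `-1`. -/
def sgn (b : Bool) : ℝ := if b then 1 else -1

/-- A face of a box: `(i, b)` is the face on which `x_i = c_i + sgn b * h_i`. -/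
abbrev Face : Type := Fin 3 × Bool

/-- An edge of a box: `(i, b)` is the edge in direction `i` on which the two remaining
coordinates, in increasing order of their index, are `c + sgn (b 0) * h` and
`c + sgn (b 1) * h`. -/
abbrev Edge : Type := Fin 3 × (Fin 2 → Bool)

/-- The unit vector in direction `i`, multiplied by a sign. -/
def unitVec (i : Fin 3) (b : Bool) : Fin 3 → ℝ := Pi.single i (sgn b)

namespace Cube

variable (K : Cube)

/-- The open box as a set. -/
def dom : Set (Fin 3 → ℝ) :=
  Set.pi Set.univ fun i => Set.Ioo (K.c i - K.h i) (K.c i + K.h i)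

/-- The parameter domain of a face: the two coordinates other than `x_{f.1}`. -/
def faceDom (f : Face) : Set (Fin 2 → ℝ) :=
  Set.pi Set.univ fun j =>
    Set.Ioo (K.c (f.1.succAbove j) - K.h (f.1.succAbove j))
      (K.c (f.1.succAbove j) + K.h (f.1.succAbove j))

/-- The point of the face `f` with the in-face coordinates `y`. -/
def facePt (f : Face) (y : Fin 2 → ℝ) : Fin 3 → ℝ :=
  Fin.insertNth (α := fun _ => ℝ) f.1 (K.c f.1 + sgn f.2 * K.h f.1) y

/-- The point of the edge `e` with `x_{e.1} = t`. -/
def edgePt (e : Edge) (t : ℝ) : Fin 3 → ℝ :=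
  Fin.insertNth (α := fun _ => ℝ) e.1 t fun j =>
    K.c (e.1.succAbove j) + sgn (e.2 j) * K.h (e.1.succAbove j)

/-! ### The bubble space -/

/-- `B_K = ∏ (x_i - c_i + h_i) (c_i + h_i - x_i)`. -/
def cellBubble : Poly 3 :=
  ∏ i, (MvPolynomial.X i - MvPolynomial.C (K.c i) + MvPolynomial.C (K.h i)) *
    (MvPolynomial.C (K.c i) + MvPolynomial.C (K.h i) - MvPolynomial.X i)

/-- `λ_f`: the linear function that vanishes on `f` and whose gradient is minus the unit outward
normal of `f`. -/
def faceLambda (f : Face) : Poly 3 :=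
  MvPolynomial.C (K.h f.1) -
    MvPolynomial.C (sgn f.2) * (MvPolynomial.X f.1 - MvPolynomial.C (K.c f.1))

/-- `B_f = B_K / λ_f`: the product of the functions `λ` of the five other faces. -/
def faceBubble (f : Face) : Poly 3 :=
  ∏ g ∈ Finset.univ.erase f, K.faceLambda g

/-- The defining relation of `B_f`. -/
theorem faceLambda_mul_faceBubble (f : Face) :
    K.faceLambda f * K.faceBubble f = K.cellBubble := by
  unfold faceBubble
  rw [Finset.mul_prod_erase Finset.univ K.faceLambda (Finset.mem_univ f),
    Fintype.prod_prod_type, cellBubble]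
  refine Finset.prod_congr rfl fun i _ => ?_
  simp only [Fintype.prod_bool, faceLambda, sgn]
  simp
  ring

/-- The integral of a polynomial over the box. -/
def cellIntegral (p : Poly 3) : ℝ := ∫ x in K.dom, MvPolynomial.eval x p

theorem integrableOn_eval (p : Poly 3) :
    IntegrableOn (fun x => MvPolynomial.eval x p) K.dom := by
  refine IntegrableOn.mono_set (t := Set.Icc (fun i => K.c i - K.h i) fun i => K.c i + K.h i)
    ((MvPolynomial.continuous_eval p).continuousOn.integrableOn_compact isCompact_Icc) ?_
  intro x hx
  exact ⟨fun i => (hx i trivial).1.le, fun i => (hx i trivial).2.le⟩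

theorem cellIntegral_add (p q : Poly 3) :
    K.cellIntegral (p + q) = K.cellIntegral p + K.cellIntegral q := by
  simp only [cellIntegral, map_add]
  exact integral_add (K.integrableOn_eval p) (K.integrableOn_eval q)

theorem cellIntegral_smul (a : ℝ) (p : Poly 3) :
    K.cellIntegral (a • p) = a * K.cellIntegral p := by
  simp only [cellIntegral, MvPolynomial.smul_eval]
  exact integral_const_mul a _

/-- `[P_k]^3 × n_f`; the sign of the normal is irrelevant here. -/
def tangentialP (f : Face) (k : ℤ) : Submodule ℝ (VPoly 3) :=
  (VP 3 k).map (crossRight fun i => MvPolynomial.C (unitVec f.1 f.2 i))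

/-- `V_f^k`: the fields `q ∈ [P_k]^3 × n_f` with `(q, B_K B_f w)_K = 0` for all
`w ∈ [P_{k-1}]^3 × n_f`. -/
def faceV (f : Face) (k : ℤ) : Submodule ℝ (VPoly 3) where
  carrier := {q | q ∈ tangentialP f k ∧ ∀ w ∈ tangentialP f (k - 1),
    K.cellIntegral (q ⬝ᵥ ((K.cellBubble * K.faceBubble f) • w)) = 0}
  add_mem' := by
    rintro p q ⟨hp, hp'⟩ ⟨hq, hq'⟩
    refine ⟨add_mem hp hq, fun w hw => ?_⟩
    rw [add_dotProduct, cellIntegral_add, hp' w hw, hq' w hw, add_zero]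
  zero_mem' := ⟨zero_mem _, fun w _ => by simp [cellIntegral]⟩
  smul_mem' := by
    rintro a q ⟨hq, hq'⟩
    refine ⟨Submodule.smul_mem _ a hq, fun w hw => ?_⟩
    rw [smul_dotProduct, cellIntegral_smul, hq' w hw, mul_zero]

/-- The bubble space `V^k(K) = B_K ∑_f B_f V_f^k(K)`. -/
def V (k : ℤ) : Submodule ℝ (VPoly 3) :=
  ⨆ f : Face, (K.faceV f k).map
    (LinearMap.lsmul (Poly 3) (VPoly 3) (K.cellBubble * K.faceBubble f) |>.restrictScalars ℝ)

/-- The enriched shape function space `S^{+,1}_{r-1,r}(K) = S^1_{r-1,r}(K) + V^{r-2}(K)`. -/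
def SPlus (r : ℕ) : Submodule ℝ (VPoly 3) :=
  S1 r ⊔ K.V ((r : ℤ) - 2)

end Cube

/-! ### The spaces of test functions -/

/-- `P_{r-1}(e)`, as polynomials in the coordinate along the edge. -/
def edgeTest (r : ℕ) : Submodule ℝ (Poly 1) := P 1 ((r : ℤ) - 1)

/-- `[P_{r-3}(f)]^2 ⊕ grad_f (homogeneous polynomials of degree r-1 on f)`, in the two coordinates
of the face. -/
def faceTest (r : ℕ) : Submodule ℝ (VPoly 2) :=
  VP 2 ((r : ℤ) - 3) ⊔ (PHom 2 ((r : ℤ) - 1)).map (grad 2)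

/-- `[P_{r-2}(f)]^2`, in the two coordinates of the face. -/
def faceCurlTest (r : ℕ) : Submodule ℝ (VPoly 2) := VP 2 ((r : ℤ) - 2)

/-- `[P_{r-5}(K)]^3 ⊕ curl [homogeneous polynomials of degree r-3]^3`. -/
def cellTest (r : ℕ) : Submodule ℝ (VPoly 3) :=
  VP 3 ((r : ℤ) - 5) ⊔ (VPHom 3 ((r : ℤ) - 3)).map curl

/-- The number of degrees of freedom on one box. -/
def numDofs (r : ℕ) : ℕ :=
  Fintype.card Edge * Module.finrank ℝ (edgeTest r) +
    Fintype.card Face * Module.finrank ℝ (faceTest r) +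
    Fintype.card Face * Module.finrank ℝ (faceCurlTest r) +
    Module.finrank ℝ (cellTest r)

/-! ### The degrees of freedom -/

/-- The vector in `ℝ³` tangential to the face `f` with the in-face components `v`. -/
def faceVec (f : Face) (v : Fin 2 → ℝ) : Fin 3 → ℝ :=
  Fin.insertNth (α := fun _ => ℝ) f.1 0 v

namespace Cube

variable (K : Cube)

/-- `∫_e (u · τ) q ds`, where `τ` is a tangent vector of the edge `e`. -/
def edgeMoment (e : Edge) (τ : Fin 3 → ℝ) (u : VPoly 3) (q : Poly 1) : ℝ :=
  ∫ t in (K.c e.1 - K.h e.1)..(K.c e.1 + K.h e.1),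
    (evalV (K.edgePt e t) u ⬝ᵥ τ) * MvPolynomial.eval (fun _ => t) q

/-- `∫_f (u × n) · q dA`, where `n` is a normal vector of the face `f`. -/
def faceMoment (f : Face) (n : Fin 3 → ℝ) (u : VPoly 3) (q : VPoly 2) : ℝ :=
  ∫ y in K.faceDom f, (evalV (K.facePt f y) u ⨯₃ n) ⬝ᵥ faceVec f (evalV y q)

/-- `∫_K u · q dV`. -/
def cellMoment (u q : VPoly 3) : ℝ :=
  ∫ x in K.dom, evalV x u ⬝ᵥ evalV x q

/-- The degrees of freedom
* `∫_e (u · τ_e) q ds`, `q ∈ P_{r-1}(e)`, for the twelve edges,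
* `∫_f (u × n_f) · q dA`, `q ∈ [P_{r-3}(f)]^2 ⊕ grad_f P̃_{r-1}(f)`, for the six faces,
* `∫_f (curl u × n_f) · q dA`, `q ∈ [P_{r-2}(f)]^2`, for the six faces,
* `∫_K u · q dV`, `q ∈ [P_{r-5}(K)]^3 ⊕ curl [P̃_{r-3}(K)]^3`,

are unisolvent for the space `S` of vector fields: the linear map that sends `u ∈ S` to all its
moments, regarded as linear functionals on the test spaces, is bijective. The signs `σ e` and
`ν f` fix which of the two unit tangents `τ_e` and unit normals `n_f` are used. -/
def Unisolvent (r : ℕ) (σ : Edge → Bool) (ν : Face → Bool) (S : Submodule ℝ (VPoly 3)) : Prop :=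
  ∀ (a₁ : Edge → Module.Dual ℝ (edgeTest r)) (a₂ : Face → Module.Dual ℝ (faceTest r))
    (a₃ : Face → Module.Dual ℝ (faceCurlTest r)) (a₄ : Module.Dual ℝ (cellTest r)),
    ∃! u : VPoly 3, u ∈ S ∧
      (∀ (e : Edge) (q : edgeTest r), K.edgeMoment e (unitVec e.1 (σ e)) u q = a₁ e q) ∧
      (∀ (f : Face) (q : faceTest r), K.faceMoment f (unitVec f.1 (ν f)) u q = a₂ f q) ∧
      (∀ (f : Face) (q : faceCurlTest r),
        K.faceMoment f (unitVec f.1 (ν f)) (curl u) q = a₃ f q) ∧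
      (∀ q : cellTest r, K.cellMoment u q = a₄ q)

end Cube

end

end CurlElement

/-!
# Unisolvence for the curl-conforming serendipity element enriched by bubbles

The system of moments is block triangular for the splitting of `S^{+,1}` into `S^1` and the bubble
space `V`. The edge, face and interior moments vanish on `V` and are unisolvent for `S^1`; the curl
moments are unisolvent for `V`. Directness of the sum, existence, uniqueness and the dimension all
follow from these facts (`allMoments_bijective`).

*The serendipity space.* Let all edge, face and interior moments of `u ∈ S^1` vanish. On an edge the
tangential component has degree at most `r - 1`, so it vanishes. Hence on each face the tangential
trace is itself a field with vanishing tangential components on the boundary of the face. Its scalar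
curl has degree at most `r - 1`, since the part of degree `r` of the normal component of the curl of
`u` is a multiple of the normal coordinate, which is constant on the face; testing with the rotated
gradient of this curl and integrating by parts shows that it is zero, and the trace is a gradient
(`eq_zero_of_faceTest`). In the interior, the `i`-th component of the curl of `u` vanishes on the
two faces orthogonal to the `x_i` axis, so it is `slab i * g_i`. Comparing top coefficients gives a
homogeneous linear system for the coefficients of the third summand of `S^1`, whose only solution is
zero (`eq_zero_of_coeff_relations`). Therefore `g` has degree at most `r - 3`, its curl is a test
field, integration by parts makes a weighted square of `g` integrate to zero, and `u` is a gradient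
(`eq_zero_of_cellTest`).

It remains to treat gradients, in two and in three dimensions. Closed polynomial fields have the
explicit potential of `grad_potential`, built from `x · u`, which for `u ∈ S^1` has superlinear
degree at most `r`; so does the analogous product on a face. A potential whose gradient has no
tangential trace is a constant plus `B g` with `B` the bubble function. The leading monomial of `B
g` contains the square of each variable, so that its degree counts in full and `g` has degree at
most `r - 2 d`. Writing `g` as a divergence of a test field gives `∫ B g² = 0` (`grad_eq_zero`). So
the moments are injective on `S^1` (`eq_zero_of_moments`); they are surjective because the dimension
of `S^1` is at least the number of moments (`le_finrank_S1`), by counting monomials in the three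
summands of `S^1`, bounding the test spaces from above.

*The bubble space.* Fields of `V` are multiples of the bubble function, so their traces vanish, and
their interior moments vanish by the defining orthogonality. On a face `f` the curl of a bubble
field only sees the summand `B_K B_f q` attached to `f`, since the other summands vanish there to
second order, and the curl moments of that summand are a weighted inner product on the tangential
trace of `q` (`curlMoment_eq`). Since `q` is orthogonal to fields of one degree less, it is
determined by this trace: if the trace is zero then `q = λ_f w`, and `q` is orthogonal to `w`
(`eq_zero_of_faceTrace`). Conversely, every trace of degree `r - 2` extends to an admissible `q`
(`exists_faceV`).
-/

namespace CurlElement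

noncomputable section

open MeasureTheory
open scoped Matrix
open MvPolynomial
open scoped Pointwise

/-! ### Polynomials with prescribed support -/

theorem mem_restrictSupport {d : ℕ} {s : Set (Fin d →₀ ℕ)} {p : Poly d} :
    p ∈ restrictSupport ℝ s ↔ ∀ m, coeff m p ≠ 0 → m ∈ s := by
  rw [mem_restrictSupport_iff]
  exact ⟨fun h m hm => h (by simpa [mem_support_iff] using hm),
    fun h m hm => h m (by simpa [mem_support_iff] using hm)⟩

theorem map_mem_of_monomial {d : ℕ} {M : Type*} [AddCommGroup M] [Module ℝ M]
    {s : Set (Fin d →₀ ℕ)} (L : Poly d →ₗ[ℝ] M) {N : Submodule ℝ M}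
    (h : ∀ m ∈ s, L (monomial m 1) ∈ N) {p : Poly d} (hp : p ∈ restrictSupport ℝ s) :
    L p ∈ N := by
  have : restrictSupport ℝ s ≤ N.comap L := by
    rw [restrictSupport_eq_span, Submodule.span_le]
    rintro _ ⟨m, hm, rfl⟩
    exact h m hm
  exact this hp

theorem mul_mem_restrictSupport {d : ℕ} {s t u : Set (Fin d →₀ ℕ)}
    (h : ∀ a ∈ s, ∀ b ∈ t, a + b ∈ u) {p q : Poly d}
    (hp : p ∈ restrictSupport ℝ s) (hq : q ∈ restrictSupport ℝ t) :
    p * q ∈ restrictSupport ℝ u := by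
  have h1 : p * q ∈ restrictSupport ℝ (s + t) := by
    rw [restrictSupport_add]
    exact Submodule.mul_mem_mul hp hq
  refine restrictSupport_mono ℝ ?_ h1
  rintro _ ⟨a, ha, b, hb, rfl⟩
  exact h a ha b hb

theorem pderiv_mem_restrictSupport {d : ℕ} {s t : Set (Fin d →₀ ℕ)} (i : Fin d)
    (h : ∀ m, m + Finsupp.single i 1 ∈ s → m ∈ t) {p : Poly d}
    (hp : p ∈ restrictSupport ℝ s) : pderiv i p ∈ restrictSupport ℝ t := by
  rw [mem_restrictSupport] at *
  intro m hm
  rw [coeff_pderiv] at hm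
  exact h m (hp _ (left_ne_zero_of_mul hm))

theorem X_mem_restrictSupport {d : ℕ} (i : Fin d) {s : Set (Fin d →₀ ℕ)}
    (h : Finsupp.single i 1 ∈ s) : (X i : Poly d) ∈ restrictSupport ℝ s :=
  (monomial_mem_restrictSupport ℝ).2 (.inl h)

theorem mem_P {d : ℕ} {k : ℤ} {p : Poly d} :
    p ∈ P d k ↔ ∀ m, coeff m p ≠ 0 → ((∑ i, m i : ℕ) : ℤ) ≤ k := mem_restrictSupport

theorem mem_PHom {d : ℕ} {k : ℤ} {p : Poly d} :
    p ∈ PHom d k ↔ ∀ m, coeff m p ≠ 0 → ((∑ i, m i : ℕ) : ℤ) = k := mem_restrictSupport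

theorem mem_VP {d : ℕ} {k : ℤ} {u : VPoly d} : u ∈ VP d k ↔ ∀ i, u i ∈ P d k := by
  simp [VP, Submodule.mem_pi]

theorem mem_VPHom {d : ℕ} {k : ℤ} {u : VPoly d} : u ∈ VPHom d k ↔ ∀ i, u i ∈ PHom d k := by
  simp [VPHom, Submodule.mem_pi]

theorem P_mono {d : ℕ} {j k : ℤ} (h : j ≤ k) : P d j ≤ P d k :=
  restrictSupport_mono ℝ fun _ hm => le_trans hm h

theorem PHom_le_P {d : ℕ} {j k : ℤ} (h : j ≤ k) : PHom d j ≤ P d k :=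
  restrictSupport_mono ℝ fun _ hm => le_trans (le_of_eq hm) h

theorem P_eq_bot {d : ℕ} {k : ℤ} (hk : k < 0) : P d k = ⊥ := by
  rw [eq_bot_iff]
  intro p hp
  rw [mem_P] at hp
  ext m
  by_contra h
  have := hp m (by simpa using h)
  omega

theorem mul_mem_P {d : ℕ} {j k l : ℤ} (hl : j + k ≤ l) {p q : Poly d} (hp : p ∈ P d j)
    (hq : q ∈ P d k) : p * q ∈ P d l := by
  refine mul_mem_restrictSupport (fun a ha b hb => ?_) hp hq
  simp only [Set.mem_ofPred_eq, Finsupp.add_apply, Finset.sum_add_distrib, Nat.cast_add] at *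
  omega

theorem sum_single {d : ℕ} (i : Fin d) (n : ℕ) : ∑ j, (Finsupp.single i n) j = n := by
  simp [Finsupp.single_apply]

theorem X_mem_P {d : ℕ} (i : Fin d) : (X i : Poly d) ∈ P d 1 :=
  X_mem_restrictSupport i (by simp only [Set.mem_ofPred_eq, sum_single, Nat.cast_one, le_refl])

theorem C_mem_P {d : ℕ} (a : ℝ) {k : ℤ} (hk : 0 ≤ k) : (C a : Poly d) ∈ P d k := by
  rw [mem_P]
  intro m hm
  rw [coeff_C] at hm
  have : m = 0 := by by_contra h; exact hm (if_neg (Ne.symm h))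
  simpa [this] using hk

theorem C_mul_mem {d : ℕ} {N : Submodule ℝ (Poly d)} (a : ℝ) {p : Poly d} (hp : p ∈ N) :
    C a * p ∈ N := by
  rw [← smul_eq_C_mul]
  exact N.smul_mem a hp

theorem pderiv_mem_P {d : ℕ} {k l : ℤ} (hl : k - 1 ≤ l) (i : Fin d) {p : Poly d}
    (hp : p ∈ P d k) : pderiv i p ∈ P d l := by
  refine pderiv_mem_restrictSupport i (fun m hm => ?_) hp
  simp only [Set.mem_ofPred_eq, Finsupp.add_apply, Finset.sum_add_distrib, sum_single,
    Nat.cast_add] at *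
  omega

theorem pderiv_mem_PHom {d : ℕ} {k l : ℤ} (hl : l = k - 1) (i : Fin d) {p : Poly d}
    (hp : p ∈ PHom d k) : pderiv i p ∈ PHom d l := by
  refine pderiv_mem_restrictSupport i (fun m hm => ?_) hp
  simp only [Set.mem_ofPred_eq, Finsupp.add_apply, Finset.sum_add_distrib, sum_single,
    Nat.cast_add] at *
  omega

/-- Splitting off the top-degree part of a polynomial. -/
theorem P_le_sup {d : ℕ} (k : ℤ) : P d k ≤ PHom d k ⊔ P d (k - 1) := by
  rw [P, restrictSupport_eq_span, Submodule.span_le]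
  rintro _ ⟨m, hm, rfl⟩
  simp only [Set.mem_ofPred_eq] at hm
  rcases eq_or_lt_of_le hm with h | h
  · exact Submodule.mem_sup_left ((monomial_mem_restrictSupport ℝ).2 (.inl h))
  · exact Submodule.mem_sup_right
      ((monomial_mem_restrictSupport ℝ).2 (.inl (by simp only [Set.mem_ofPred_eq]; omega)))

theorem pderiv_pderiv_comm {d : ℕ} (i j : Fin d) (p : Poly d) :
    pderiv i (pderiv j p) = pderiv j (pderiv i p) := by
  ext m
  simp only [coeff_pderiv, Finsupp.add_apply]
  rw [add_right_comm]
  by_cases h : i = j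
  · subst h; rfl
  · rw [Finsupp.single_eq_of_ne h, Finsupp.single_eq_of_ne (Ne.symm h)]
    ring_nf

theorem grad_apply {d : ℕ} (p : Poly d) (i : Fin d) : grad d p i = pderiv i p := rfl

/-! ### Diagonal operators and closed fields -/

/-- The operator that multiplies the coefficient of each monomial `m` by `f m`. -/
def scale {d : ℕ} (f : (Fin d →₀ ℕ) → ℝ) : Poly d →ₗ[ℝ] Poly d :=
  (basisMonomials (Fin d) ℝ).constr ℝ fun m => f m • monomial m 1

theorem scale_monomial {d : ℕ} (f : (Fin d →₀ ℕ) → ℝ) (m : Fin d →₀ ℕ) :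
    scale f (monomial m 1) = f m • monomial m 1 := by
  have := (basisMonomials (Fin d) ℝ).constr_basis ℝ
    (fun m => f m • (monomial m 1 : Poly d)) m
  simpa [scale] using this

theorem coeff_scale {d : ℕ} (f : (Fin d →₀ ℕ) → ℝ) (p : Poly d) (m : Fin d →₀ ℕ) :
    coeff m (scale f p) = f m * coeff m p := by
  have : (lcoeff ℝ m) ∘ₗ scale f = f m • lcoeff ℝ m := by
    refine (basisMonomials (Fin d) ℝ).ext fun n => ?_
    simp only [coe_basisMonomials, LinearMap.comp_apply, scale_monomial, LinearMap.smul_apply,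
      lcoeff_apply, coeff_smul, coeff_monomial, smul_eq_mul]
    split_ifs with h
    · rw [h]
    · simp
  exact LinearMap.congr_fun this p

theorem scale_mem_restrictSupport {d : ℕ} (f : (Fin d →₀ ℕ) → ℝ) {s : Set (Fin d →₀ ℕ)}
    {p : Poly d} (hp : p ∈ restrictSupport ℝ s) : scale f p ∈ restrictSupport ℝ s := by
  rw [mem_restrictSupport] at *
  intro m hm
  rw [coeff_scale] at hm
  exact hp m (right_ne_zero_of_mul hm)

/-- Euler's identity `x · grad p = |m| p` on monomials of exponent `m`. -/
theorem euler {d : ℕ} (p : Poly d) :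
    ∑ i, X i * pderiv i p = scale (fun m => (∑ i, m i : ℕ)) p := by
  have : ∑ i, LinearMap.mulLeft ℝ (X i : Poly d) ∘ₗ (pderiv i).toLinearMap =
      scale (fun m => ((∑ i, m i : ℕ) : ℝ)) := by
    refine (basisMonomials (Fin d) ℝ).ext fun n => ?_
    simp only [coe_basisMonomials, LinearMap.sum_apply, LinearMap.comp_apply, scale_monomial,
      LinearMap.mulLeft_apply, Derivation.coeFn_coe, X_mul_pderiv_monomial]
    rw [← Finset.sum_smul, Nat.cast_smul_eq_nsmul]
  have h := LinearMap.congr_fun this p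
  simpa using h

theorem pderiv_scale_sum {d : ℕ} (i : Fin d) (p : Poly d) :
    pderiv i (scale (fun m => ((∑ j, m j : ℕ) : ℝ)) p) =
      scale (fun m => ((∑ j, m j : ℕ) : ℝ) + 1) (pderiv i p) := by
  ext m
  simp only [coeff_pderiv, coeff_scale, Finsupp.add_apply, Finset.sum_add_distrib, sum_single,
    Nat.cast_add, Nat.cast_one]
  ring

/-- The potential `∑_m |m|⁻¹ (x · v)_m x^m` of a closed polynomial field `v`. -/
def potential {d : ℕ} (v : VPoly d) : Poly d :=
  scale (fun m => ((∑ i, m i : ℕ) : ℝ)⁻¹) (∑ i, X i * v i)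

/-- The Poincaré lemma for polynomials: since `∂ᵢ(x · v) = (1 + x · ∇) vᵢ` for closed `v`,
dividing each monomial of `x · v` by its degree gives a potential. -/
theorem grad_potential {d : ℕ} {v : VPoly d} (hv : ∀ i j, pderiv i (v j) = pderiv j (v i)) :
    grad d (potential v) = v := by
  have h1 : ∀ i, pderiv i (∑ j, X j * v j) =
      scale (fun m => ((∑ j, m j : ℕ) : ℝ) + 1) (v i) := by
    intro i
    have h2 : scale (fun m => ((∑ j, m j : ℕ) : ℝ) + 1) (v i) =
        scale (fun m => ((∑ j, m j : ℕ) : ℝ)) (v i) + v i := by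
      ext m; simp only [coeff_scale, coeff_add]; ring
    rw [h2, ← euler]
    simp only [map_sum, Derivation.leibniz, smul_eq_mul, Finset.sum_add_distrib, hv i]
    congr 1
    simp [pderiv_X, Pi.single_apply]
  have h3 : scale (fun m => ((∑ j, m j : ℕ) : ℝ)) (potential v) = ∑ j, X j * v j := by
    ext m
    simp only [potential, coeff_scale]
    by_cases hm : m = 0
    · subst hm
      have h0 : coeff 0 (∑ i, X i * v i) = 0 := by
        rw [coeff_sum]
        exact Finset.sum_eq_zero fun i _ => by rw [coeff_X_mul']; simp
      simp [h0]
    · have : (∑ i, m i) ≠ 0 := by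
        intro h
        exact hm (Finsupp.ext fun i => by simpa using Finset.sum_eq_zero_iff.1 h i)
      rw [mul_inv_cancel_left₀ (by exact_mod_cast this)]
  ext i m
  have h4 := h1 i
  rw [← h3, pderiv_scale_sum] at h4
  have h5 := congrArg (coeff m) h4
  simp only [coeff_scale] at h5
  rw [grad_apply]
  exact mul_left_cancel₀ (by positivity) h5

/-! ### Integration of polynomials over boxes -/

/-- The open box with centre `c` and half side lengths `h`, in any dimension. -/
def box {d : ℕ} (c h : Fin d → ℝ) : Set (Fin d → ℝ) :=
  Set.pi Set.univ fun i => Set.Ioo (c i - h i) (c i + h i)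

theorem isOpen_box {d : ℕ} (c h : Fin d → ℝ) : IsOpen (box c h) :=
  isOpen_set_pi Set.finite_univ fun _ _ => isOpen_Ioo

theorem measurableSet_box {d : ℕ} (c h : Fin d → ℝ) : MeasurableSet (box c h) :=
  (isOpen_box c h).measurableSet

theorem integrableOn_box {d : ℕ} (c h : Fin d → ℝ) (p : Poly d) :
    IntegrableOn (fun x => eval x p) (box c h) := by
  refine IntegrableOn.mono_set (t := Set.Icc (fun i => c i - h i) fun i => c i + h i)
    ((MvPolynomial.continuous_eval p).continuousOn.integrableOn_compact isCompact_Icc) ?_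
  intro x hx
  exact ⟨fun i => (hx i trivial).1.le, fun i => (hx i trivial).2.le⟩

/-- The integral of a polynomial over a box, as a linear functional. -/
def boxInt {d : ℕ} (c h : Fin d → ℝ) : Poly d →ₗ[ℝ] ℝ where
  toFun p := ∫ x in box c h, eval x p
  map_add' p q := by
    simp only [map_add]
    exact integral_add (integrableOn_box c h p) (integrableOn_box c h q)
  map_smul' a p := by
    simp only [smul_eval]
    exact integral_const_mul a _

theorem boxInt_apply {d : ℕ} (c h : Fin d → ℝ) (p : Poly d) :
    boxInt c h p = ∫ x in box c h, eval x p := rfl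

theorem eq_zero_of_box {d : ℕ} {c h : Fin d → ℝ} (hh : ∀ i, 0 < h i) {p : Poly d}
    (hp : ∀ x ∈ box c h, eval x p = 0) : p = 0 := by
  refine MvPolynomial.funext_set (fun i => Set.Ioo (c i - h i) (c i + h i))
    (fun i => Set.Ioo_infinite (by linarith [hh i])) fun x hx => ?_
  rw [map_zero]
  exact hp x hx

/-- A weighted integral of a sum of squares vanishes only if the squares do. -/
theorem eq_zero_of_boxInt_sum_sq {d : ℕ} {ι : Type*} [Fintype ι] {c h : Fin d → ℝ}
    (hh : ∀ i, 0 < h i) {w : ι → Poly d} (hw : ∀ i, ∀ x ∈ box c h, 0 < eval x (w i))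
    {q : ι → Poly d} (hq : boxInt c h (∑ i, w i * (q i * q i)) = 0) : q = 0 := by
  have hnn : ∀ i, ∀ x ∈ box c h, 0 ≤ eval x (w i) * (eval x (q i) * eval x (q i)) :=
    fun i x hx => mul_nonneg (hw i x hx).le (mul_self_nonneg _)
  rw [boxInt_apply, setIntegral_eq_zero_iff_of_nonneg_ae
    ((ae_restrict_iff' (measurableSet_box c h)).2 (ae_of_all _ fun x hx => by
      simp only [map_mul, map_sum]
      exact Finset.sum_nonneg fun i _ => hnn i x hx))
    (integrableOn_box c h _)] at hq
  have h0 := Measure.eqOn_open_of_ae_eq hq (isOpen_box c h)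
    (MvPolynomial.continuous_eval _).continuousOn continuousOn_const
  funext i
  refine eq_zero_of_box (c := c) hh fun x hx => ?_
  have h1 := h0 hx
  simp only [map_mul, map_sum] at h1
  have h3 := (Finset.sum_eq_zero_iff_of_nonneg fun i _ => hnn i x hx).1 h1 i (Finset.mem_univ i)
  exact mul_self_eq_zero.1 ((mul_eq_zero.1 h3).resolve_left (hw i x hx).ne')

theorem eq_zero_of_boxInt_sq {d : ℕ} {c h : Fin d → ℝ}
    (hh : ∀ i, 0 < h i) {w : Poly d} (hw : ∀ x ∈ box c h, 0 < eval x w) {q : Poly d}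
    (hq : boxInt c h (w * (q * q)) = 0) : q = 0 := by
  have := eq_zero_of_boxInt_sum_sq (ι := Unit) (w := fun _ => w) (q := fun _ => q) hh
    (fun _ => hw) (by simpa using hq)
  exact congrFun this ()

theorem hasFDerivAt_eval {d : ℕ} (p : Poly d) (x : Fin d → ℝ) :
    HasFDerivAt (fun x => eval x p)
      (∑ k, eval x (pderiv k p) • (ContinuousLinearMap.proj k : (Fin d → ℝ) →L[ℝ] ℝ)) x := by
  induction p using MvPolynomial.induction_on with
  | C a => simpa using hasFDerivAt_const a x
  | add p q hp hq =>
    simp only [map_add, add_smul, Finset.sum_add_distrib]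
    exact hp.add hq
  | mul_X p i hp =>
    have hX : HasFDerivAt (fun x : Fin d → ℝ => x i) (ContinuousLinearMap.proj i) x :=
      (ContinuousLinearMap.proj (R := ℝ) (φ := fun _ : Fin d => ℝ) i).hasFDerivAt
    have := hp.mul hX
    simp only [map_mul, eval_X]
    refine this.congr_fderiv ?_
    ext y
    simp [Derivation.leibniz, pderiv_X, Pi.single_apply, add_mul, Finset.sum_add_distrib,
      Finset.mul_sum, mul_assoc, apply_ite, ite_mul]

theorem boxInt_pderiv_eq_zero {n : ℕ} {c h : Fin (n + 1) → ℝ} (hh : ∀ i, 0 < h i)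
    (i : Fin (n + 1)) {p : Poly (n + 1)}
    (hp : ∀ b x, x i = c i + sgn b * h i → eval x p = 0) : boxInt c h (pderiv i p) = 0 := by
  have key := integral_divergence_of_hasFDerivAt_off_countable' (E := ℝ)
    (fun i => c i - h i) (fun i => c i + h i) (fun i => by dsimp only; linarith [hh i])
    (fun j x => eval x (if j = i then p else 0))
    (fun j x => ∑ k, eval x (pderiv k (if j = i then p else 0)) •
      (ContinuousLinearMap.proj k : (Fin (n + 1) → ℝ) →L[ℝ] ℝ)) ∅ Set.countable_empty
    (fun j => (MvPolynomial.continuous_eval _).continuousOn)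
    (fun x _ j => hasFDerivAt_eval _ x) ?_
  · have h1 : ∀ x : Fin (n + 1) → ℝ, (∑ j, (∑ k, eval x (pderiv k (if j = i then p else 0)) •
        (ContinuousLinearMap.proj k : (Fin (n + 1) → ℝ) →L[ℝ] ℝ)) (Pi.single j 1)) =
        eval x (pderiv i p) := by
      intro x
      rw [Finset.sum_eq_single i]
      · rw [sum_apply, Finset.sum_eq_single i] <;>
          simp +contextual
      · intro j _ hj
        simp [hj]
      · simp
    simp only [h1] at key
    have hbox : box c h =ᵐ[volume] Set.Icc (fun i => c i - h i) fun i => c i + h i :=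
      Measure.univ_pi_Ioo_ae_eq_Icc
    rw [boxInt_apply, setIntegral_congr_set hbox, key]
    refine Finset.sum_eq_zero fun j _ => ?_
    by_cases hj : j = i
    · subst hj
      simp only [if_true]
      rw [integral_eq_zero_of_ae (ae_of_all _ fun y => hp true _ (by simp [sgn])),
        integral_eq_zero_of_ae (ae_of_all _ fun y => hp false _ (by simp [sgn, sub_eq_add_neg])),
        sub_zero]
    · simp [hj]
  · refine Continuous.integrableOn_Icc ?_
    simp only [sum_apply]
    refine continuous_finsetSum _ fun j _ => continuous_finsetSum _ fun k _ => ?_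
    simp only [smul_apply, smul_eq_mul]
    exact (MvPolynomial.continuous_eval _).mul continuous_const

/-- Integration by parts on a box for a product vanishing on the faces orthogonal to `x_i`. -/
theorem boxInt_pderiv_mul {n : ℕ} {c h : Fin (n + 1) → ℝ} (hh : ∀ i, 0 < h i)
    (i : Fin (n + 1)) {p : Poly (n + 1)} (q : Poly (n + 1))
    (hp : ∀ b x, x i = c i + sgn b * h i → eval x p = 0) :
    boxInt c h (pderiv i p * q) = -boxInt c h (p * pderiv i q) := by
  have := boxInt_pderiv_eq_zero (c := c) hh i (p := p * q) fun b x hx => by simp [hp b x hx]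
  rw [Derivation.leibniz, smul_eq_mul, smul_eq_mul, map_add] at this
  rw [mul_comm (pderiv i p)]
  linarith

/-! ### Vanishing on faces and divisibility -/

theorem sgn_mul_self (b : Bool) : sgn b * sgn b = 1 := by cases b <;> simp [sgn]

theorem sgn_ne_zero (b : Bool) : sgn b ≠ 0 := by cases b <;> simp [sgn]

theorem X_sub_C_dvd {d : ℕ} {k : Fin d} {a : ℝ} {p : Poly d}
    (hp : ∀ x : Fin d → ℝ, x k = a → eval x p = 0) : X k - C a ∣ p := by
  have h1 : ∀ q : Poly d, X k - C a ∣ q - bind₁ (Function.update X k (C a)) q := by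
    intro q
    induction q using MvPolynomial.induction_on with
    | C b => simp
    | add p q hp hq =>
      rw [map_add, add_sub_add_comm]
      exact dvd_add hp hq
    | mul_X p i hp =>
      rw [map_mul, bind₁_X_right]
      by_cases hi : i = k
      · subst hi
        rw [Function.update_self]
        have : p * X i - bind₁ (Function.update X i (C a)) p * C a =
          (p - bind₁ (Function.update X i (C a)) p) * C a + p * (X i - C a) := by ring
        rw [this]
        exact dvd_add (hp.mul_right _) (dvd_mul_left _ _)
      · rw [Function.update_of_ne hi, ← sub_mul]
        exact hp.mul_right _
  have h2 : bind₁ (Function.update X k (C a)) p = 0 := by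
    refine MvPolynomial.funext fun x => ?_
    rw [map_zero, eval, eval₂Hom_bind₁]
    refine hp _ ?_
    simp
  simpa [h2] using h1 p

/-- The affine function `h_k ∓ (x_k - c_k)` that vanishes on a face of a box, in any
dimension. -/
def lam {d : ℕ} (c h : Fin d → ℝ) (f : Fin d × Bool) : Poly d :=
  C (h f.1) - C (sgn f.2) * (X f.1 - C (c f.1))

theorem eval_lam {d : ℕ} (c h : Fin d → ℝ) (f : Fin d × Bool) (x : Fin d → ℝ) :
    eval x (lam c h f) = h f.1 - sgn f.2 * (x f.1 - c f.1) := by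
  simp [lam]

theorem eval_lam_eq_zero {d : ℕ} {c h : Fin d → ℝ} {f : Fin d × Bool} {x : Fin d → ℝ} :
    eval x (lam c h f) = 0 ↔ x f.1 = c f.1 + sgn f.2 * h f.1 := by
  rw [eval_lam]
  rcases f with ⟨k, _ | _⟩ <;> simp only [sgn] <;> constructor <;> intro h <;> norm_num at * <;>
    linarith

theorem lam_pos {d : ℕ} {c h : Fin d → ℝ} (f : Fin d × Bool) {x : Fin d → ℝ}
    (hx : x ∈ box c h) : 0 < eval x (lam c h f) := by
  rw [eval_lam]
  have := hx f.1 trivial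
  rw [Set.mem_Ioo] at this
  rcases f with ⟨k, _ | _⟩ <;> simp only [sgn] at * <;> norm_num <;> linarith

theorem lam_eq_mul {d : ℕ} (c h : Fin d → ℝ) (f : Fin d × Bool) :
    lam c h f = C (-sgn f.2) * (X f.1 - C (c f.1 + sgn f.2 * h f.1)) := by
  have : (C (sgn f.2) * C (sgn f.2) : Poly d) = 1 := by rw [← C_mul, sgn_mul_self, C_1]
  simp only [lam, C_add, C_mul, C_neg]
  linear_combination (-C (h f.1)) * this

theorem associated_lam {d : ℕ} (c h : Fin d → ℝ) (f : Fin d × Bool) :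
    Associated (X f.1 - C (c f.1 + sgn f.2 * h f.1)) (lam c h f) := by
  rw [lam_eq_mul]
  exact associated_unit_mul_right _ _
    ((isUnit_iff_ne_zero.2 (neg_ne_zero.2 (sgn_ne_zero _))).map C)

theorem lam_dvd_iff {d : ℕ} {c h : Fin d → ℝ} {f : Fin d × Bool} {p : Poly d} :
    lam c h f ∣ p ↔ ∀ x, x f.1 = c f.1 + sgn f.2 * h f.1 → eval x p = 0 := by
  constructor
  · rintro ⟨q, rfl⟩ x hx
    rw [map_mul, eval_lam_eq_zero.2 hx, zero_mul]
  · intro hp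
    exact (associated_lam c h f).dvd_iff_dvd_left.1 (X_sub_C_dvd hp)

theorem lam_ne_zero {d : ℕ} (c h : Fin d → ℝ) (f : Fin d × Bool) : lam c h f ≠ 0 := by
  intro h0
  have := congrArg (eval fun _ => c f.1 + sgn f.2 * h f.1 + 1) h0
  rw [map_zero, eval_lam_eq_zero] at this
  linarith

theorem prime_lam {d : ℕ} (c h : Fin d → ℝ) (f : Fin d × Bool) : Prime (lam c h f) := by
  refine ⟨lam_ne_zero c h f, fun hu => ?_, fun p q hpq => ?_⟩
  · obtain ⟨q, hq⟩ := hu.exists_right_inv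
    have := congrArg (eval fun _ => c f.1 + sgn f.2 * h f.1) hq
    rw [map_mul, eval_lam_eq_zero.2 rfl] at this
    simp at this
  · -- restriction to the hyperplane is a ring homomorphism into a domain
    set φ := bind₁ (Function.update (X : Fin d → Poly d) f.1 (C (c f.1 + sgn f.2 * h f.1)))
      with hφ
    have hdvd : ∀ r : Poly d, lam c h f ∣ r ↔ φ r = 0 := by
      intro r
      have hev : ∀ x, eval x (φ r) =
          eval (Function.update x f.1 (c f.1 + sgn f.2 * h f.1)) r := by
        intro x
        rw [hφ, eval, eval₂Hom_bind₁]
        congr 2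
        funext i
        by_cases hi : i = f.1
        · subst hi; simp
        · simp [hi]
      rw [lam_dvd_iff]
      constructor
      · intro hr
        refine MvPolynomial.funext fun x => ?_
        rw [hev, map_zero]
        exact hr _ (by simp)
      · intro hr x hx
        have := hev x
        rw [hr, map_zero, ← hx, Function.update_eq_self] at this
        exact this.symm
    simp only [hdvd] at *
    rw [map_mul] at hpq
    exact mul_eq_zero.1 hpq

theorem not_lam_dvd_lam {d : ℕ} {c h : Fin d → ℝ} (hh : ∀ i, 0 < h i) {f g : Fin d × Bool}
    (hfg : f ≠ g) : ¬ lam c h f ∣ lam c h g := by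
  rw [lam_dvd_iff]
  intro H
  have h1 := H (Function.update (fun i => c i + sgn g.2 * h i + 1) f.1
    (c f.1 + sgn f.2 * h f.1)) (by simp)
  rw [eval_lam_eq_zero] at h1
  by_cases hk : g.1 = f.1
  · rw [hk, Function.update_self] at h1
    have h2 : sgn f.2 = sgn g.2 := mul_right_cancel₀ (hh f.1).ne' (add_left_cancel h1)
    apply hfg
    refine Prod.ext hk.symm ?_
    revert h2
    rcases f with ⟨_, _ | _⟩ <;> rcases g with ⟨_, _ | _⟩ <;> simp [sgn] <;> norm_num
  · rw [Function.update_of_ne hk] at h1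
    linarith

theorem prod_lam_dvd {d : ℕ} {c h : Fin d → ℝ} (hh : ∀ i, 0 < h i) (s : Finset (Fin d × Bool))
    {p : Poly d} (hp : ∀ f ∈ s, ∀ x, x f.1 = c f.1 + sgn f.2 * h f.1 → eval x p = 0) :
    ∏ f ∈ s, lam c h f ∣ p := by
  refine Finset.prod_dvd_of_isRelPrime (fun f _ g _ hfg => ?_) fun f hf => lam_dvd_iff.2 (hp f hf)
  exact (prime_lam c h f).irreducible.isRelPrime_iff_not_dvd.2 (not_lam_dvd_lam hh hfg)

/-- The bubble function of a box: the product of the affine functions of all its faces. -/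
def bubble {d : ℕ} (c h : Fin d → ℝ) : Poly d := ∏ f, lam c h f

theorem bubble_pos {d : ℕ} {c h : Fin d → ℝ} {x : Fin d → ℝ} (hx : x ∈ box c h) :
    0 < eval x (bubble c h) := by
  rw [bubble, map_prod]
  exact Finset.prod_pos fun f _ => lam_pos f hx

theorem eval_bubble_eq_zero {d : ℕ} {c h : Fin d → ℝ} {x : Fin d → ℝ} (f : Fin d × Bool)
    (hx : x f.1 = c f.1 + sgn f.2 * h f.1) : eval x (bubble c h) = 0 := by
  rw [bubble, map_prod]
  exact Finset.prod_eq_zero (Finset.mem_univ f) (eval_lam_eq_zero.2 hx)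

/-! ### Gradients with vanishing tangential trace -/

/-- The superlinear degree of a monomial in any number of variables. -/
def superlin {d : ℕ} (m : Fin d →₀ ℕ) : ℕ := ∑ i, if m i = 1 then 0 else m i

/-- The serendipity space of polynomials of superlinear degree at most `r`, in any number of
variables. -/
def SL (d r : ℕ) : Submodule ℝ (Poly d) := restrictSupport ℝ {m | superlin m ≤ r}

theorem mem_SL {d r : ℕ} {p : Poly d} : p ∈ SL d r ↔ ∀ m, coeff m p ≠ 0 → superlin m ≤ r :=
  mem_restrictSupport

/-- The tangential components of `v` vanish on every face of the box: `v_j` vanishes on the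
faces that are not orthogonal to the `x_j` axis. -/
def TangentiallyZero {d : ℕ} (c h : Fin d → ℝ) (v : VPoly d) : Prop :=
  ∀ j k, k ≠ j → ∀ b x, x k = c k + sgn b * h k → eval x (v j) = 0

theorem eval_eq_of_pderiv_eq_zero {d : ℕ} {k : Fin d} {a : ℝ} {φ : Poly d}
    (hφ : ∀ j, k ≠ j → ∀ x : Fin d → ℝ, x k = a → eval x (pderiv j φ) = 0)
    {x y : Fin d → ℝ} (hx : x k = a) (hy : y k = a) : eval x φ = eval y φ := by
  have hd : ∀ t : ℝ, HasDerivAt (fun t : ℝ => eval (x + t • (y - x)) φ) 0 t := by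
    intro t
    have hpath : HasDerivAt (fun t : ℝ => x + t • (y - x)) (y - x) t := by
      simpa using ((hasDerivAt_id t).smul_const (y - x)).const_add x
    have hc := (hasFDerivAt_eval φ (x + t • (y - x))).comp_hasDerivAt t hpath
    refine hc.congr_deriv ?_
    rw [sum_apply]
    refine Finset.sum_eq_zero fun j _ => ?_
    by_cases hj : k = j
    · subst hj
      simp [hx, hy]
    · simp [hφ j hj (x + t • (y - x)) (by simp [hx, hy])]
  have := is_const_of_deriv_eq_zero (fun t => (hd t).differentiableAt) (fun t => (hd t).deriv) 0 1
  simpa using this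

/-- A polynomial whose gradient has vanishing tangential trace is constant on the boundary. -/
theorem exists_eq_C_add_bubble_mul {n : ℕ} {c h : Fin (n + 2) → ℝ} (hh : ∀ i, 0 < h i)
    {φ : Poly (n + 2)} (hφ : TangentiallyZero c h (grad (n + 2) φ)) :
    ∃ a g, φ = C a + bubble c h * g := by
  set x₀ : Fin (n + 2) → ℝ := fun i => c i + h i with hx₀
  have hconst : ∀ k b (x y : Fin (n + 2) → ℝ), x k = c k + sgn b * h k →
      y k = c k + sgn b * h k → eval x φ = eval y φ := fun k b x y hx hy =>
    eval_eq_of_pderiv_eq_zero (fun j hj x hx => hφ j k hj b x hx) hx hy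
  have hall : ∀ (f : Fin (n + 2) × Bool) x, x f.1 = c f.1 + sgn f.2 * h f.1 →
      eval x φ = eval x₀ φ := by
    rintro ⟨k, b⟩ x hx
    obtain ⟨l, hl⟩ := exists_ne k
    -- the face `(k, b)` meets the face `(l, true)`, which contains the corner `x₀`
    rw [hconst k b x (Function.update x₀ k (c k + sgn b * h k)) hx (by simp)]
    exact hconst l true _ _ (by rw [Function.update_of_ne hl]; simp [hx₀, sgn])
      (by simp [hx₀, sgn])
  obtain ⟨g, hg⟩ := prod_lam_dvd hh Finset.univ (p := φ - C (eval x₀ φ))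
    (fun f _ x hx => by simp [hall f x hx])
  exact ⟨eval x₀ φ, g, by rw [bubble, ← hg]; ring⟩

theorem degLex_lam {d : ℕ} (c h : Fin d → ℝ) (f : Fin d × Bool) :
    MonomialOrder.degLex.degree (lam c h f) = Finsupp.single f.1 1 := by
  have hX : (X f.1 - C (c f.1 + sgn f.2 * h f.1) : Poly d) ≠ 0 := fun h0 =>
    lam_ne_zero c h f (by rw [lam_eq_mul, h0, mul_zero])
  rw [lam_eq_mul, MonomialOrder.degree_mul (by simpa using sgn_ne_zero f.2) hX,
    MonomialOrder.degree_C, zero_add, MonomialOrder.degree_X_sub_C]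

theorem degLex_bubble {d : ℕ} (c h : Fin d → ℝ) (i : Fin d) :
    MonomialOrder.degLex.degree (bubble c h) i = 2 := by
  have : MonomialOrder.degLex.degree (bubble c h) =
      ∑ f : Fin d × Bool, Finsupp.single f.1 1 := by
    rw [bubble, MonomialOrder.degree_prod_of_mem_nonZeroDivisors]
    · simp only [degLex_lam]
    · intro f _
      rw [mem_nonZeroDivisors_iff_ne_zero]
      exact MonomialOrder.leadingCoeff_ne_zero_iff.2 (lam_ne_zero c h f)
  rw [this, Finsupp.finsetSum_apply, Fintype.sum_prod_type]
  simp [Finsupp.single_apply]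

theorem bubble_ne_zero {d : ℕ} (c h : Fin d → ℝ) : bubble c h ≠ 0 :=
  Finset.prod_ne_zero_iff.2 fun f _ => lam_ne_zero c h f

/-- The leading monomial of a multiple of the bubble function contains the square of every
variable, so that its superlinear degree is its degree. -/
theorem mem_P_of_bubble_mul {d r : ℕ} (hd : 0 < d) {c h : Fin d → ℝ} {a : ℝ} {g : Poly d}
    (hφ : C a + bubble c h * g ∈ SL d r) : g ∈ P d ((r : ℤ) - 2 * d) := by
  by_cases hg : g = 0
  · rw [hg]; exact zero_mem _
  have hBg := mul_ne_zero (bubble_ne_zero c h) hg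
  set m := MonomialOrder.degLex.degree (bubble c h * g) with hm
  have hmi : ∀ i, m i = 2 + MonomialOrder.degLex.degree g i := by
    intro i
    rw [hm, MonomialOrder.degree_mul (bubble_ne_zero c h) hg, Finsupp.add_apply, degLex_bubble]
  have hm0 : m ≠ 0 := by
    intro h0
    have := hmi ⟨0, hd⟩
    rw [h0] at this
    simp at this
    omega
  have hc : coeff m (C a + bubble c h * g) ≠ 0 := by
    rw [coeff_add, coeff_C, if_neg hm0.symm, zero_add]
    exact mem_support_iff.1 (MonomialOrder.degree_mem_support hBg)
  have h1 := mem_SL.1 hφ m hc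
  have h2 : superlin m = 2 * d + (MonomialOrder.degLex.degree g).degree := by
    rw [superlin, Finsupp.degree_eq_sum]
    have : ∀ i, (if m i = 1 then 0 else m i) = 2 + MonomialOrder.degLex.degree g i := by
      intro i
      rw [hmi, if_neg (by omega)]
    simp only [this, Finset.sum_add_distrib]
    simp [mul_comm]
  rw [degree_degLexDegree] at h2
  rw [mem_P]
  intro k hk
  have h3 := le_totalDegree (mem_support_iff.2 hk)
  rw [Finsupp.sum_fintype _ _ (by simp)] at h3
  omega

/-- A gradient of a serendipity polynomial with vanishing tangential trace is zero if it is
orthogonal to the polynomial fields of degree `r - 2 d + 1`: the potential is `B g` up to a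
constant, and `g` is the divergence of such a field. -/
theorem grad_eq_zero {n r : ℕ} {c h : Fin (n + 2) → ℝ} (hh : ∀ i, 0 < h i)
    {φ : Poly (n + 2)} (hS : φ ∈ SL (n + 2) r) (hφ : TangentiallyZero c h (grad (n + 2) φ))
    (hm : ∀ q ∈ VP (n + 2) ((r : ℤ) - 2 * (n + 2) + 1),
      boxInt c h (∑ i, grad (n + 2) φ i * q i) = 0) :
    grad (n + 2) φ = 0 := by
  obtain ⟨a, g, rfl⟩ := exists_eq_C_add_bubble_mul hh hφ
  have hg := mem_P_of_bubble_mul (by omega) hS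
  push_cast at hg
  set G := scale (fun m => (((∑ i, m i : ℕ) : ℝ) + (n + 2))⁻¹) g with hG
  have hdiv : ∑ i, pderiv i (X i * G) = g := by
    simp only [Derivation.leibniz, smul_eq_mul, Finset.sum_add_distrib, euler]
    ext m
    simp only [pderiv_X, Pi.single_eq_same, mul_one, Finset.sum_const, Finset.card_univ,
      Fintype.card_fin, coeff_add, coeff_scale, hG, nsmul_eq_mul]
    rw [← map_natCast C, coeff_C_mul, coeff_scale]
    have : ((∑ i, m i : ℕ) : ℝ) + (n + 2) ≠ 0 := by positivity
    rw [← add_mul]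
    push_cast at *
    rw [← mul_assoc, mul_inv_cancel₀ this, one_mul]
  have h1 := hm (fun i => X i * G) (mem_VP.2 fun i =>
    mul_mem_P (by linarith) (X_mem_P i) (scale_mem_restrictSupport _ hg))
  have h2 : boxInt c h (∑ i, grad (n + 2) (C a + bubble c h * g) i * (X i * G)) =
      -boxInt c h (bubble c h * (g * g)) := by
    rw [map_sum]
    have : ∀ i, boxInt c h (grad (n + 2) (C a + bubble c h * g) i * (X i * G)) =
        -boxInt c h (bubble c h * g * pderiv i (X i * G)) := by
      intro i
      rw [grad_apply, map_add, pderiv_C, zero_add, boxInt_pderiv_mul hh]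
      intro b x hx
      rw [map_mul, eval_bubble_eq_zero (i, b) hx, zero_mul]
    simp only [this]
    rw [Finset.sum_neg_distrib, ← map_sum, ← Finset.mul_sum, hdiv, mul_assoc]
  rw [h2, neg_eq_zero] at h1
  have h3 := eq_zero_of_boxInt_sq hh (fun x hx => bubble_pos hx) h1
  rw [h3, mul_zero, add_zero]
  ext i : 1
  rw [grad_apply, pderiv_C]
  rfl

/-! ### The face problem -/

theorem grad_mem_faceTest {r : ℕ} {ψ : Poly 2} (hψ : ψ ∈ P 2 ((r : ℤ) - 1)) :
    grad 2 ψ ∈ faceTest r := by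
  obtain ⟨a, ha, b, hb, rfl⟩ := Submodule.mem_sup.1 (P_le_sup _ hψ)
  rw [map_add]
  refine add_mem (Submodule.mem_sup_right (Submodule.mem_map_of_mem ha))
    (Submodule.mem_sup_left (mem_VP.2 fun i => pderiv_mem_P (by linarith) i hb))

/-- The two-dimensional problem: a field with zero tangential trace whose scalar curl has degree
at most `r - 1` is determined by its moments. Testing with the rotated gradient of the curl
removes the curl, so that the field is a gradient. -/
theorem eq_zero_of_faceTest {r : ℕ} {c h : Fin 2 → ℝ} (hh : ∀ i, 0 < h i) {v : VPoly 2}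
    (hv : TangentiallyZero c h v) (hcurl : pderiv 0 (v 1) - pderiv 1 (v 0) ∈ P 2 ((r : ℤ) - 1))
    (hrad : ∑ i, X i * v i ∈ SL 2 r)
    (hm : ∀ q ∈ faceTest r, boxInt c h (v 1 * q 0 - v 0 * q 1) = 0) : v = 0 := by
  set ψ := pderiv 0 (v 1) - pderiv 1 (v 0) with hψ
  have h1 := hm _ (grad_mem_faceTest hcurl)
  have h2 : boxInt c h (v 1 * grad 2 ψ 0 - v 0 * grad 2 ψ 1) = -boxInt c h (1 * (ψ * ψ)) := by
    have e0 := boxInt_pderiv_mul hh 0 ψ (hv 1 0 (by decide))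
    have e1 := boxInt_pderiv_mul hh 1 ψ (hv 0 1 (by decide))
    have hsq : ψ * ψ = pderiv 0 (v 1) * ψ - pderiv 1 (v 0) * ψ := by rw [← sub_mul]
    rw [one_mul, hsq, map_sub (boxInt c h), map_sub (boxInt c h), e0, e1, grad_apply, grad_apply]
    ring
  rw [h2, neg_eq_zero] at h1
  have h3 : ψ = 0 := eq_zero_of_boxInt_sq hh (by simp) h1
  have hclosed : ∀ i j, pderiv i (v j) = pderiv j (v i) := by
    have h01 : pderiv 0 (v 1) = pderiv 1 (v 0) := sub_eq_zero.1 h3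
    intro i j
    fin_cases i <;> fin_cases j <;> first | rfl | exact h01 | exact h01.symm
  have hpot := grad_potential hclosed
  rw [← hpot] at hv ⊢
  refine grad_eq_zero (n := 0) (r := r) hh (scale_mem_restrictSupport _ hrad) hv ?_
  intro q hq
  rw [hpot]
  have hq' : ![q 1, -q 0] ∈ faceTest r := by
    refine Submodule.mem_sup_left (mem_VP.2 fun i => ?_)
    have hq0 := mem_VP.1 hq
    have hle : P 2 ((r : ℤ) - 2 * ((0 : ℕ) + 2) + 1) ≤ P 2 ((r : ℤ) - 3) :=
      P_mono (by push_cast; linarith)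
    fin_cases i
    · exact hle (hq0 1)
    · exact neg_mem (hle (hq0 0))
  have := hm _ hq'
  rw [Fin.sum_univ_two]
  convert this using 2
  simp
  ring

/-! ### The fields of the space `S^1` -/

theorem crossRight_apply (p v : VPoly 3) : crossRight v p =
    ![p 1 * v 2 - p 2 * v 1, p 2 * v 0 - p 0 * v 2, p 0 * v 1 - p 1 * v 0] := by
  change p ⨯₃ v = _
  rw [cross_apply]

theorem wField_apply (w : VPoly 3) : wField w =
    ![X 1 * X 2 * (w 1 - w 2), X 0 * X 2 * (w 2 - w 0), X 0 * X 1 * (w 0 - w 1)] := rfl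

theorem curl_apply (u : VPoly 3) : curl u =
    ![pderiv 1 (u 2) - pderiv 2 (u 1), pderiv 2 (u 0) - pderiv 0 (u 2),
      pderiv 0 (u 1) - pderiv 1 (u 0)] := rfl

theorem mem_W {k : ℤ} {w : VPoly 3} : w ∈ W k ↔
    ∀ i, w i ∈ restrictSupport ℝ {m | ((∑ j, m j : ℕ) : ℤ) = k ∧ m i = 0} := by
  simp [W, Submodule.mem_pi]

theorem exists_of_mem_S1 {r : ℕ} {u : VPoly 3} (hu : u ∈ S1 r) :
    ∃ φ ∈ S0 r, ∃ p ∈ VP 3 ((r : ℤ) - 1), ∃ w ∈ W ((r : ℤ) - 1),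
      u = grad 3 φ + crossRight X p + wField w := by
  obtain ⟨a, ha, b, hb, rfl⟩ := Submodule.mem_sup.1 hu
  obtain ⟨e, he, d, hd, rfl⟩ := Submodule.mem_sup.1 ha
  obtain ⟨φ, hφ, rfl⟩ := he
  obtain ⟨p, hp, rfl⟩ := hd
  obtain ⟨w, hw, rfl⟩ := hb
  exact ⟨φ, hφ, p, hp, w, hw, rfl⟩

theorem sum_X_mul_crossRight (p : VPoly 3) : ∑ i, X i * crossRight X p i = 0 := by
  rw [crossRight_apply, Fin.sum_univ_three]
  simp
  ring

theorem sum_X_mul_wField (w : VPoly 3) : ∑ i, X i * wField w i = 0 := by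
  rw [wField_apply, Fin.sum_univ_three]
  simp
  ring

theorem sum_X_mul_mem_S0 {r : ℕ} {u : VPoly 3} (hu : u ∈ S1 r) :
    ∑ i, X i * u i ∈ SL 3 r := by
  obtain ⟨φ, hφ, p, hp, w, hw, rfl⟩ := exists_of_mem_S1 hu
  have : ∑ i, X i * (grad 3 φ + crossRight X p + wField w) i = ∑ i, X i * pderiv i φ := by
    simp only [Pi.add_apply, mul_add, Finset.sum_add_distrib, sum_X_mul_crossRight,
      sum_X_mul_wField, add_zero, grad_apply]
  rw [this, euler]
  exact scale_mem_restrictSupport _ hφ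

/-- The monomials of the `i`-th component of a field in `S^1`: the degree in `x_i` is at most
`r - 1`, and the superlinear degree in the other two variables `x_j`, `x_k` at most `r`. -/
def compSupport (r : ℕ) (i j k : Fin 3) : Set (Fin 3 →₀ ℕ) :=
  {m | m i + 1 ≤ r ∧ (if m j = 1 then 0 else m j) + (if m k = 1 then 0 else m k) ≤ r}

theorem comp_mem_of_parts {r : ℕ} (hr : 2 ≤ r) {i j k : Fin 3} (hij : i ≠ j) (hik : i ≠ k)
    (hjk : j ≠ k) (hsum : ∀ f : Fin 3 → ℕ, ∑ l, f l = f i + f j + f k)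
    {φ : Poly 3} (hφ : φ ∈ S0 r) {p : VPoly 3} (hp : p ∈ VP 3 ((r : ℤ) - 1))
    {w : VPoly 3} (hw : w ∈ W ((r : ℤ) - 1)) :
    pderiv i φ + (p j * X k - p k * X j) + X j * X k * (w j - w k) ∈
      restrictSupport ℝ (compSupport r i j k) := by
  rw [mem_VP] at hp
  rw [mem_W] at hw
  have hX : X j * X k ∈ restrictSupport ℝ {Finsupp.single j 1 + Finsupp.single k 1} := by
    have : (X j * X k : Poly 3) = monomial (Finsupp.single j 1 + Finsupp.single k 1) 1 := by
      simp [X, monomial_mul]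
    rw [this]
    exact (monomial_mem_restrictSupport ℝ).2 (.inl rfl)
  refine add_mem (add_mem ?_ (sub_mem ?_ ?_)) (mul_sub (X j * X k) (w j) (w k) ▸ sub_mem ?_ ?_)
  · refine pderiv_mem_restrictSupport i (fun m hm => ?_) hφ
    simp only [Set.mem_ofPred_eq, superlinearDegree, hsum, Finsupp.add_apply,
      Finsupp.single_eq_same, Finsupp.single_eq_of_ne hij.symm,
      Finsupp.single_eq_of_ne hik.symm, compSupport, add_zero] at hm ⊢
    constructor
    · split_ifs at hm <;> omega
    · omega
  · refine mul_mem_restrictSupport (fun a ha b hb => ?_) (hp j)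
      (X_mem_restrictSupport (s := {Finsupp.single k 1}) k rfl)
    rw [Set.mem_singleton_iff.1 hb]
    simp only [Set.mem_ofPred_eq, hsum, Finsupp.add_apply,
      Finsupp.single_eq_same, Finsupp.single_eq_of_ne hik,
      Finsupp.single_eq_of_ne hjk, compSupport, add_zero] at ha ⊢
    split_ifs <;> omega
  · refine mul_mem_restrictSupport (fun a ha b hb => ?_) (hp k)
      (X_mem_restrictSupport (s := {Finsupp.single j 1}) j rfl)
    rw [Set.mem_singleton_iff.1 hb]
    simp only [Set.mem_ofPred_eq, hsum, Finsupp.add_apply,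
      Finsupp.single_eq_same, Finsupp.single_eq_of_ne hij,
      Finsupp.single_eq_of_ne hjk.symm, compSupport, add_zero] at ha ⊢
    split_ifs <;> omega
  all_goals
    refine mul_mem_restrictSupport (fun b hb a ha => ?_) hX (hw _)
    rw [Set.mem_singleton_iff.1 hb]
    simp only [Set.mem_ofPred_eq, hsum, Finsupp.add_apply,
      Finsupp.single_eq_same, Finsupp.single_eq_of_ne hij, Finsupp.single_eq_of_ne hik,
      Finsupp.single_eq_of_ne hjk, Finsupp.single_eq_of_ne hjk.symm, compSupport, add_zero,
      zero_add] at ha ⊢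
    split_ifs <;> omega

theorem comp_mem {r : ℕ} (hr : 2 ≤ r) {u : VPoly 3} (hu : u ∈ S1 r) (i : Fin 3) :
    u i ∈ restrictSupport ℝ (compSupport r i (i.succAbove 0) (i.succAbove 1)) := by
  obtain ⟨φ, hφ, p, hp, w, hw, rfl⟩ := exists_of_mem_S1 hu
  rw [crossRight_apply, wField_apply]
  fin_cases i
  · exact comp_mem_of_parts hr (i := 0) (j := 1) (k := 2) (by decide) (by decide) (by decide)
      (fun f => by rw [Fin.sum_univ_three]) hφ hp hw
  · have := comp_mem_of_parts hr (i := 1) (j := 0) (k := 2) (by decide) (by decide) (by decide)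
      (fun f => by rw [Fin.sum_univ_three]; ring) hφ (neg_mem hp) (neg_mem hw)
    convert this using 1
    · rfl
    change pderiv 1 φ + (p 2 * X 0 - p 0 * X 2) + X 0 * X 2 * (w 2 - w 0) = _
    simp only [Pi.neg_apply]
    ring
  · exact comp_mem_of_parts hr (i := 2) (j := 0) (k := 1) (by decide) (by decide) (by decide)
      (fun f => by rw [Fin.sum_univ_three]; ring) hφ hp hw

theorem curl_grad (φ : Poly 3) : curl (grad 3 φ) = 0 := by
  rw [curl_apply]
  simp only [grad_apply]
  rw [pderiv_pderiv_comm 1 2, pderiv_pderiv_comm 2 0, pderiv_pderiv_comm 0 1]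
  ext i : 1
  fin_cases i <;> simp

theorem curl_mem_VP {k l : ℤ} (hl : k - 1 ≤ l) {u : VPoly 3} (hu : u ∈ VP 3 k) :
    curl u ∈ VP 3 l := by
  rw [mem_VP] at *
  rw [curl_apply]
  intro i
  fin_cases i <;> exact sub_mem (pderiv_mem_P hl _ (hu _)) (pderiv_mem_P hl _ (hu _))

theorem crossRight_X_mem_VP {k l : ℤ} (hl : k + 1 ≤ l) {p : VPoly 3} (hp : p ∈ VP 3 k) :
    crossRight X p ∈ VP 3 l := by
  rw [mem_VP] at *
  rw [crossRight_apply]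
  intro i
  fin_cases i <;>
    exact sub_mem (mul_mem_P hl (hp _) (X_mem_P _)) (mul_mem_P hl (hp _) (X_mem_P _))

theorem pderiv_of_mem_W {k : ℤ} {w : VPoly 3} (hw : w ∈ W k) (i : Fin 3) :
    pderiv i (w i) = 0 := by
  ext m
  rw [coeff_pderiv, coeff_zero]
  by_contra h
  have := (mem_restrictSupport.1 (mem_W.1 hw i) _ (left_ne_zero_of_mul h)).2
  simp at this

theorem euler_of_mem_W {k : ℤ} {w : VPoly 3} (hw : w ∈ W k) (i : Fin 3) :
    ∑ j, X j * pderiv j (w i) = C (k : ℝ) * w i := by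
  rw [euler]
  ext m
  rw [coeff_scale, coeff_C_mul]
  by_cases h : coeff m (w i) = 0
  · simp [h]
  · rw [← (mem_restrictSupport.1 (mem_W.1 hw i) _ h).1, Int.cast_natCast]

theorem curl_wField {k : ℤ} {w : VPoly 3} (hw : w ∈ W k) (i : Fin 3) :
    curl (wField w) i = X i * (C ((k : ℝ) + 3) * w i - ∑ j, w j) := by
  have e := euler_of_mem_W hw i
  have d0 := pderiv_of_mem_W hw 0
  have d1 := pderiv_of_mem_W hw 1
  have d2 := pderiv_of_mem_W hw 2
  rw [Fin.sum_univ_three] at e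
  rw [curl_apply, wField_apply, Fin.sum_univ_three, C_add]
  have h3 : (C 3 : Poly 3) = 3 := map_ofNat C 3
  rw [h3]
  fin_cases i <;>
    simp [Derivation.leibniz, pderiv_X, d0, d1, d2] at e ⊢
  · linear_combination X 0 * e
  · linear_combination X 1 * e
  · linear_combination X 2 * e

/-! ### The cell problem -/

theorem mem_P_of_lam_mul {d : ℕ} {k : ℤ} {c h : Fin d → ℝ} {f : Fin d × Bool} {q : Poly d}
    (hq : lam c h f * q ∈ P d k) : q ∈ P d (k - 1) := by
  by_cases h0 : q = 0
  · rw [h0]; exact zero_mem _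
  have hne := mul_ne_zero (lam_ne_zero c h f) h0
  have h1 := mem_P.1 hq _ (mem_support_iff.1
    (MonomialOrder.degree_mem_support (m := MonomialOrder.degLex) hne))
  rw [MonomialOrder.degree_mul (lam_ne_zero c h f) h0, degLex_lam] at h1
  simp only [Finsupp.add_apply, Finset.sum_add_distrib, sum_single] at h1
  rw [← Finsupp.degree_eq_sum, degree_degLexDegree] at h1
  rw [mem_P]
  intro m hm
  have h3 := le_totalDegree (mem_support_iff.2 hm)
  rw [Finsupp.sum_fintype _ _ (by simp)] at h3
  omega

theorem lam_dvd_pderiv {d : ℕ} {c h : Fin d → ℝ} {f : Fin d × Bool} {j : Fin d} (hj : j ≠ f.1)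
    {p : Poly d} (hp : lam c h f ∣ p) : lam c h f ∣ pderiv j p := by
  obtain ⟨q, rfl⟩ := hp
  have : pderiv j (lam c h f) = 0 := by
    simp [lam, pderiv_X, Derivation.leibniz, Pi.single_eq_of_ne hj.symm]
  rw [Derivation.leibniz, this, smul_zero, add_zero]
  exact dvd_mul_right _ _

theorem lam_dvd_of_tangentiallyZero {d : ℕ} {c h : Fin d → ℝ} {v : VPoly d}
    (hv : TangentiallyZero c h v) {j k : Fin d} (hkj : k ≠ j) (b : Bool) :
    lam c h (k, b) ∣ v j := lam_dvd_iff.2 (hv j k hkj b)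

/-- The normal component of the curl of a field with zero tangential trace vanishes on the
faces. -/
theorem lam_dvd_curl {c h : Fin 3 → ℝ} {u : VPoly 3} (hu : TangentiallyZero c h u)
    (f : Fin 3 × Bool) : lam c h f ∣ curl u f.1 := by
  have key : ∀ i b j k, j ≠ i → k ≠ i → lam c h (i, b) ∣ pderiv j (u k) := fun i b j k hj hk =>
    lam_dvd_pderiv hj (lam_dvd_of_tangentiallyZero hu hk.symm b)
  rw [curl_apply]
  obtain ⟨i, b⟩ := f
  fin_cases i
  · exact dvd_sub (key 0 b 1 2 (by decide) (by decide)) (key 0 b 2 1 (by decide) (by decide))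
  · exact dvd_sub (key 1 b 2 0 (by decide) (by decide)) (key 1 b 0 2 (by decide) (by decide))
  · exact dvd_sub (key 2 b 0 1 (by decide) (by decide)) (key 2 b 1 0 (by decide) (by decide))

/-- The product of the affine functions of the two faces orthogonal to the `x_i` axis. -/
def slab {d : ℕ} (c h : Fin d → ℝ) (i : Fin d) : Poly d := lam c h (i, true) * lam c h (i, false)

theorem slab_pos {d : ℕ} {c h : Fin d → ℝ} (i : Fin d) {x : Fin d → ℝ} (hx : x ∈ box c h) :
    0 < eval x (slab c h i) := by
  rw [slab, map_mul]
  exact mul_pos (lam_pos _ hx) (lam_pos _ hx)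

theorem mem_P_of_slab_mul {d : ℕ} {k : ℤ} {c h : Fin d → ℝ} {i : Fin d} {q : Poly d}
    (hq : slab c h i * q ∈ P d k) : q ∈ P d (k - 2) := by
  rw [slab, mul_assoc] at hq
  have := mem_P_of_lam_mul (mem_P_of_lam_mul hq)
  rwa [sub_sub, one_add_one_eq_two] at this

theorem slab_dvd_curl {c h : Fin 3 → ℝ} (hh : ∀ i, 0 < h i) {u : VPoly 3}
    (hu : TangentiallyZero c h u) (i : Fin 3) : slab c h i ∣ curl u i := by
  have := prod_lam_dvd hh {(i, true), (i, false)} (p := curl u i) (by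
    intro f hf
    have hfi : f.1 = i := by
      simp only [Finset.mem_insert, Finset.mem_singleton] at hf
      rcases hf with rfl | rfl <;> rfl
    have := lam_dvd_iff.1 (lam_dvd_curl hu f)
    rwa [hfi] at this ⊢)
  rwa [Finset.prod_pair (by simp)] at this

/-- A multiple of `slab i` has no monomials of top degree in which `x_i` enters linearly. -/
theorem coeff_slab_mul {d : ℕ} {k : ℤ} {c h : Fin d → ℝ} {i : Fin d} {g : Poly d}
    (hg : g ∈ P d (k - 1)) {m : Fin d →₀ ℕ} (hm : ((∑ j, m j : ℕ) : ℤ) = k) (hmi : m i = 0) :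
    coeff (Finsupp.single i 1 + m) (slab c h i * g) = 0 := by
  have h1 : slab c h i * g = -(X i * (X i * g)) +
      (C (2 * c i) * (X i * g) + C (h i * h i - c i * c i) * g) := by
    simp only [slab, lam, sgn, map_mul, map_sub, if_true, Bool.false_eq_true, if_false, map_neg,
      C_1]
    have : (C 2 : Poly d) = 2 := map_ofNat C 2
    rw [this]
    ring
  have h2 : C (2 * c i) * (X i * g) + C (h i * h i - c i * c i) * g ∈ P d k :=
    add_mem (C_mul_mem _ (mul_mem_P (by linarith) (X_mem_P i) hg))
      (C_mul_mem _ (P_mono (by linarith) hg))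
  have h3 : coeff (Finsupp.single i 1 + m)
      (C (2 * c i) * (X i * g) + C (h i * h i - c i * c i) * g) = 0 := by
    by_contra hne
    have := mem_P.1 h2 _ hne
    simp only [Finsupp.add_apply, Finset.sum_add_distrib, sum_single] at this
    push_cast at this hm
    omega
  rw [h1, coeff_add, h3, coeff_neg, coeff_X_mul, coeff_X_mul', if_neg (by simp [hmi])]
  simp

theorem curl_of_mem_S1 {r : ℕ} {u : VPoly 3} (hu : u ∈ S1 r) :
    ∃ p ∈ VP 3 ((r : ℤ) - 1), ∃ w ∈ W ((r : ℤ) - 1), ∀ i,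
      curl u i = p i + X i * (C ((r : ℝ) + 2) * w i - ∑ j, w j) := by
  obtain ⟨φ, hφ, p, hp, w, hw, rfl⟩ := exists_of_mem_S1 hu
  refine ⟨curl (crossRight X p), curl_mem_VP (k := r) le_rfl
    (crossRight_X_mem_VP (by linarith) hp), w, hw, fun i => ?_⟩
  rw [map_add, map_add, curl_grad, zero_add, Pi.add_apply, curl_wField hw]
  congr 5
  push_cast
  ring

/-- The linear relations between the top coefficients of the components of the curl force the
fields `wField w` to be absent. For a fixed monomial the coefficients `a_i` satisfy
`(s + 2) a_i² = (a_0 + a_1 + a_2) a_i`, and at most two of them are nonzero. -/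
theorem eq_zero_of_coeff_relations {s : ℝ} (hs : 0 < s) {k : ℤ} (hk : 0 < k) {w : VPoly 3}
    (hw : w ∈ W k)
    (hrel : ∀ i m, ((∑ j, m j : ℕ) : ℤ) = k → m i = 0 →
      (s + 2) * coeff m (w i) - ∑ j, coeff m (w j) = 0) : w = 0 := by
  ext i m
  rw [Pi.zero_apply, coeff_zero]
  by_contra hne
  have hsupp : ∀ j, coeff m (w j) ≠ 0 → ((∑ j, m j : ℕ) : ℤ) = k ∧ m j = 0 :=
    fun j hj => mem_restrictSupport.1 (mem_W.1 hw j) m hj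
  have hm := (hsupp i hne).1
  have hsq : ∀ j, (s + 2) * coeff m (w j) ^ 2 = (∑ l, coeff m (w l)) * coeff m (w j) := by
    intro j
    by_cases hj : coeff m (w j) = 0
    · rw [hj]; ring
    · linear_combination coeff m (w j) * hrel j m hm (hsupp j hj).2
  obtain ⟨l, hl⟩ : ∃ l, m l ≠ 0 := by
    by_contra hall
    push Not at hall
    simp only [hall, Finset.sum_const_zero, Nat.cast_zero] at hm
    omega
  have hl0 : coeff m (w l) = 0 := by
    by_contra h0
    exact hl (hsupp l h0).2
  have hpos : 0 < ∑ j, coeff m (w j) ^ 2 := lt_of_lt_of_le (by positivity)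
    (Finset.single_le_sum (f := fun j => coeff m (w j) ^ 2) (fun j _ => sq_nonneg _)
      (Finset.mem_univ i))
  have htot : (s + 2) * ∑ j, coeff m (w j) ^ 2 = (∑ l, coeff m (w l)) ^ 2 := by
    rw [Finset.mul_sum, Finset.sum_congr rfl fun j _ => hsq j, ← Finset.mul_sum, sq]
  have hle : (∑ l, coeff m (w l)) ^ 2 ≤ 2 * ∑ j, coeff m (w j) ^ 2 := by
    rw [Fin.sum_univ_three, Fin.sum_univ_three]
    generalize ha : coeff m (w 0) = a
    generalize hb : coeff m (w 1) = b
    generalize hc : coeff m (w 2) = d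
    have : a = 0 ∨ b = 0 ∨ d = 0 := by
      rw [← ha, ← hb, ← hc]
      fin_cases l
      · exact .inl hl0
      · exact .inr (.inl hl0)
      · exact .inr (.inr hl0)
    rcases this with rfl | rfl | rfl
    · nlinarith [sq_nonneg (b - d)]
    · nlinarith [sq_nonneg (a - d)]
    · nlinarith [sq_nonneg (a - b)]
  nlinarith

theorem curl_mem_cellTest {r : ℕ} {g : VPoly 3} (hg : g ∈ VP 3 ((r : ℤ) - 3)) :
    curl g ∈ cellTest r := by
  have h1 : ∀ i, ∃ a ∈ PHom 3 ((r : ℤ) - 3), ∃ b ∈ P 3 ((r : ℤ) - 3 - 1), a + b = g i :=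
    fun i => Submodule.mem_sup.1 (P_le_sup _ (mem_VP.1 hg i))
  choose a ha b hb hab using h1
  have : g = a + b := funext fun i => (hab i).symm
  rw [this, map_add]
  exact add_mem (Submodule.mem_sup_right (Submodule.mem_map_of_mem (mem_VPHom.2 ha)))
    (Submodule.mem_sup_left (curl_mem_VP (by linarith) (mem_VP.2 hb)))

/-- Integration by parts for the curl of a field with zero tangential trace. -/
theorem boxInt_curl {c h : Fin 3 → ℝ} (hh : ∀ i, 0 < h i) {u : VPoly 3}
    (hu : TangentiallyZero c h u) (g : VPoly 3) :
    boxInt c h (∑ i, curl u i * g i) = boxInt c h (∑ i, u i * curl g i) := by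
  have ibp : ∀ i j k, i ≠ j →
      boxInt c h (pderiv i (u j) * g k) = -boxInt c h (u j * pderiv i (g k)) :=
    fun i j k hij => boxInt_pderiv_mul hh i (g k) (hu j i hij)
  rw [curl_apply, curl_apply, Fin.sum_univ_three, Fin.sum_univ_three]
  simp only [Matrix.cons_val_zero, Matrix.cons_val_one, Matrix.cons_val, sub_mul, mul_sub,
    map_add, map_sub]
  rw [ibp 1 2 0 (by decide), ibp 2 1 0 (by decide), ibp 2 0 1 (by decide), ibp 0 2 1 (by decide),
    ibp 0 1 2 (by decide), ibp 1 0 2 (by decide)]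
  ring

/-- The three-dimensional problem: a field of `S^1` with zero tangential trace is determined by
its interior moments. The curl has components `slab i * g i` with `g` a test field for the
integration by parts, so it vanishes, and the field is a gradient. -/
theorem eq_zero_of_cellTest {r : ℕ} (hr : 2 ≤ r) {c h : Fin 3 → ℝ} (hh : ∀ i, 0 < h i)
    {u : VPoly 3} (hS : u ∈ S1 r) (hu : TangentiallyZero c h u)
    (hm : ∀ q ∈ cellTest r, boxInt c h (∑ i, u i * q i) = 0) : u = 0 := by
  obtain ⟨p, hp, w, hw, hcurl⟩ := curl_of_mem_S1 hS
  choose g hg using fun i => slab_dvd_curl hh hu i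
  have hwP : ∀ i, w i ∈ P 3 ((r : ℤ) - 1) := fun i =>
    restrictSupport_mono ℝ (fun m hm => hm.1.le) (mem_W.1 hw i)
  have hgP : ∀ i, g i ∈ P 3 ((r : ℤ) - 2) := by
    intro i
    refine mem_P_of_slab_mul (c := c) (h := h) (i := i) ?_
    rw [← hg, hcurl]
    exact add_mem (P_mono (by linarith) (mem_VP.1 hp i)) (mul_mem_P (by linarith) (X_mem_P i)
      (sub_mem (C_mul_mem _ (hwP i)) (sum_mem fun j _ => hwP j)))
  have hw0 : w = 0 := by
    refine eq_zero_of_coeff_relations (s := r) (by positivity) (k := (r : ℤ) - 1) (by omega) hw ?_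
    intro i m hm hmi
    have h1 := coeff_slab_mul (c := c) (h := h) (i := i) (k := (r : ℤ) - 1) (g := g i)
      (P_mono (by linarith) (hgP i)) hm hmi
    rw [← hg, hcurl, coeff_add, coeff_X_mul, coeff_sub, coeff_C_mul, coeff_sum] at h1
    have h2 : coeff (Finsupp.single i 1 + m) (p i) = 0 := by
      by_contra hne
      have := mem_P.1 (mem_VP.1 hp i) _ hne
      simp only [Finsupp.add_apply, Finset.sum_add_distrib, sum_single] at this
      push_cast at this hm
      omega
    rwa [h2, zero_add] at h1
  have hgP' : g ∈ VP 3 ((r : ℤ) - 3) := by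
    refine mem_VP.2 fun i => ?_
    have : (r : ℤ) - 3 = r - 1 - 2 := by ring
    rw [this]
    refine mem_P_of_slab_mul (c := c) (h := h) (i := i) ?_
    rw [← hg, hcurl, hw0]
    simpa using mem_VP.1 hp i
  have hg0 : g = 0 := by
    refine eq_zero_of_boxInt_sum_sq (w := slab c h) hh (fun i x hx => slab_pos i hx) ?_
    have h1 := boxInt_curl hh hu g
    rw [hm _ (curl_mem_cellTest hgP')] at h1
    rw [← h1]
    congr 1
    exact Finset.sum_congr rfl fun i _ => by rw [hg]; ring
  have hc0 : curl u = 0 := by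
    funext i
    rw [hg, hg0]
    simp
  have hclosed : ∀ i j, pderiv i (u j) = pderiv j (u i) := by
    have h0 : pderiv 1 (u 2) = pderiv 2 (u 1) := sub_eq_zero.1 (congrFun hc0 0)
    have h1 : pderiv 2 (u 0) = pderiv 0 (u 2) := sub_eq_zero.1 (congrFun hc0 1)
    have h2 : pderiv 0 (u 1) = pderiv 1 (u 0) := sub_eq_zero.1 (congrFun hc0 2)
    intro i j
    fin_cases i <;> fin_cases j
    exacts [rfl, h2, h1.symm, h2.symm, rfl, h0, h1, h0.symm, rfl]
  have hpot := grad_potential hclosed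
  have hrad := sum_X_mul_mem_S0 hS
  rw [← hpot] at hu ⊢
  refine grad_eq_zero (n := 1) (r := r) hh (scale_mem_restrictSupport _ hrad) hu ?_
  intro q hq
  rw [hpot]
  exact hm q (Submodule.mem_sup_left
    (mem_VP.2 fun i => P_mono (by push_cast; linarith) (mem_VP.1 hq i)))

/-! ### Restriction to faces and edges -/

/-- Restriction of a polynomial to the hyperplane `x_i = a`, as a polynomial in the remaining
variables. -/
def restr {n : ℕ} (i : Fin (n + 1)) (a : ℝ) : Poly (n + 1) →ₐ[ℝ] Poly n :=
  aeval (Fin.insertNth (α := fun _ => Poly n) i (C a) X)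

theorem restr_X_self {n : ℕ} (i : Fin (n + 1)) (a : ℝ) : restr i a (X i) = C a := by
  simp [restr]

theorem restr_X_succAbove {n : ℕ} (i : Fin (n + 1)) (a : ℝ) (j : Fin n) :
    restr i a (X (i.succAbove j)) = X j := by
  simp [restr]

theorem restr_C {n : ℕ} (i : Fin (n + 1)) (a b : ℝ) : restr i a (C b) = C b := by
  simp [restr]

theorem eval_restr {n : ℕ} (i : Fin (n + 1)) (a : ℝ) (y : Fin n → ℝ) (p : Poly (n + 1)) :
    eval y (restr i a p) = eval (Fin.insertNth (α := fun _ => ℝ) i a y) p := by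
  induction p using MvPolynomial.induction_on with
  | C b => rw [restr_C, eval_C, eval_C]
  | add p q hp hq => simp only [map_add, hp, hq]
  | mul_X p j hp =>
    rw [map_mul, map_mul, map_mul, hp, eval_X]
    congr 1
    rcases Fin.eq_self_or_eq_succAbove i j with rfl | ⟨k, rfl⟩
    · rw [restr_X_self, eval_C, Fin.insertNth_apply_same]
    · rw [restr_X_succAbove, eval_X, Fin.insertNth_apply_succAbove]

theorem pderiv_restr {n : ℕ} (i : Fin (n + 1)) (a : ℝ) (j : Fin n) (p : Poly (n + 1)) :
    pderiv j (restr i a p) = restr i a (pderiv (i.succAbove j) p) := by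
  induction p using MvPolynomial.induction_on with
  | C b => simp
  | add p q hp hq => simp only [map_add, hp, hq]
  | mul_X p k hp =>
    have hk : pderiv j (restr i a (X k)) = restr i a (pderiv (i.succAbove j) (X k)) := by
      rcases Fin.eq_self_or_eq_succAbove i k with rfl | ⟨l, rfl⟩
      · rw [restr_X_self, pderiv_C, pderiv_X_of_ne (Fin.succAbove_ne k j).symm, map_zero]
      · rw [restr_X_succAbove, pderiv_X, pderiv_X]
        by_cases hl : l = j
        · subst hl; simp
        · rw [Pi.single_eq_of_ne hl,
            Pi.single_eq_of_ne (fun h => hl (Fin.succAbove_right_injective h)), map_zero]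
    simp only [map_mul, Derivation.leibniz, smul_eq_mul, map_add, hp, hk]

/-- The exponent of a monomial with the `i`-th variable removed. -/
def removeVar {n : ℕ} (i : Fin (n + 1)) (m : Fin (n + 1) →₀ ℕ) : Fin n →₀ ℕ :=
  Finsupp.equivFunOnFinite.symm fun j => m (i.succAbove j)

theorem removeVar_apply {n : ℕ} (i : Fin (n + 1)) (m : Fin (n + 1) →₀ ℕ) (j : Fin n) :
    removeVar i m j = m (i.succAbove j) := rfl

theorem restr_monomial {n : ℕ} (i : Fin (n + 1)) (a : ℝ) (m : Fin (n + 1) →₀ ℕ) :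
    restr i a (monomial m 1) = a ^ m i • monomial (removeVar i m) 1 := by
  rw [restr, aeval_monomial, map_one, one_mul, Finsupp.prod_fintype _ _ (by simp),
    Fin.prod_univ_succAbove _ i, Fin.insertNth_apply_same, ← C_pow, ← smul_eq_C_mul]
  congr 1
  rw [monomial_eq, C_1, one_mul, Finsupp.prod_fintype _ _ (by simp)]
  exact Finset.prod_congr rfl fun j _ => by rw [Fin.insertNth_apply_succAbove, removeVar_apply]

theorem restr_mem_restrictSupport {n : ℕ} (i : Fin (n + 1)) (a : ℝ) {s : Set (Fin (n + 1) →₀ ℕ)}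
    {t : Set (Fin n →₀ ℕ)} (hst : ∀ m ∈ s, removeVar i m ∈ t) {p : Poly (n + 1)}
    (hp : p ∈ restrictSupport ℝ s) : restr i a p ∈ restrictSupport ℝ t := by
  refine map_mem_of_monomial (restr i a).toLinearMap (fun m hm => ?_) hp
  rw [AlgHom.toLinearMap_apply, restr_monomial]
  exact Submodule.smul_mem _ _ ((monomial_mem_restrictSupport ℝ).2 (.inl (hst m hm)))

theorem restr_mem_P {n : ℕ} (i : Fin (n + 1)) (a : ℝ) {k : ℤ} {p : Poly (n + 1)}
    (hp : p ∈ P (n + 1) k) : restr i a p ∈ P n k := by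
  refine restr_mem_restrictSupport i a (fun m hm => ?_) hp
  simp only [Set.mem_ofPred_eq, removeVar_apply] at hm ⊢
  rw [Fin.sum_univ_succAbove _ i] at hm
  push_cast at hm ⊢
  have : (0 : ℤ) ≤ m i := Int.natCast_nonneg _
  linarith

theorem restr_mem_SL {n : ℕ} (i : Fin (n + 1)) (a : ℝ) {r : ℕ} {p : Poly (n + 1)}
    (hp : p ∈ SL (n + 1) r) : restr i a p ∈ SL n r := by
  refine restr_mem_restrictSupport i a (fun m hm => ?_) hp
  simp only [Set.mem_ofPred_eq, superlin, removeVar_apply] at hm ⊢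
  rw [Fin.sum_univ_succAbove _ i] at hm
  exact le_trans (Nat.le_add_left _ _) hm

theorem restr_lam_eq_zero {n : ℕ} (c h : Fin (n + 1) → ℝ) (f : Fin (n + 1) × Bool) :
    restr f.1 (c f.1 + sgn f.2 * h f.1) (lam c h f) = 0 := by
  refine MvPolynomial.funext fun y => ?_
  rw [eval_restr, map_zero, eval_lam_eq_zero, Fin.insertNth_apply_same]

theorem lam_dvd_of_restr_eq_zero {n : ℕ} {c h : Fin (n + 1) → ℝ} {f : Fin (n + 1) × Bool}
    {p : Poly (n + 1)} (hp : restr f.1 (c f.1 + sgn f.2 * h f.1) p = 0) : lam c h f ∣ p := by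
  rw [lam_dvd_iff]
  intro x hx
  have := congrArg (eval fun j => x (f.1.succAbove j)) hp
  rw [eval_restr, map_zero, ← hx] at this
  rwa [show Fin.insertNth (α := fun _ => ℝ) f.1 (x f.1) (fun j => x (f.1.succAbove j)) = x from
    Fin.insertNth_self_removeNth f.1 x] at this

namespace Cube

variable (K : Cube)

/-- Restriction of a polynomial to a face of the box. -/
def toFace (f : Face) : Poly 3 →ₐ[ℝ] Poly 2 := restr f.1 (K.c f.1 + sgn f.2 * K.h f.1)

theorem eval_toFace (f : Face) (y : Fin 2 → ℝ) (p : Poly 3) :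
    eval y (K.toFace f p) = eval (K.facePt f y) p := eval_restr _ _ y p

/-- The tangential trace of a field on a face, in the coordinates of the face. -/
def faceTrace (f : Face) : VPoly 3 →ₗ[ℝ] VPoly 2 :=
  LinearMap.pi fun j => (K.toFace f).toLinearMap ∘ₗ LinearMap.proj (f.1.succAbove j)

theorem faceTrace_apply (f : Face) (u : VPoly 3) (j : Fin 2) :
    K.faceTrace f u j = K.toFace f (u (f.1.succAbove j)) := rfl

/-- The centre of a face in its own coordinates. -/
def faceC (f : Face) : Fin 2 → ℝ := fun j => K.c (f.1.succAbove j)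

/-- The half side lengths of a face. -/
def faceH (f : Face) : Fin 2 → ℝ := fun j => K.h (f.1.succAbove j)

theorem faceH_pos (f : Face) (j : Fin 2) : 0 < K.faceH f j := K.h_pos _

/-- Up to a nonzero factor the face moments are `∫ v₁ q₀ - v₀ q₁` for the tangential trace `v`. -/
theorem faceMoment_eq (f : Face) (s : Bool) : ∃ θ : ℝ, θ ≠ 0 ∧ ∀ u q,
    K.faceMoment f (unitVec f.1 s) u q = θ * boxInt (K.faceC f) (K.faceH f)
      (K.faceTrace f u 1 * q 0 - K.faceTrace f u 0 * q 1) := by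
  have key : ∃ θ : ℝ, θ ≠ 0 ∧ ∀ (v : Fin 3 → ℝ) (z : Fin 2 → ℝ),
      (v ⨯₃ unitVec f.1 s) ⬝ᵥ faceVec f z =
        θ * (v (f.1.succAbove 1) * z 0 - v (f.1.succAbove 0) * z 1) := by
    obtain ⟨i, b⟩ := f
    have e : ∀ z : Fin 2 → ℝ, faceVec (0, b) z = ![0, z 0, z 1] ∧
        faceVec (1, b) z = ![z 0, 0, z 1] ∧ faceVec (2, b) z = ![z 0, z 1, 0] := by
      intro z
      refine ⟨?_, ?_, ?_⟩ <;> ext k <;> fin_cases k <;> rfl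
    have a0 : (0 : Fin 3).succAbove 0 = 1 := rfl
    have a1 : (0 : Fin 3).succAbove 1 = 2 := rfl
    have b0 : (1 : Fin 3).succAbove 0 = 0 := rfl
    have b1 : (1 : Fin 3).succAbove 1 = 2 := rfl
    have c0 : (2 : Fin 3).succAbove 0 = 0 := rfl
    have c1 : (2 : Fin 3).succAbove 1 = 1 := rfl
    fin_cases i
    · refine ⟨sgn s, sgn_ne_zero s, fun v z => ?_⟩
      simp [(e z).1, cross_apply, dotProduct, Fin.sum_univ_three, unitVec, a0, a1]
      ring
    · refine ⟨-sgn s, neg_ne_zero.2 (sgn_ne_zero s), fun v z => ?_⟩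
      simp [(e z).2.1, cross_apply, dotProduct, Fin.sum_univ_three, unitVec, b0, b1]
      ring
    · refine ⟨sgn s, sgn_ne_zero s, fun v z => ?_⟩
      simp [(e z).2.2, cross_apply, dotProduct, Fin.sum_univ_three, unitVec, c0, c1]
      ring
  obtain ⟨θ, hθ, h⟩ := key
  refine ⟨θ, hθ, fun u q => ?_⟩
  rw [faceMoment, boxInt_apply, ← integral_const_mul]
  change ∫ y in box (K.faceC f) (K.faceH f), _ = _
  congr 1
  ext y
  rw [h]
  simp only [map_sub, map_mul, faceTrace_apply, eval_toFace]
  rfl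

/-- Restriction of a polynomial to an edge of the box. -/
def toEdge (e : Edge) : Poly 3 →ₐ[ℝ] Poly 1 :=
  aeval (Fin.insertNth (α := fun _ => Poly 1) e.1 (X 0) fun j =>
    C (K.c (e.1.succAbove j) + sgn (e.2 j) * K.h (e.1.succAbove j)))

theorem eval_toEdge (e : Edge) (t : ℝ) (p : Poly 3) :
    eval (fun _ => t) (K.toEdge e p) = eval (K.edgePt e t) p := by
  induction p using MvPolynomial.induction_on with
  | C b => simp [toEdge]
  | add p q hp hq => simp only [map_add, hp, hq]
  | mul_X p j hp =>
    rw [map_mul, map_mul, map_mul, hp, eval_X, toEdge, aeval_X, edgePt]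
    congr 1
    rcases Fin.eq_self_or_eq_succAbove e.1 j with rfl | ⟨k, rfl⟩
    · simp
    · simp

theorem toEdge_mem_P (e : Edge) {r : ℕ} {s : Set (Fin 3 →₀ ℕ)} (hs : ∀ m ∈ s, m e.1 + 1 ≤ r)
    {p : Poly 3} (hp : p ∈ restrictSupport ℝ s) : K.toEdge e p ∈ P 1 ((r : ℤ) - 1) := by
  refine map_mem_of_monomial (K.toEdge e).toLinearMap (fun m hm => ?_) hp
  rw [AlgHom.toLinearMap_apply, toEdge, aeval_monomial, map_one, one_mul,
    Finsupp.prod_fintype _ _ (by simp), Fin.prod_univ_succAbove _ e.1, Fin.insertNth_apply_same]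
  simp only [Fin.insertNth_apply_succAbove, ← C_pow, ← map_prod]
  rw [mul_comm]
  refine C_mul_mem _ ?_
  rw [X_pow_eq_monomial]
  refine (monomial_mem_restrictSupport ℝ).2 (.inl ?_)
  rw [Set.mem_ofPred_eq, sum_single]
  have := hs m hm
  omega

theorem edgeMoment_eq (e : Edge) (s : Bool) (u : VPoly 3) (q : Poly 1) :
    K.edgeMoment e (unitVec e.1 s) u q =
      sgn s * ∫ t in (K.c e.1 - K.h e.1)..(K.c e.1 + K.h e.1),
        eval (fun _ => t) (K.toEdge e (u e.1) * q) := by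
  rw [edgeMoment, ← intervalIntegral.integral_const_mul]
  congr 1
  ext t
  rw [map_mul, eval_toEdge, unitVec, dotProduct_single, evalV]
  ring

theorem cellMoment_eq (u q : VPoly 3) :
    K.cellMoment u q = boxInt K.c K.h (∑ i, u i * q i) := by
  rw [cellMoment, boxInt_apply]
  change ∫ y in box K.c K.h, _ = _
  congr 1
  ext x
  simp only [dotProduct, evalV, map_sum, map_mul]

/-! ### Injectivity of the moments on `S^1` -/

theorem toEdge_eq_zero {r : ℕ} (hr : 2 ≤ r) {u : VPoly 3} (hu : u ∈ S1 r) (e : Edge) {s : Bool}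
    (hm : ∀ q ∈ edgeTest r, K.edgeMoment e (unitVec e.1 s) u q = 0) : K.toEdge e (u e.1) = 0 := by
  set p := K.toEdge e (u e.1) with hp
  have h1 := hm p (K.toEdge_mem_P e (fun m hm => hm.1) (comp_mem hr hu e.1))
  rw [edgeMoment_eq, mul_eq_zero, or_iff_right (sgn_ne_zero s), ← hp] at h1
  have hlt : K.c e.1 - K.h e.1 < K.c e.1 + K.h e.1 := by linarith [K.h_pos e.1]
  have hcont : Continuous fun t : ℝ => eval (fun _ : Fin 1 => t) (p * p) :=
    (MvPolynomial.continuous_eval _).comp (continuous_pi fun _ => continuous_id)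
  refine eq_zero_of_box (c := fun _ => K.c e.1) (h := fun _ => K.h e.1) (fun _ => K.h_pos e.1) ?_
  intro x hx
  by_contra hne
  have hpos := intervalIntegral.integral_pos hlt hcont.continuousOn
    (fun t _ => by rw [map_mul]; exact mul_self_nonneg _)
    ⟨x 0, ⟨(hx 0 trivial).1.le, (hx 0 trivial).2.le⟩, by
      have : (fun _ : Fin 1 => x 0) = x := funext fun i => by rw [Subsingleton.elim i 0]
      rw [this, map_mul]
      exact mul_self_pos.2 hne⟩
  exact hpos.ne' h1

/-- Every point on two faces of a box that are orthogonal to different axes lies on an edge. -/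
theorem tangentiallyZero_faceTrace {u : VPoly 3} (hu : ∀ e, K.toEdge e (u e.1) = 0) (f : Face) :
    TangentiallyZero (K.faceC f) (K.faceH f) (K.faceTrace f u) := by
  intro j k hkj b y hy
  rw [faceTrace_apply, eval_toFace]
  set i := f.1.succAbove j with hi
  have hx : ∀ l, ∃ b' : Bool, K.facePt f y (i.succAbove l) =
      K.c (i.succAbove l) + sgn b' * K.h (i.succAbove l) := by
    intro l
    rcases Fin.eq_self_or_eq_succAbove f.1 (i.succAbove l) with h | ⟨k', h⟩
    · exact ⟨f.2, by rw [h, facePt, Fin.insertNth_apply_same]⟩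
    · have hk' : k' = k := by
        have hne : k' ≠ j := by
          rintro rfl
          exact Fin.succAbove_ne i l (h.trans hi.symm)
        omega
      subst hk'
      refine ⟨b, ?_⟩
      rw [h, facePt, Fin.insertNth_apply_succAbove]
      exact hy
  choose β hβ using hx
  have h1 := K.eval_toEdge (i, β) (K.facePt f y i) (u i)
  rw [hu (i, β), map_zero] at h1
  rw [h1]
  congr 2
  rw [edgePt]
  exact (Fin.eq_insertNth_iff.2 ⟨rfl, funext hβ⟩)

theorem curl_faceTrace (f : Face) (u : VPoly 3) :
    pderiv 0 (K.faceTrace f u 1) - pderiv 1 (K.faceTrace f u 0) = K.toFace f (curl u f.1) ∨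
      pderiv 0 (K.faceTrace f u 1) - pderiv 1 (K.faceTrace f u 0) =
        -K.toFace f (curl u f.1) := by
  simp only [faceTrace_apply, toFace, pderiv_restr, ← map_sub, ← map_neg]
  obtain ⟨i, b⟩ := f
  fin_cases i
  · exact .inl rfl
  · right
    rw [curl_apply]
    congr 1
    exact (neg_sub _ _).symm
  · exact .inl rfl

theorem toFace_curl_mem_P {r : ℕ} {u : VPoly 3} (hu : u ∈ S1 r) (f : Face) :
    K.toFace f (curl u f.1) ∈ P 2 ((r : ℤ) - 1) := by
  obtain ⟨p, hp, w, hw, hcurl⟩ := curl_of_mem_S1 hu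
  have hwP : ∀ i, w i ∈ P 3 ((r : ℤ) - 1) := fun i =>
    restrictSupport_mono ℝ (fun m hm => hm.1.le) (mem_W.1 hw i)
  rw [hcurl, map_add, map_mul, toFace, restr_X_self]
  exact add_mem (restr_mem_P _ _ (mem_VP.1 hp _)) (C_mul_mem _ (restr_mem_P _ _
    (sub_mem (C_mul_mem _ (hwP _)) (sum_mem fun j _ => hwP j))))

theorem sum_X_mul_faceTrace_mem {r : ℕ} (hr : 2 ≤ r) {u : VPoly 3} (hu : u ∈ S1 r) (f : Face) :
    ∑ j, X j * K.faceTrace f u j ∈ SL 2 r := by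
  have h1 : ∑ j, X j * K.faceTrace f u j = K.toFace f (∑ i, X i * u i) -
      C (K.c f.1 + sgn f.2 * K.h f.1) * K.toFace f (u f.1) := by
    rw [Fin.sum_univ_succAbove _ f.1, map_add, map_mul, map_sum, toFace, restr_X_self]
    simp only [map_mul, restr_X_succAbove, faceTrace_apply, toFace]
    ring
  rw [h1]
  refine sub_mem (restr_mem_SL _ _ (sum_X_mul_mem_S0 hu)) (C_mul_mem _ ?_)
  refine restr_mem_restrictSupport _ _ (fun m hm => ?_) (comp_mem hr hu f.1)
  simp only [Set.mem_ofPred_eq, superlin, Fin.sum_univ_two, removeVar_apply]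
  exact hm.2

/-- The edge, face and interior moments determine a field of `S^1`. -/
theorem eq_zero_of_moments {r : ℕ} (hr : 2 ≤ r) {u : VPoly 3} (hu : u ∈ S1 r) {σ : Edge → Bool}
    {ν : Face → Bool}
    (h1 : ∀ e, ∀ q ∈ edgeTest r, K.edgeMoment e (unitVec e.1 (σ e)) u q = 0)
    (h2 : ∀ f, ∀ q ∈ faceTest r, K.faceMoment f (unitVec f.1 (ν f)) u q = 0)
    (h4 : ∀ q ∈ cellTest r, K.cellMoment u q = 0) : u = 0 := by
  have hedge : ∀ e, K.toEdge e (u e.1) = 0 := fun e => K.toEdge_eq_zero hr hu e (h1 e)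
  have hface : ∀ f, K.faceTrace f u = 0 := by
    intro f
    obtain ⟨θ, hθ, hmom⟩ := K.faceMoment_eq f (ν f)
    refine eq_zero_of_faceTest (K.faceH_pos f) (K.tangentiallyZero_faceTrace hedge f) ?_
      (K.sum_X_mul_faceTrace_mem hr hu f) fun q hq => ?_
    · rcases K.curl_faceTrace f u with h | h <;> rw [h]
      · exact K.toFace_curl_mem_P hu f
      · exact neg_mem (K.toFace_curl_mem_P hu f)
    · have := h2 f q hq
      rw [hmom] at this
      exact (mul_eq_zero.1 this).resolve_left hθ
  refine eq_zero_of_cellTest hr K.h_pos hu ?_ fun q hq => by rw [← cellMoment_eq]; exact h4 q hq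
  intro j k hkj b
  refine lam_dvd_iff.1 (lam_dvd_of_restr_eq_zero (f := (k, b)) ?_)
  obtain ⟨l, rfl⟩ := Fin.exists_succAbove_eq hkj.symm
  exact congrFun (hface (k, b)) l

end Cube

/-! ### Finite-dimensional representation of functionals -/

theorem finite_setOf_sum_le (d : ℕ) (k : ℤ) :
    {m : Fin d →₀ ℕ | ((∑ i, m i : ℕ) : ℤ) ≤ k}.Finite := by
  refine (Set.finite_Iic (Finsupp.equivFunOnFinite.symm fun _ : Fin d => k.toNat)).subset ?_
  intro m hm i
  have h1 : m i ≤ ∑ j, m j := Finset.single_le_sum (fun _ _ => Nat.zero_le _) (Finset.mem_univ i)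
  simp only [Set.mem_ofPred_eq] at hm
  change m i ≤ k.toNat
  omega

theorem finite_restrictSupport {d : ℕ} {s : Set (Fin d →₀ ℕ)} (hs : s.Finite) :
    FiniteDimensional ℝ (restrictSupport ℝ s) :=
  have := hs.to_subtype
  Module.Finite.of_basis (basisRestrictSupport ℝ s)

instance finite_P (d : ℕ) (k : ℤ) : FiniteDimensional ℝ (P d k) :=
  finite_restrictSupport (finite_setOf_sum_le d k)

instance finite_PHom (d : ℕ) (k : ℤ) : FiniteDimensional ℝ (PHom d k) :=
  Submodule.finiteDimensional_of_le (PHom_le_P le_rfl)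

/-- A product of submodules is linearly equivalent to the product of the underlying spaces. -/
def piEquiv {d : ℕ} (N : Fin d → Submodule ℝ (Poly d)) :
    (Submodule.pi Set.univ N) ≃ₗ[ℝ] ((i : Fin d) → N i) where
  toFun u i := ⟨u.1 i, u.2 i trivial⟩
  invFun v := ⟨fun i => v i, fun i _ => (v i).2⟩
  map_add' _ _ := rfl
  map_smul' _ _ := rfl
  left_inv _ := rfl
  right_inv _ := rfl

instance finite_VP (d : ℕ) (k : ℤ) : FiniteDimensional ℝ (VP d k) :=
  Module.Finite.equiv (piEquiv fun _ => P d k).symm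

instance finite_VPHom (d : ℕ) (k : ℤ) : FiniteDimensional ℝ (VPHom d k) :=
  Module.Finite.equiv (piEquiv fun _ => PHom d k).symm

/-- A form that is nondegenerate on a finite-dimensional subspace represents all its
functionals. -/
theorem exists_represents {M : Type*} [AddCommGroup M] [Module ℝ M] (N : Submodule ℝ M)
    [FiniteDimensional ℝ N] (B : M →ₗ[ℝ] M →ₗ[ℝ] ℝ)
    (hB : ∀ x ∈ N, (∀ y ∈ N, B x y = 0) → x = 0) (a : Module.Dual ℝ N) :
    ∃ x ∈ N, ∀ y : N, B x y = a y := by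
  have hinj : Function.Injective (B.domRestrict₁₂ N N) := by
    rw [← LinearMap.ker_eq_bot, LinearMap.ker_eq_bot']
    intro x hx
    exact Subtype.ext (hB x x.2 fun y hy => LinearMap.congr_fun hx ⟨y, hy⟩)
  obtain ⟨x, hx⟩ := (LinearMap.injective_iff_surjective_of_finrank_eq_finrank
    (Subspace.dual_finrank_eq (K := ℝ) (V := N)).symm).1 hinj a
  exact ⟨x, x.2, fun y => LinearMap.congr_fun hx y⟩

/-- The weighted inner product `∫ w p · q` over a box. -/
def form {d : ℕ} (c h : Fin d → ℝ) (w : Poly d) : VPoly d →ₗ[ℝ] VPoly d →ₗ[ℝ] ℝ :=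
  LinearMap.mk₂ ℝ (fun p q => boxInt c h (w * ∑ i, p i * q i))
    (fun p p' q => by simp only [Pi.add_apply, add_mul, Finset.sum_add_distrib, mul_add, map_add])
    (fun a p q => by
      simp only [Pi.smul_apply, smul_mul_assoc, ← Finset.smul_sum, mul_smul_comm, map_smul])
    (fun p q q' => by simp only [Pi.add_apply, mul_add, Finset.sum_add_distrib, map_add])
    (fun a p q => by
      simp only [Pi.smul_apply, mul_smul_comm, ← Finset.smul_sum, map_smul])

theorem form_apply {d : ℕ} (c h : Fin d → ℝ) (w : Poly d) (p q : VPoly d) :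
    form c h w p q = boxInt c h (w * ∑ i, p i * q i) := rfl

theorem eq_zero_of_form {d : ℕ} {c h : Fin d → ℝ} (hh : ∀ i, 0 < h i) {w : Poly d}
    (hw : ∀ x ∈ box c h, 0 < eval x w) {p : VPoly d} (hp : form c h w p p = 0) : p = 0 :=
  eq_zero_of_boxInt_sum_sq (w := fun _ => w) hh (fun _ => hw) (by
    rwa [form_apply, Finset.mul_sum] at hp)

namespace Cube

variable (K : Cube)

/-! ### The bubble fields -/

theorem cellBubble_eq : K.cellBubble = bubble K.c K.h := by
  rw [← K.faceLambda_mul_faceBubble (0, true), faceBubble,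
    Finset.mul_prod_erase Finset.univ K.faceLambda (Finset.mem_univ _)]
  rfl

/-- The weight `B_K B_f` of the bubble fields attached to the face `f`. -/
def weight (f : Face) : Poly 3 := K.cellBubble * K.faceBubble f

theorem weight_eq (f : Face) : K.weight f = lam K.c K.h f * K.faceBubble f ^ 2 := by
  rw [weight, ← K.faceLambda_mul_faceBubble f]
  change lam K.c K.h f * _ * _ = _
  ring

theorem bubble_dvd_weight (f : Face) : bubble K.c K.h ∣ K.weight f :=
  K.cellBubble_eq ▸ dvd_mul_right _ _

theorem lam_mul_weight (f : Face) : lam K.c K.h f * K.weight f = bubble K.c K.h ^ 2 := by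
  rw [weight_eq, ← K.cellBubble_eq, ← K.faceLambda_mul_faceBubble f]
  change _ = (lam K.c K.h f * _) ^ 2
  ring

theorem lam_sq_dvd_weight {f g : Face} (hfg : g ≠ f) : lam K.c K.h g ^ 2 ∣ K.weight f := by
  have h1 : lam K.c K.h g ∣ K.faceBubble f :=
    Finset.dvd_prod_of_mem K.faceLambda (Finset.mem_erase.2 ⟨hfg, Finset.mem_univ g⟩)
  exact (pow_dvd_pow_of_dvd h1 2).trans (K.weight_eq f ▸ dvd_mul_left _ _)

theorem mem_tangentialP {f : Face} {k : ℤ} {q : VPoly 3} :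
    q ∈ tangentialP f k ↔ q f.1 = 0 ∧ ∀ i, q i ∈ P 3 k := by
  obtain ⟨i, b⟩ := f
  have hss : (C (sgn b) * C (sgn b) : Poly 3) = 1 := by rw [← C_mul, sgn_mul_self, C_1]
  constructor
  · rintro ⟨p, hp, rfl⟩
    replace hp := mem_VP.1 hp
    rw [crossRight_apply]
    constructor
    · fin_cases i <;> simp [unitVec]
    · intro j
      fin_cases j <;>
        exact sub_mem (mul_comm (C _) (p _) ▸ C_mul_mem _ (hp _))
          (mul_comm (C _) (p _) ▸ C_mul_mem _ (hp _))
  · rintro ⟨h0, hP⟩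
    fin_cases i
    · refine ⟨![0, -(C (sgn b) * q 2), C (sgn b) * q 1], mem_VP.2 fun j => ?_, ?_⟩
      · fin_cases j
        exacts [zero_mem _, neg_mem (C_mul_mem _ (hP 2)), C_mul_mem _ (hP 1)]
      · rw [crossRight_apply]
        ext j : 1
        fin_cases j
        · simp [unitVec]
          exact h0.symm
        · simp [unitVec]; linear_combination q 1 * hss
        · simp [unitVec]; linear_combination q 2 * hss
    · refine ⟨![C (sgn b) * q 2, 0, -(C (sgn b) * q 0)], mem_VP.2 fun j => ?_, ?_⟩
      · fin_cases j
        exacts [C_mul_mem _ (hP 2), zero_mem _, neg_mem (C_mul_mem _ (hP 0))]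
      · rw [crossRight_apply]
        ext j : 1
        fin_cases j
        · simp [unitVec]; linear_combination q 0 * hss
        · simp [unitVec]
          exact h0.symm
        · simp [unitVec]; linear_combination q 2 * hss
    · refine ⟨![-(C (sgn b) * q 1), C (sgn b) * q 0, 0], mem_VP.2 fun j => ?_, ?_⟩
      · fin_cases j
        exacts [neg_mem (C_mul_mem _ (hP 1)), C_mul_mem _ (hP 0), zero_mem _]
      · rw [crossRight_apply]
        ext j : 1
        fin_cases j
        · simp [unitVec]; linear_combination q 0 * hss
        · simp [unitVec]; linear_combination q 1 * hss
        · simp [unitVec]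
          exact h0.symm

instance finite_tangentialP (f : Face) (k : ℤ) : FiniteDimensional ℝ (tangentialP f k) := by
  unfold tangentialP
  infer_instance

theorem mem_faceV {f : Face} {k : ℤ} {q : VPoly 3} :
    q ∈ K.faceV f k ↔ q ∈ tangentialP f k ∧ ∀ w ∈ tangentialP f (k - 1),
      form K.c K.h (K.weight f) q w = 0 := by
  have h1 : ∀ w, K.cellIntegral (q ⬝ᵥ ((K.cellBubble * K.faceBubble f) • w)) =
      form K.c K.h (K.weight f) q w := by
    intro w
    rw [dotProduct_smul, smul_eq_mul]
    rfl
  change (q ∈ tangentialP f k ∧ ∀ w ∈ tangentialP f (k - 1), K.cellIntegral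
    (q ⬝ᵥ ((K.cellBubble * K.faceBubble f) • w)) = 0) ↔ _
  simp only [h1]

theorem exists_of_mem_V {k : ℤ} {v : VPoly 3} (hv : v ∈ K.V k) :
    ∃ Q : Face → VPoly 3, (∀ f, Q f ∈ K.faceV f k) ∧ v = ∑ f, K.weight f • Q f := by
  refine Submodule.iSup_induction (motive := fun v => ∃ Q : Face → VPoly 3,
    (∀ f, Q f ∈ K.faceV f k) ∧ v = ∑ f, K.weight f • Q f) _ hv ?_ ?_ ?_
  · rintro f _ ⟨q, hq, rfl⟩
    refine ⟨Pi.single f q, fun g => ?_, ?_⟩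
    · by_cases hg : g = f
      · subst hg; simpa using hq
      · rw [Pi.single_eq_of_ne hg]; exact zero_mem _
    · rw [Finset.sum_eq_single f (fun g _ hg => by rw [Pi.single_eq_of_ne hg, smul_zero])
        (by simp), Pi.single_eq_same]
      rfl
  · exact ⟨0, fun f => zero_mem _, by simp⟩
  · rintro _ _ ⟨Q, hQ, rfl⟩ ⟨R, hR, rfl⟩
    exact ⟨Q + R, fun f => add_mem (hQ f) (hR f), by
      simp only [Pi.add_apply, smul_add, Finset.sum_add_distrib]⟩

theorem weight_smul_mem_V {k : ℤ} {f : Face} {q : VPoly 3} (hq : q ∈ K.faceV f k) :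
    K.weight f • q ∈ K.V k :=
  Submodule.mem_iSup_of_mem f ⟨q, hq, rfl⟩

theorem toFace_eq_zero_of_dvd {f : Face} {p : Poly 3} (hp : lam K.c K.h f ∣ p) :
    K.toFace f p = 0 := by
  obtain ⟨q, rfl⟩ := hp
  rw [map_mul, toFace, restr_lam_eq_zero, zero_mul]

theorem faceTrace_eq_zero_of_dvd {f : Face} {u : VPoly 3} (hu : ∀ i, lam K.c K.h f ∣ u i) :
    K.faceTrace f u = 0 := by
  funext j
  rw [faceTrace_apply, K.toFace_eq_zero_of_dvd (hu _)]
  rfl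

theorem bubble_dvd_of_mem_V {k : ℤ} {v : VPoly 3} (hv : v ∈ K.V k) (i : Fin 3) :
    bubble K.c K.h ∣ v i := by
  obtain ⟨Q, _, rfl⟩ := K.exists_of_mem_V hv
  rw [Finset.sum_apply]
  exact Finset.dvd_sum fun f _ => (K.bubble_dvd_weight f).mul_right _

theorem lam_dvd_bubble (f : Face) : lam K.c K.h f ∣ bubble K.c K.h :=
  Finset.dvd_prod_of_mem _ (Finset.mem_univ f)

theorem faceTrace_of_mem_V {k : ℤ} {v : VPoly 3} (hv : v ∈ K.V k) (f : Face) :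
    K.faceTrace f v = 0 :=
  K.faceTrace_eq_zero_of_dvd fun i => ((K.lam_dvd_bubble f).trans (K.bubble_dvd_of_mem_V hv i))

theorem edgeMoment_of_mem_V {k : ℤ} {v : VPoly 3} (hv : v ∈ K.V k) (e : Edge) (s : Bool)
    (q : Poly 1) : K.edgeMoment e (unitVec e.1 s) v q = 0 := by
  have h1 : ∀ t : ℝ, eval (fun _ => t) (K.toEdge e (v e.1) * q) = 0 := by
    intro t
    obtain ⟨p, hp⟩ := (K.lam_dvd_bubble (e.1.succAbove 0, e.2 0)).trans
      (K.bubble_dvd_of_mem_V hv e.1)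
    rw [map_mul, eval_toEdge, hp, map_mul, eval_lam_eq_zero.2, zero_mul, zero_mul]
    simp [edgePt]
  rw [edgeMoment_eq]
  simp only [h1, intervalIntegral.integral_zero, mul_zero]

theorem faceMoment_of_mem_V {k : ℤ} {v : VPoly 3} (hv : v ∈ K.V k) (f : Face) (s : Bool)
    (q : VPoly 2) : K.faceMoment f (unitVec f.1 s) v q = 0 := by
  obtain ⟨θ, -, h⟩ := K.faceMoment_eq f s
  rw [h, K.faceTrace_of_mem_V hv]
  simp

theorem cellTest_le {r : ℕ} : cellTest r ≤ VP 3 ((r : ℤ) - 3) := by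
  refine sup_le (fun q hq => mem_VP.2 fun i => P_mono (by linarith) (mem_VP.1 hq i)) ?_
  rintro _ ⟨q, hq, rfl⟩
  exact curl_mem_VP (k := (r : ℤ) - 3) (by linarith)
    (mem_VP.2 fun i => PHom_le_P le_rfl (mem_VPHom.1 hq i))

/-- The defining orthogonality of the bubble fields makes their interior moments vanish. -/
theorem cellMoment_of_mem_V {r : ℕ} {v : VPoly 3} (hv : v ∈ K.V ((r : ℤ) - 2)) {q : VPoly 3}
    (hq : q ∈ cellTest r) : K.cellMoment v q = 0 := by
  obtain ⟨Q, hQ, rfl⟩ := K.exists_of_mem_V hv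
  have hqP := mem_VP.1 (cellTest_le hq)
  have h1 : ∀ f, boxInt K.c K.h (∑ i, (K.weight f • Q f) i * q i) = 0 := by
    intro f
    obtain ⟨hT, horth⟩ := K.mem_faceV.1 (hQ f)
    have h2 := horth (Function.update q f.1 0) (mem_tangentialP.2 ⟨by simp, fun i => by
      by_cases hi : i = f.1
      · subst hi; rw [Function.update_self]; exact zero_mem _
      · rw [Function.update_of_ne hi]; exact P_mono (by linarith) (hqP i)⟩)
    rw [form_apply, Finset.mul_sum] at h2
    rw [← h2]
    refine congrArg (boxInt K.c K.h) (Finset.sum_congr rfl fun i _ => ?_)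
    rw [Pi.smul_apply, smul_eq_mul, mul_assoc]
    by_cases hi : i = f.1
    · subst hi; rw [(mem_tangentialP.1 hT).1]; ring
    · rw [Function.update_of_ne hi]
  rw [cellMoment_eq]
  simp only [Finset.sum_apply, Finset.sum_mul]
  rw [Finset.sum_comm, map_sum]
  exact Finset.sum_eq_zero fun f _ => h1 f

/-! ### The curl of the bubble fields on the faces -/

theorem faceTrace_curl_of_sq_dvd {f : Face} {u : VPoly 3} (hu : ∀ i, lam K.c K.h f ^ 2 ∣ u i) :
    K.faceTrace f (curl u) = 0 := by
  have h1 : ∀ i j, K.toFace f (pderiv j (u i)) = 0 := by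
    intro i j
    obtain ⟨q, hq⟩ := hu i
    refine K.toFace_eq_zero_of_dvd ?_
    rw [hq, sq, mul_assoc, Derivation.leibniz, Derivation.leibniz]
    exact ⟨pderiv j (lam K.c K.h f * q) + q * pderiv j (lam K.c K.h f), by
      simp only [smul_eq_mul, Derivation.leibniz]; ring⟩
  have h2 : ∀ i, K.toFace f (curl u i) = 0 := by
    intro i
    rw [curl_apply]
    fin_cases i <;> simp [h1]
  funext j
  rw [faceTrace_apply, h2]
  rfl

theorem toFace_pderiv_lam_mul (f : Face) (j : Fin 3) (p : Poly 3) :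
    K.toFace f (pderiv j (lam K.c K.h f * p)) =
      C (if j = f.1 then -sgn f.2 else 0) * K.toFace f p := by
  have h1 : pderiv j (lam K.c K.h f) = C (if j = f.1 then -sgn f.2 else 0) := by
    by_cases hj : j = f.1
    · subst hj
      simp [lam, Derivation.leibniz]
    · simp [lam, Derivation.leibniz, pderiv_X_of_ne (Ne.symm hj), hj]
  rw [Derivation.leibniz, h1, map_add, smul_eq_mul, smul_eq_mul, map_mul, map_mul,
    K.toFace_eq_zero_of_dvd dvd_rfl, zero_mul, zero_add, mul_comm]
  rw [toFace, restr_C]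

/-- On the face `f` the curl of `λ_f p` is a multiple of `n × p`. -/
theorem faceTrace_curl_lam_smul (f : Face) : ∃ θ : ℝ, θ ≠ 0 ∧ ∀ (p : VPoly 3) (q : VPoly 2),
    K.faceTrace f (curl (lam K.c K.h f • p)) 1 * q 0 -
      K.faceTrace f (curl (lam K.c K.h f • p)) 0 * q 1 =
      C θ * ∑ j, K.faceTrace f p j * q j := by
  have key := K.toFace_pderiv_lam_mul f
  simp only [Fin.sum_univ_two, faceTrace_apply, curl_apply, Pi.smul_apply, smul_eq_mul]
  obtain ⟨i, b⟩ := f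
  have a0 : (0 : Fin 3).succAbove 0 = 1 := rfl
  have a1 : (0 : Fin 3).succAbove 1 = 2 := rfl
  have b0 : (1 : Fin 3).succAbove 0 = 0 := rfl
  have b1 : (1 : Fin 3).succAbove 1 = 2 := rfl
  have c0 : (2 : Fin 3).succAbove 0 = 0 := rfl
  have c1 : (2 : Fin 3).succAbove 1 = 1 := rfl
  fin_cases i
  · refine ⟨-sgn b, neg_ne_zero.2 (sgn_ne_zero b), fun p q => ?_⟩
    simp only [Fin.zero_eta, a0, a1, Matrix.cons_val_one, Matrix.cons_val, map_sub]
    simp only [Fin.zero_eta] at key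
    simp only [key]
    simp
    ring
  · refine ⟨sgn b, sgn_ne_zero b, fun p q => ?_⟩
    simp only [Fin.mk_one, b0, b1, Matrix.cons_val_zero, Matrix.cons_val, map_sub]
    simp only [Fin.mk_one] at key
    simp only [key]
    simp
    ring
  · refine ⟨-sgn b, neg_ne_zero.2 (sgn_ne_zero b), fun p q => ?_⟩
    simp only [Fin.reduceFinMk, c0, c1, Matrix.cons_val_zero, Matrix.cons_val_one, map_sub]
    simp only [Fin.reduceFinMk] at key
    simp only [key]
    simp
    ring

/-- The square of the restriction of `B_f` to the face `f`. -/
def faceWeight (f : Face) : Poly 2 := K.toFace f (K.faceBubble f) ^ 2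

theorem faceWeight_pos (f : Face) {y : Fin 2 → ℝ} (hy : y ∈ box (K.faceC f) (K.faceH f)) :
    0 < eval y (K.faceWeight f) := by
  rw [faceWeight, map_pow, eval_toFace, faceBubble, map_prod]
  refine sq_pos_of_ne_zero (Finset.prod_ne_zero_iff.2 fun g hg h0 => ?_)
  have h1 := eval_lam_eq_zero.1 h0
  rcases Fin.eq_self_or_eq_succAbove f.1 g.1 with h | ⟨j, h⟩
  · rw [h, facePt, Fin.insertNth_apply_same] at h1
    have h2 := mul_right_cancel₀ (K.h_pos f.1).ne' (add_left_cancel h1)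
    refine (Finset.mem_erase.1 hg).1 (Prod.ext h ?_)
    revert h2
    rcases f with ⟨_, _ | _⟩ <;> rcases g with ⟨_, _ | _⟩ <;> simp [sgn] <;> norm_num
  · rw [h, facePt, Fin.insertNth_apply_succAbove] at h1
    have h2 := hy j trivial
    rw [Set.mem_Ioo, faceC, faceH] at h2
    rcases g with ⟨_, _ | _⟩ <;> simp [sgn] at h1 <;> linarith [h2.1, h2.2]

/-- The curl moments of a bubble field on `f` only see the part attached to `f`, and there they
are a weighted inner product. -/
theorem curlMoment_eq (f : Face) (s : Bool) : ∃ θ : ℝ, θ ≠ 0 ∧ ∀ (Q : Face → VPoly 3) q,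
    K.faceMoment f (unitVec f.1 s) (curl (∑ g, K.weight g • Q g)) q =
      θ * form (K.faceC f) (K.faceH f) (K.faceWeight f) (K.faceTrace f (Q f)) q := by
  obtain ⟨θ, hθ, h1⟩ := K.faceMoment_eq f s
  obtain ⟨η, hη, h2⟩ := K.faceTrace_curl_lam_smul f
  refine ⟨θ * η, mul_ne_zero hθ hη, fun Q q => ?_⟩
  have h3 : K.faceTrace f (curl (∑ g, K.weight g • Q g)) =
      K.faceTrace f (curl (lam K.c K.h f • (K.faceBubble f ^ 2 • Q f))) := by
    rw [map_sum, map_sum, Finset.sum_eq_single f, weight_eq, mul_smul]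
    · intro g _ hg
      exact K.faceTrace_curl_of_sq_dvd fun i =>
        (K.lam_sq_dvd_weight hg.symm).trans (dvd_mul_right _ _)
    · simp
  have h4 : ∀ j, K.faceTrace f (K.faceBubble f ^ 2 • Q f) j =
      K.faceWeight f * K.faceTrace f (Q f) j := by
    intro j
    rw [faceTrace_apply, Pi.smul_apply, smul_eq_mul, map_mul, map_pow]
    rfl
  rw [h1, h3, h2, ← smul_eq_C_mul, map_smul, form_apply, mul_assoc, smul_eq_mul]
  simp only [h4, mul_assoc, Finset.mul_sum]

theorem faceTrace_mem_VP {f : Face} {k : ℤ} {q : VPoly 3} (hq : q ∈ tangentialP f k) :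
    K.faceTrace f q ∈ VP 2 k :=
  mem_VP.2 fun _ => restr_mem_P _ _ ((mem_tangentialP.1 hq).2 _)

theorem lam_mem_P {d : ℕ} (c h : Fin d → ℝ) (f : Fin d × Bool) : lam c h f ∈ P d 1 :=
  sub_mem (C_mem_P _ zero_le_one)
    (C_mul_mem _ (sub_mem (X_mem_P _) (C_mem_P _ zero_le_one)))

theorem lam_mul_weight_pos (f : Face) {x : Fin 3 → ℝ} (hx : x ∈ box K.c K.h) :
    0 < eval x (lam K.c K.h f * K.weight f) := by
  rw [lam_mul_weight, map_pow]
  exact pow_pos (bubble_pos hx) 2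

theorem form_lam_smul (f : Face) (p q : VPoly 3) :
    form K.c K.h (K.weight f) (lam K.c K.h f • p) q =
      form K.c K.h (lam K.c K.h f * K.weight f) p q := by
  rw [form_apply, form_apply, Finset.mul_sum, Finset.mul_sum]
  refine congrArg (boxInt K.c K.h) (Finset.sum_congr rfl fun i _ => ?_)
  rw [Pi.smul_apply, smul_eq_mul]
  ring

/-- A field of `V_f` is determined by its trace on `f`: if the trace vanishes, then `q = λ_f w`,
and `w` is one of the fields to which `q` is orthogonal. -/
theorem eq_zero_of_faceTrace {f : Face} {k : ℤ} {q : VPoly 3} (hq : q ∈ K.faceV f k)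
    (h0 : K.faceTrace f q = 0) : q = 0 := by
  obtain ⟨hT, horth⟩ := K.mem_faceV.1 hq
  rw [mem_tangentialP] at hT
  have hdvd : ∀ i, lam K.c K.h f ∣ q i := by
    intro i
    rcases Fin.eq_self_or_eq_succAbove f.1 i with rfl | ⟨j, rfl⟩
    · rw [hT.1]; exact dvd_zero _
    · exact lam_dvd_of_restr_eq_zero (congrFun h0 j)
  choose w hw using hdvd
  have hqw : q = lam K.c K.h f • w := funext hw
  have hwT : w ∈ tangentialP f (k - 1) := by
    refine mem_tangentialP.2 ⟨?_, fun i => mem_P_of_lam_mul (hw i ▸ hT.2 i)⟩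
    have := hw f.1
    rw [hT.1] at this
    exact (mul_eq_zero.1 this.symm).resolve_left (lam_ne_zero _ _ _)
  have h1 := horth w hwT
  rw [hqw, form_lam_smul] at h1
  rw [hqw, eq_zero_of_form K.h_pos (fun x hx => K.lam_mul_weight_pos f hx) h1, smul_zero]

/-- The extension of a field on the face `f` to the box that is constant in the normal
direction. -/
def extend (f : Face) (p : VPoly 2) : VPoly 3 :=
  Fin.insertNth (α := fun _ => Poly 3) f.1 0 fun j => rename f.1.succAbove (p j)

theorem faceTrace_extend (f : Face) (p : VPoly 2) : K.faceTrace f (extend f p) = p := by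
  funext j
  rw [faceTrace_apply, extend, Fin.insertNth_apply_succAbove, toFace, restr, aeval_rename]
  have : (Fin.insertNth (α := fun _ => Poly 2) f.1 (C (K.c f.1 + sgn f.2 * K.h f.1)) X) ∘
      f.1.succAbove = (X : Fin 2 → Poly 2) := by
    funext i
    rw [Function.comp_apply, Fin.insertNth_apply_succAbove]
  rw [this, aeval_X_left, AlgHom.id_apply]

theorem extend_mem {f : Face} {k : ℤ} {p : VPoly 2} (hp : p ∈ VP 2 k) :
    extend f p ∈ tangentialP f k := by
  rw [mem_tangentialP, extend]
  refine ⟨Fin.insertNth_apply_same _ _ _, fun i => ?_⟩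
  rcases Fin.eq_self_or_eq_succAbove f.1 i with rfl | ⟨j, rfl⟩
  · rw [Fin.insertNth_apply_same]; exact zero_mem _
  · rw [Fin.insertNth_apply_succAbove]
    refine map_mem_of_monomial (rename f.1.succAbove).toLinearMap (fun m hm => ?_)
      (mem_VP.1 hp j)
    rw [AlgHom.toLinearMap_apply, rename_monomial]
    refine (monomial_mem_restrictSupport ℝ).2 (.inl ?_)
    simp only [Set.mem_ofPred_eq] at hm ⊢
    rw [Fin.sum_univ_succAbove _ f.1, Finsupp.mapDomain_of_notMem_range _ _ (by simp), zero_add]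
    simpa only [Finsupp.mapDomain_apply Fin.succAbove_right_injective] using hm

/-- Every functional on `[P_k(f)]²` is represented by a field of `V_f`: extend a representing
field to the box and subtract a multiple of `λ_f` to make it orthogonal. -/
theorem exists_faceV (f : Face) {k : ℤ} (a : Module.Dual ℝ (VP 2 k)) :
    ∃ q ∈ K.faceV f k, ∀ y : VP 2 k,
      form (K.faceC f) (K.faceH f) (K.faceWeight f) (K.faceTrace f q) y = a y := by
  obtain ⟨p, hp, hpa⟩ := exists_represents (VP 2 k)
    (form (K.faceC f) (K.faceH f) (K.faceWeight f))
    (fun x hx h => eq_zero_of_form (K.faceH_pos f) (fun y hy => K.faceWeight_pos f hy) (h x hx)) a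
  obtain ⟨w, hw, hwa⟩ := exists_represents (tangentialP f (k - 1))
    (form K.c K.h (lam K.c K.h f * K.weight f))
    (fun x hx h => eq_zero_of_form K.h_pos (fun y hy => K.lam_mul_weight_pos f hy) (h x hx))
    ((form K.c K.h (K.weight f) (extend f p)).domRestrict _)
  refine ⟨extend f p - lam K.c K.h f • w, K.mem_faceV.2 ⟨?_, fun w' hw' => ?_⟩, fun y => ?_⟩
  · refine sub_mem (extend_mem hp) (mem_tangentialP.2 ?_)
    obtain ⟨h0, hP⟩ := mem_tangentialP.1 hw
    exact ⟨by rw [Pi.smul_apply, h0, smul_zero],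
      fun i => mul_mem_P (by linarith) (lam_mem_P _ _ _) (hP i)⟩
  · rw [map_sub, LinearMap.sub_apply, form_lam_smul, hwa ⟨w', hw'⟩]
    exact sub_self _
  · have : K.faceTrace f (lam K.c K.h f • w) = 0 :=
      K.faceTrace_eq_zero_of_dvd fun i => dvd_mul_right _ (w i)
    rw [map_sub, this, sub_zero, faceTrace_extend, hpa]

/-- A bubble field is determined by its curl moments. -/
theorem eq_zero_of_curlMoments {r : ℕ} {v : VPoly 3} (hv : v ∈ K.V ((r : ℤ) - 2))
    {ν : Face → Bool}
    (h3 : ∀ f, ∀ q ∈ faceCurlTest r, K.faceMoment f (unitVec f.1 (ν f)) (curl v) q = 0) :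
    v = 0 := by
  obtain ⟨Q, hQ, rfl⟩ := K.exists_of_mem_V hv
  refine Finset.sum_eq_zero fun f _ => ?_
  obtain ⟨θ, hθ, h⟩ := K.curlMoment_eq f (ν f)
  have h1 := h3 f _ (K.faceTrace_mem_VP (K.mem_faceV.1 (hQ f)).1)
  rw [h] at h1
  rw [K.eq_zero_of_faceTrace (hQ f) (eq_zero_of_form (K.faceH_pos f)
    (fun y hy => K.faceWeight_pos f hy) ((mul_eq_zero.1 h1).resolve_left hθ)), smul_zero]

/-- The curl moments of the bubble fields can be prescribed. -/
theorem exists_curlMoments {r : ℕ} (ν : Face → Bool)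
    (a : Face → Module.Dual ℝ (faceCurlTest r)) :
    ∃ v ∈ K.V ((r : ℤ) - 2), ∀ (f : Face) (q : faceCurlTest r),
      K.faceMoment f (unitVec f.1 (ν f)) (curl v) q = a f q := by
  choose θ hθ h using fun f => K.curlMoment_eq f (ν f)
  choose Q hQ hQa using fun f => K.exists_faceV f (k := (r : ℤ) - 2) ((θ f)⁻¹ • a f)
  refine ⟨∑ f, K.weight f • Q f, sum_mem fun f _ => K.weight_smul_mem_V (hQ f), fun f q => ?_⟩
  rw [h]
  refine (congrArg (θ f * ·) (hQa f q)).trans ?_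
  exact mul_inv_cancel_left₀ (hθ f) (a f q)

end Cube

/-! ### Counting monomials -/

theorem finrank_restrictSupport {d : ℕ} (s : Set (Fin d →₀ ℕ)) :
    Module.finrank ℝ (restrictSupport ℝ s) = s.ncard := by
  rw [Module.finrank_eq_nat_card_basis (basisRestrictSupport ℝ s), Nat.card_coe_set_eq]

theorem ncard_sum_eq (d n : ℕ) :
    {m : Fin d →₀ ℕ | ((∑ i, m i : ℕ) : ℤ) = n}.ncard = (d + n - 1).choose n := by
  have : {m : Fin d →₀ ℕ | ((∑ i, m i : ℕ) : ℤ) = n} =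
      ((Finset.univ : Finset (Fin d)).finsuppAntidiag n : Set (Fin d →₀ ℕ)) := by
    ext m
    simp only [Set.mem_ofPred_eq, Finset.mem_coe, Finset.mem_finsuppAntidiag,
      Finset.subset_univ, and_true]
    exact Nat.cast_inj
  rw [this, Set.ncard_coe_finset, Finset.card_finsuppAntidiag_nat_eq_choose, Finset.card_univ,
    Fintype.card_fin]

theorem ncard_sum_le_add_one (d : ℕ) (n : ℤ) :
    {m : Fin d →₀ ℕ | ((∑ i, m i : ℕ) : ℤ) ≤ n + 1}.ncard =
      {m : Fin d →₀ ℕ | ((∑ i, m i : ℕ) : ℤ) ≤ n}.ncard +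
        {m : Fin d →₀ ℕ | ((∑ i, m i : ℕ) : ℤ) = n + 1}.ncard := by
  have hfin : {m : Fin d →₀ ℕ | ((∑ i, m i : ℕ) : ℤ) = n + 1}.Finite :=
    (finite_setOf_sum_le d (n + 1)).subset fun m hm => le_of_eq hm
  rw [← Set.ncard_union_eq (Set.disjoint_left.2 fun m hm hm' => ?_) (finite_setOf_sum_le d n) hfin]
  · congr 1
    ext m
    simp only [Set.mem_union, Set.mem_ofPred_eq]
    omega
  · simp only [Set.mem_ofPred_eq] at hm hm'
    omega

theorem finrank_P_add_one (d n : ℕ) :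
    Module.finrank ℝ (P d (n + 1)) = Module.finrank ℝ (P d n) +
      Module.finrank ℝ (PHom d (n + 1)) := by
  rw [P, P, PHom, finrank_restrictSupport, finrank_restrictSupport, finrank_restrictSupport]
  exact ncard_sum_le_add_one d n

theorem finrank_PHom_nat (d n : ℕ) :
    Module.finrank ℝ (PHom d n) = (d + n - 1).choose n := by
  rw [PHom, finrank_restrictSupport, ncard_sum_eq]

theorem finrank_P_zero (d : ℕ) : Module.finrank ℝ (P d 0) = 1 := by
  rw [P, finrank_restrictSupport]
  have : {m : Fin d →₀ ℕ | ((∑ i, m i : ℕ) : ℤ) ≤ 0} = {0} := by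
    ext m
    simp only [Set.mem_ofPred_eq, Set.mem_singleton_iff]
    constructor
    · intro h
      ext i
      have h1 : m i ≤ ∑ j, m j :=
        Finset.single_le_sum (fun _ _ => Nat.zero_le _) (Finset.mem_univ i)
      rw [Finsupp.coe_zero, Pi.zero_apply]
      omega
    · rintro rfl
      simp
  rw [this, Set.ncard_singleton]

theorem finrank_P_of_neg {d : ℕ} {k : ℤ} (hk : k < 0) : Module.finrank ℝ (P d k) = 0 := by
  rw [P_eq_bot hk, finrank_bot]

theorem finrank_PHom_of_neg {d : ℕ} {k : ℤ} (hk : k < 0) : Module.finrank ℝ (PHom d k) = 0 := by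
  have : PHom d k = ⊥ := eq_bot_iff.2 (P_eq_bot (d := d) hk ▸ PHom_le_P (le_refl k))
  rw [this, finrank_bot]

theorem finrank_PHom_one {n : ℕ} : Module.finrank ℝ (PHom 1 n) = 1 := by
  rw [finrank_PHom_nat, Nat.add_sub_cancel_left, Nat.choose_self]

theorem finrank_PHom_two {k : ℤ} (hk : -1 ≤ k) : (Module.finrank ℝ (PHom 2 k) : ℤ) = k + 1 := by
  obtain rfl | hk := eq_or_lt_of_le hk
  · rw [finrank_PHom_of_neg (by norm_num)]; norm_num
  · obtain ⟨n, rfl⟩ := Int.eq_ofNat_of_zero_le (by omega : 0 ≤ k)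
    rw [finrank_PHom_nat, show 2 + n - 1 = n + 1 by omega, Nat.choose_succ_self_right]
    push_cast
    ring

theorem finrank_PHom_three {k : ℤ} (hk : -2 ≤ k) :
    2 * (Module.finrank ℝ (PHom 3 k) : ℤ) = (k + 1) * (k + 2) := by
  obtain hk0 | hk0 := lt_or_ge k 0
  · rw [finrank_PHom_of_neg hk0]
    interval_cases k <;> norm_num
  · obtain ⟨n, rfl⟩ := Int.eq_ofNat_of_zero_le hk0
    rw [finrank_PHom_nat, show 3 + n - 1 = n + 2 by omega, Nat.choose_symm_add]
    have h2 : (n + 2).choose 2 * 2 = (n + 2) * (n + 1) := by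
      have := Nat.add_one_mul_choose_eq (n + 1) 1
      simpa [mul_comm] using this.symm
    have h3 : ((n + 2).choose 2 : ℤ) * 2 = (n + 2) * (n + 1) := by exact_mod_cast h2
    linarith

theorem finrank_P_one {k : ℤ} (hk : -1 ≤ k) : (Module.finrank ℝ (P 1 k) : ℤ) = k + 1 := by
  obtain rfl | hk := eq_or_lt_of_le hk
  · rw [finrank_P_of_neg (by norm_num)]; norm_num
  · obtain ⟨n, rfl⟩ := Int.eq_ofNat_of_zero_le (by omega : 0 ≤ k)
    clear * -
    induction n with
    | zero => rw [Nat.cast_zero, finrank_P_zero]; norm_num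
    | succ n ih =>
      have h1 := finrank_PHom_one (n := n + 1)
      push_cast at h1 ⊢
      rw [finrank_P_add_one, h1]
      push_cast
      linarith

theorem finrank_P_two {k : ℤ} (hk : -2 ≤ k) :
    2 * (Module.finrank ℝ (P 2 k) : ℤ) = (k + 1) * (k + 2) := by
  obtain hk0 | hk0 := lt_or_ge k 0
  · rw [finrank_P_of_neg hk0]
    interval_cases k <;> norm_num
  · obtain ⟨n, rfl⟩ := Int.eq_ofNat_of_zero_le hk0
    clear hk hk0
    induction n with
    | zero => rw [Nat.cast_zero, finrank_P_zero]; norm_num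
    | succ n ih =>
      have h1 := finrank_PHom_two (k := n + 1) (by omega)
      push_cast at h1 ⊢
      rw [finrank_P_add_one]
      push_cast
      linarith

theorem finrank_P_three {k : ℤ} (hk : -3 ≤ k) :
    6 * (Module.finrank ℝ (P 3 k) : ℤ) = (k + 1) * (k + 2) * (k + 3) := by
  obtain hk0 | hk0 := lt_or_ge k 0
  · rw [finrank_P_of_neg hk0]
    interval_cases k <;> norm_num
  · obtain ⟨n, rfl⟩ := Int.eq_ofNat_of_zero_le hk0
    clear hk hk0
    induction n with
    | zero => rw [Nat.cast_zero, finrank_P_zero]; norm_num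
    | succ n ih =>
      have h1 := finrank_PHom_three (k := n + 1) (by omega)
      push_cast at h1 ⊢
      rw [finrank_P_add_one]
      push_cast
      linarith

theorem finrank_pi_submodule {d : ℕ} (N : Fin d → Submodule ℝ (Poly d))
    [∀ i, FiniteDimensional ℝ (N i)] :
    Module.finrank ℝ (Submodule.pi Set.univ N) = ∑ i, Module.finrank ℝ (N i) := by
  rw [(piEquiv N).finrank_eq, Module.finrank_pi_fintype]

theorem finrank_VP (d : ℕ) (k : ℤ) :
    Module.finrank ℝ (VP d k) = d * Module.finrank ℝ (P d k) := by
  rw [VP, finrank_pi_submodule]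
  simp

theorem finrank_VPHom (d : ℕ) (k : ℤ) :
    Module.finrank ℝ (VPHom d k) = d * Module.finrank ℝ (PHom d k) := by
  rw [VPHom, finrank_pi_submodule]
  simp

/-- Insertion of a variable with exponent zero. -/
def insertVar (i : Fin 3) (m : Fin 2 →₀ ℕ) : Fin 3 →₀ ℕ :=
  Finsupp.equivFunOnFinite.symm (Fin.insertNth (α := fun _ => ℕ) i 0 m)

theorem insertVar_injective (i : Fin 3) : Function.Injective (insertVar i) := by
  intro m m' h
  ext j
  have := DFunLike.congr_fun h (i.succAbove j)
  simpa [insertVar] using this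

theorem insertVar_self (i : Fin 3) (m : Fin 2 →₀ ℕ) : insertVar i m i = 0 := by
  simp [insertVar]

theorem sum_insertVar (i : Fin 3) (m : Fin 2 →₀ ℕ) : ∑ j, insertVar i m j = ∑ j, m j := by
  rw [Fin.sum_univ_succAbove _ i]
  simp [insertVar]

theorem finrank_P_two_le (i : Fin 3) (k : ℤ) : Module.finrank ℝ (P 2 k) ≤
    Module.finrank ℝ
      (restrictSupport ℝ {m : Fin 3 →₀ ℕ | ((∑ j, m j : ℕ) : ℤ) ≤ k ∧ m i = 0}) := by
  rw [P, finrank_restrictSupport, finrank_restrictSupport]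
  refine Set.ncard_le_ncard_of_injOn (insertVar i) (fun m hm => ⟨?_, insertVar_self i m⟩)
    (insertVar_injective i).injOn ((finite_setOf_sum_le 3 k).subset fun m hm => hm.1)
  rw [sum_insertVar]
  exact hm

theorem finrank_PHom_two_le (i : Fin 3) (k : ℤ) : Module.finrank ℝ (PHom 2 k) ≤
    Module.finrank ℝ
      (restrictSupport ℝ {m : Fin 3 →₀ ℕ | ((∑ j, m j : ℕ) : ℤ) = k ∧ m i = 0}) := by
  rw [PHom, finrank_restrictSupport, finrank_restrictSupport]
  refine Set.ncard_le_ncard_of_injOn (insertVar i) (fun m hm => ⟨?_, insertVar_self i m⟩)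
    (insertVar_injective i).injOn ((finite_setOf_sum_le 3 k).subset fun m hm => hm.1.le)
  rw [sum_insertVar]
  exact hm

/-- The exponent `(a, b, c)`. -/
def triple (a b c : ℕ) : Fin 3 →₀ ℕ := Finsupp.equivFunOnFinite.symm ![a, b, c]

theorem triple_inj {a b c a' b' c' : ℕ} (h : triple a b c = triple a' b' c') :
    a = a' ∧ b = b' ∧ c = c' :=
  ⟨DFunLike.congr_fun h 0, DFunLike.congr_fun h 1, DFunLike.congr_fun h 2⟩

theorem sum_triple (a b c : ℕ) : ∑ i, triple a b c i = a + b + c := by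
  rw [Fin.sum_univ_three]
  rfl

theorem superlinearDegree_triple (a b c : ℕ) : superlinearDegree (triple a b c) =
    (if a = 1 then 0 else a) + (if b = 1 then 0 else b) + if c = 1 then 0 else c := by
  rw [superlinearDegree, Fin.sum_univ_three]
  rfl

/-- The `a`-th natural number other than `1`. -/
def skipOne (a : ℕ) : ℕ := if a = 0 then 0 else a + 1

theorem skipOne_ne_one (a : ℕ) : skipOne a ≠ 1 := by rw [skipOne]; split_ifs <;> omega

theorem skipOne_le {a r : ℕ} (h : a < r) : skipOne a ≤ r := by rw [skipOne]; split_ifs <;> omega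

theorem skipOne_injective : Function.Injective skipOne := by
  intro a b h
  rw [skipOne, skipOne] at h
  split_ifs at h <;> omega

/-- The exponents `x_i x_{i+1}^b x_{i+2}^{r-b}`. -/
def oneLinear (r : ℕ) (i : Fin 3) (b : ℕ) : Fin 3 →₀ ℕ :=
  ![triple 1 b (r - b), triple (r - b) 1 b, triple b (r - b) 1] i

/-- The exponents `x_i x_j x_k^r`. -/
def twoLinear (r : ℕ) (i : Fin 3) : Fin 3 →₀ ℕ :=
  ![triple r 1 1, triple 1 r 1, triple 1 1 r] i

/-- A monomial `x_i x_{i+1}^b x_{i+2}^{r-b}` with two linear variables is counted only once if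
`b ≠ 1`. -/
theorem oneLinear_inj {r b b' : ℕ} (hb : b ≤ r) (hb1 : b ≠ 1) (hb' : b' ≤ r) (hb1' : b' ≠ 1) :
    ∀ {i j : Fin 3}, oneLinear r i b = oneLinear r j b' → i = j ∧ b = b'
  | 0, 0, h => ⟨rfl, (triple_inj h).2.1⟩
  | 1, 1, h => ⟨rfl, (triple_inj h).2.2⟩
  | 2, 2, h => ⟨rfl, (triple_inj h).1⟩
  | 0, 1, h => by
    obtain ⟨h1, h2, h3⟩ : 1 = r - b' ∧ b = 1 ∧ r - b = b' := triple_inj h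
    omega
  | 0, 2, h => by
    obtain ⟨h1, h2, h3⟩ : 1 = b' ∧ b = r - b' ∧ r - b = 1 := triple_inj h
    omega
  | 1, 0, h => by
    obtain ⟨h1, h2, h3⟩ : r - b = 1 ∧ 1 = b' ∧ b = r - b' := triple_inj h
    omega
  | 1, 2, h => by
    obtain ⟨h1, h2, h3⟩ : r - b = b' ∧ 1 = r - b' ∧ b = 1 := triple_inj h
    omega
  | 2, 0, h => by
    obtain ⟨h1, h2, h3⟩ : b = 1 ∧ r - b = b' ∧ 1 = r - b' := triple_inj h
    omega
  | 2, 1, h => by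
    obtain ⟨h1, h2, h3⟩ : b = r - b' ∧ r - b = 1 ∧ 1 = b' := triple_inj h
    omega

theorem oneLinear_ne_triple {b : ℕ} (hb1 : b ≠ 1) : ∀ i, oneLinear 2 i b ≠ triple 1 1 1
  | 0, h => hb1 (triple_inj h).2.1
  | 1, h => hb1 (triple_inj h).2.2
  | 2, h => hb1 (triple_inj h).1

theorem sum_oneLinear {r b : ℕ} (hb : b ≤ r) : ∀ i, ∑ j, oneLinear r i b j = r + 1
  | 0 => (sum_triple 1 b (r - b)).trans (by omega)
  | 1 => (sum_triple (r - b) 1 b).trans (by omega)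
  | 2 => (sum_triple b (r - b) 1).trans (by omega)

theorem superlinearDegree_oneLinear {r b : ℕ} (hb : b ≤ r) :
    ∀ i, superlinearDegree (oneLinear r i b) ≤ r
  | 0 => (superlinearDegree_triple 1 b (r - b)).trans_le (by split_ifs <;> omega)
  | 1 => (superlinearDegree_triple (r - b) 1 b).trans_le (by split_ifs <;> omega)
  | 2 => (superlinearDegree_triple b (r - b) 1).trans_le (by split_ifs <;> omega)

theorem twoLinear_injective {r : ℕ} (hr : 2 ≤ r) : Function.Injective (twoLinear r) := by
  intro i j h
  fin_cases i <;> fin_cases j <;> first | rfl | (have := triple_inj h; omega)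

theorem sum_twoLinear {r : ℕ} (i : Fin 3) : ∑ j, twoLinear r i j = r + 2 := by
  fin_cases i <;> refine (sum_triple _ _ _).trans ?_ <;> omega

theorem superlinearDegree_twoLinear {r : ℕ} (i : Fin 3) :
    superlinearDegree (twoLinear r i) ≤ r := by
  fin_cases i <;> refine (superlinearDegree_triple _ _ _).trans_le ?_ <;> split_ifs <;> omega

theorem superlinearDegree_le_sum (m : Fin 3 →₀ ℕ) : superlinearDegree m ≤ ∑ i, m i :=
  Finset.sum_le_sum fun i _ => by split_ifs <;> omega

theorem finite_setOf_superlinearDegree_le (r : ℕ) :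
    {m : Fin 3 →₀ ℕ | superlinearDegree m ≤ r}.Finite := by
  refine (Set.finite_Iic (Finsupp.equivFunOnFinite.symm fun _ : Fin 3 => r + 1)).subset ?_
  intro m hm i
  have h1 : (if m i = 1 then 0 else m i) ≤ superlinearDegree m :=
    Finset.single_le_sum (f := fun i => if m i = 1 then 0 else m i) (fun _ _ => Nat.zero_le _)
      (Finset.mem_univ i)
  simp only [Set.mem_ofPred_eq] at hm
  change m i ≤ r + 1
  split_ifs at h1 <;> omega

/-- Besides the monomials of degree at most `r`, the serendipity space contains `3 r` monomials of
degree `r + 1` with a linear variable, the three monomials `x_i x_j x_k^r`, and, for `r = 2`, the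
monomial `x_0 x_1 x_2`, which is not of the form `x_i x_j^2`. -/
theorem le_ncard_superlinearDegree {r : ℕ} (hr : 2 ≤ r) :
    Module.finrank ℝ (P 3 r) + 3 * r + 3 + (if r = 2 then 1 else 0) ≤
      {m : Fin 3 →₀ ℕ | superlinearDegree m ≤ r}.ncard := by
  classical
  set F : Fin 3 × Fin r → Fin 3 →₀ ℕ := fun x => oneLinear r x.1 (skipOne x.2) with hF
  have hFinj : Function.Injective F := by
    rintro ⟨i, a⟩ ⟨j, b⟩ h
    have := oneLinear_inj (skipOne_le a.2) (skipOne_ne_one a) (skipOne_le b.2) (skipOne_ne_one b) h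
    exact Prod.ext this.1 (Fin.ext (skipOne_injective this.2))
  have hFsum : ∀ x, ∑ j, F x j = r + 1 := fun x => sum_oneLinear (skipOne_le x.2.2) x.1
  have c2 : (Set.range F).ncard = 3 * r := by
    rw [← Nat.card_coe_set_eq, Nat.card_range_of_injective hFinj]
    simp
  have c3 : (Set.range (twoLinear r)).ncard = 3 := by
    rw [← Nat.card_coe_set_eq, Nat.card_range_of_injective (twoLinear_injective hr)]
    simp
  set T4 : Set (Fin 3 →₀ ℕ) := if r = 2 then {triple 1 1 1} else ∅ with hT4
  have c4 : T4.ncard = if r = 2 then 1 else 0 := by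
    rw [hT4]; split_ifs <;> simp
  have h4 : ∀ m ∈ T4, r = 2 ∧ m = triple 1 1 1 := by
    intro m hm
    rw [hT4] at hm
    split_ifs at hm with h
    · exact ⟨h, hm⟩
    · exact absurd hm (Set.notMem_empty _)
  have f1 := finite_setOf_sum_le 3 (r : ℤ)
  have f2 := Set.finite_range F
  have f3 := Set.finite_range (twoLinear r)
  have f4 : T4.Finite := (Set.finite_singleton (triple 1 1 1)).subset fun m hm => (h4 m hm).2
  have d12 : Disjoint {m : Fin 3 →₀ ℕ | ((∑ i, m i : ℕ) : ℤ) ≤ r} (Set.range F) := by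
    rw [Set.disjoint_left]
    rintro _ hm ⟨x, rfl⟩
    rw [Set.mem_ofPred_eq, hFsum] at hm
    omega
  have d123 : Disjoint ({m : Fin 3 →₀ ℕ | ((∑ i, m i : ℕ) : ℤ) ≤ r} ∪ Set.range F)
      (Set.range (twoLinear r)) := by
    rw [Set.disjoint_left]
    rintro _ (hm | ⟨x, hx⟩) ⟨i, rfl⟩
    · rw [Set.mem_ofPred_eq, sum_twoLinear] at hm
      omega
    · have h1 := hFsum x
      rw [hx, sum_twoLinear] at h1
      omega
  have d1234 : Disjoint ({m : Fin 3 →₀ ℕ | ((∑ i, m i : ℕ) : ℤ) ≤ r} ∪ Set.range F ∪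
      Set.range (twoLinear r)) T4 := by
    rw [Set.disjoint_left]
    rintro m hm hm4
    obtain ⟨rfl, rfl⟩ := h4 m hm4
    rcases hm with (hm | ⟨⟨i, a⟩, hx⟩) | ⟨i, hx⟩
    · rw [Set.mem_ofPred_eq, sum_triple] at hm
      omega
    · exact oneLinear_ne_triple (skipOne_ne_one a) i hx
    · have h1 := sum_twoLinear (r := 2) i
      rw [hx, sum_triple] at h1
      omega
  rw [P, finrank_restrictSupport]
  have hcard := Set.ncard_union_eq d1234 ((f1.union f2).union f3) f4
  rw [Set.ncard_union_eq d123 (f1.union f2) f3, Set.ncard_union_eq d12 f1 f2, c2, c3, c4] at hcard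
  rw [← hcard]
  refine Set.ncard_le_ncard ?_ (finite_setOf_superlinearDegree_le r)
  rintro m (((hm | ⟨x, rfl⟩) | ⟨i, rfl⟩) | hm)
  · have := superlinearDegree_le_sum m
    simp only [Set.mem_ofPred_eq] at hm ⊢
    omega
  · exact superlinearDegree_oneLinear (skipOne_le x.2.2) x.1
  · exact superlinearDegree_twoLinear i
  · obtain ⟨-, rfl⟩ := h4 m hm
    rw [Set.mem_ofPred_eq, superlinearDegree_triple]
    simp

/-! ### Dimensions -/

theorem eq_zero_of_grad {φ : Poly 3} (h0 : coeff 0 φ = 0)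
    (hφ : ∑ i, X i * pderiv i φ = 0) : φ = 0 := by
  rw [euler] at hφ
  ext m
  have h1 := congrArg (coeff m) hφ
  rw [coeff_scale, coeff_zero, mul_eq_zero, Nat.cast_eq_zero] at h1
  rcases h1 with h1 | h1
  · have : m = 0 := Finsupp.ext fun i => by simpa using Finset.sum_eq_zero_iff.1 h1 i
    rw [this, h0, coeff_zero]
  · exact h1

theorem eq_zero_of_wField {k : ℤ} (hk : 0 < k) {w : VPoly 3} (hw : w ∈ W k)
    (h : wField w = 0) : w = 0 := by
  have hcurl := fun i => curl_wField hw i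
  rw [h] at hcurl
  have hX : ∀ i, C ((k : ℝ) + 3) * w i - ∑ j, w j = 0 := by
    intro i
    have := hcurl i
    rw [map_zero] at this
    exact (mul_eq_zero.1 this.symm).resolve_left (X_ne_zero i)
  have hk' : (0 : ℝ) < k + 1 := by
    have : (0 : ℝ) < k := by exact_mod_cast hk
    linarith
  refine eq_zero_of_coeff_relations hk' hk hw fun i m _ _ => ?_
  have := congrArg (coeff m) (hX i)
  rw [coeff_sub, coeff_C_mul, coeff_sum, coeff_zero] at this
  rw [← this]
  ring

/-- Fields `p` with `p_2` independent of `x_2`: a complement of the kernel of `p ↦ p × x`. -/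
def crossParam (k : ℤ) : Submodule ℝ (VPoly 3) :=
  Submodule.pi Set.univ ![P 3 k, P 3 k, restrictSupport ℝ {m | ((∑ j, m j : ℕ) : ℤ) ≤ k ∧ m 2 = 0}]

theorem mem_crossParam {k : ℤ} {p : VPoly 3} : p ∈ crossParam k ↔
    p 0 ∈ P 3 k ∧ p 1 ∈ P 3 k ∧
      p 2 ∈ restrictSupport ℝ {m | ((∑ j, m j : ℕ) : ℤ) ≤ k ∧ m 2 = 0} := by
  simp [crossParam, Submodule.mem_pi, Fin.forall_fin_succ]

theorem crossParam_le (k : ℤ) : crossParam k ≤ VP 3 k := by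
  intro p hp
  obtain ⟨h0, h1, h2⟩ := mem_crossParam.1 hp
  refine mem_VP.2 fun i => ?_
  fin_cases i
  exacts [h0, h1, restrictSupport_mono ℝ (fun m hm => hm.1) h2]

theorem eq_zero_of_crossRight {k : ℤ} {p : VPoly 3} (hp : p ∈ crossParam k)
    (h : crossRight X p = 0) : p = 0 := by
  rw [crossRight_apply] at h
  have e0 : p 1 * X 2 - p 2 * X 1 = 0 := congrFun h 0
  have e1 : p 2 * X 0 - p 0 * X 2 = 0 := congrFun h 1
  have h2 : p 2 = 0 := by
    ext m
    by_contra hne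
    have hm := (mem_restrictSupport.1 (mem_crossParam.1 hp).2.2 m hne).2
    have h3 := congrArg (coeff (m + Finsupp.single 1 1)) e0
    rw [coeff_sub, coeff_mul_X, coeff_mul_X', if_neg (by simp [hm]), zero_sub, coeff_zero,
      neg_eq_zero] at h3
    exact hne h3
  rw [h2, zero_mul, sub_zero] at e0
  rw [h2, zero_mul, zero_sub, neg_eq_zero] at e1
  ext i : 1
  fin_cases i
  exacts [(mul_eq_zero.1 e1).resolve_right (X_ne_zero 2),
    (mul_eq_zero.1 e0).resolve_right (X_ne_zero 2), h2]

instance finite_S0 (r : ℕ) : FiniteDimensional ℝ (S0 r) :=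
  finite_restrictSupport (finite_setOf_superlinearDegree_le r)

theorem W_le (k : ℤ) : W k ≤ VP 3 k := fun _ hw =>
  mem_VP.2 fun i => restrictSupport_mono ℝ (fun _ hm => hm.1.le) (mem_W.1 hw i)

instance finite_W (k : ℤ) : FiniteDimensional ℝ (W k) := Submodule.finiteDimensional_of_le (W_le k)

instance finite_S1 (r : ℕ) : FiniteDimensional ℝ (S1 r) := by
  unfold S1
  infer_instance

/-- The serendipity polynomials without constant term. -/
def S0' (r : ℕ) : Submodule ℝ (Poly 3) :=
  restrictSupport ℝ ({m | superlinearDegree m ≤ r} \ {0})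

theorem S0'_le (r : ℕ) : S0' r ≤ S0 r := restrictSupport_mono ℝ Set.sdiff_subset

instance finite_S0' (r : ℕ) : FiniteDimensional ℝ (S0' r) :=
  Submodule.finiteDimensional_of_le (S0'_le r)

instance finite_crossParam (k : ℤ) : FiniteDimensional ℝ (crossParam k) :=
  Submodule.finiteDimensional_of_le (crossParam_le k)

/-- The three summands of `S^1` are independent: the product with `x` isolates the gradient, and
the other two have components of degree at most `r` and homogeneous of degree `r + 1`. -/
theorem finrank_le_finrank_S1 {r : ℕ} (hr : 2 ≤ r) :
    Module.finrank ℝ (S0' r) + Module.finrank ℝ (crossParam ((r : ℤ) - 1)) +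
      Module.finrank ℝ (W ((r : ℤ) - 1)) ≤ Module.finrank ℝ (S1 r) := by
  let L : (S0' r × crossParam ((r : ℤ) - 1)) × W ((r : ℤ) - 1) →ₗ[ℝ] VPoly 3 :=
    (((grad 3).domRestrict (S0' r)).coprod
      ((crossRight X).domRestrict (crossParam ((r : ℤ) - 1)))).coprod
      (wField.domRestrict (W ((r : ℤ) - 1)))
  have hL : ∀ z, L z ∈ S1 r := by
    rintro ⟨⟨φ, p⟩, w⟩
    change grad 3 φ.1 + crossRight X p.1 + wField w.1 ∈ S1 r
    have h1 : grad 3 φ.1 ∈ (S0 r).map (grad 3) := Submodule.mem_map_of_mem (S0'_le r φ.2)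
    have h2 : crossRight X p.1 ∈ (VP 3 ((r : ℤ) - 1)).map (crossRight X) :=
      Submodule.mem_map_of_mem (crossParam_le _ p.2)
    have h3 : wField w.1 ∈ (W ((r : ℤ) - 1)).map wField := Submodule.mem_map_of_mem w.2
    exact add_mem (Submodule.mem_sup_left (add_mem (Submodule.mem_sup_left h1)
      (Submodule.mem_sup_right h2))) (Submodule.mem_sup_right h3)
  have hinj : Function.Injective L := by
    refine (injective_iff_map_eq_zero L).2 ?_
    rintro ⟨⟨⟨φ, hφ⟩, ⟨p, hp⟩⟩, ⟨w, hw⟩⟩ h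
    have h0 : grad 3 φ + crossRight X p + wField w = 0 := h
    have hφ0 : φ = 0 := by
      refine eq_zero_of_grad ?_ ?_
      · by_contra hne
        exact (mem_restrictSupport.1 hφ 0 hne).2 rfl
      · have h1 : ∑ i, X i * (grad 3 φ + crossRight X p + wField w) i = 0 := by
          rw [h0]; simp
        simpa only [Pi.add_apply, mul_add, Finset.sum_add_distrib, sum_X_mul_crossRight,
          sum_X_mul_wField, add_zero, grad_apply] using h1
    rw [hφ0, map_zero, zero_add] at h0
    have hcross := crossRight_X_mem_VP (l := r) (by linarith) (crossParam_le _ hp)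
    have hwhom : ∀ i, wField w i ∈ PHom 3 ((r : ℤ) + 1) := by
      have hwi : ∀ i, w i ∈ PHom 3 ((r : ℤ) - 1) := fun i =>
        restrictSupport_mono ℝ (fun m hm => hm.1) (mem_W.1 hw i)
      have hmul : ∀ i j (q : Poly 3), q ∈ PHom 3 ((r : ℤ) - 1) →
          X i * X j * q ∈ PHom 3 ((r : ℤ) + 1) := by
        intro i j q hq
        have hX : ∀ i : Fin 3, (X i : Poly 3) ∈ PHom 3 1 := fun i =>
          X_mem_restrictSupport i (by simp only [Set.mem_ofPred_eq, sum_single, Nat.cast_one])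
        have hadd : ∀ (a b l : ℤ) (s t : Poly 3), l = a + b → s ∈ PHom 3 a → t ∈ PHom 3 b →
            s * t ∈ PHom 3 l := by
          intro a b l s t hl hs ht
          refine mul_mem_restrictSupport (fun m hm n hn => ?_) hs ht
          simp only [Set.mem_ofPred_eq, Finsupp.add_apply, Finset.sum_add_distrib,
            Nat.cast_add] at *
          omega
        exact hadd 2 _ _ _ _ (by ring) (hadd 1 1 2 _ _ (by norm_num) (hX i) (hX j)) hq
      intro i
      rw [wField_apply]
      fin_cases i <;> exact hmul _ _ _ (sub_mem (hwi _) (hwi _))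
    have hw0 : wField w = 0 := by
      ext i m
      by_contra hne
      have h1 := mem_PHom.1 (hwhom i) m hne
      have h2 : coeff m (crossRight X p i) = 0 := by
        by_contra hne'
        have := mem_P.1 (mem_VP.1 hcross i) m hne'
        omega
      have h3 := congrArg (coeff m) (congrFun h0 i)
      rw [Pi.add_apply, coeff_add, h2, zero_add] at h3
      exact hne h3
    rw [hw0, add_zero] at h0
    have hp0 := eq_zero_of_crossRight hp h0
    have hw0' := eq_zero_of_wField (by omega) hw hw0
    subst hφ0 hp0 hw0'
    rfl
  rw [← Module.finrank_prod, ← Module.finrank_prod, ← LinearMap.finrank_range_of_inj hinj]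
  refine Submodule.finrank_mono ?_
  rintro _ ⟨z, rfl⟩
  exact hL z

theorem finrank_edgeTest {r : ℕ} : Module.finrank ℝ (edgeTest r) = r := by
  have := finrank_P_one (k := (r : ℤ) - 1) (by omega)
  rw [edgeTest]
  omega

instance finite_edgeTest (r : ℕ) : FiniteDimensional ℝ (edgeTest r) := finite_P _ _

instance finite_faceTest (r : ℕ) : FiniteDimensional ℝ (faceTest r) := by
  unfold faceTest
  infer_instance

instance finite_faceCurlTest (r : ℕ) : FiniteDimensional ℝ (faceCurlTest r) := finite_VP _ _

instance finite_cellTest (r : ℕ) : FiniteDimensional ℝ (cellTest r) := by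
  unfold cellTest
  infer_instance

theorem finrank_faceTest_le {r : ℕ} (hr : 2 ≤ r) :
    (Module.finrank ℝ (faceTest r) : ℤ) ≤ ((r : ℤ) - 2) * (r - 1) + r := by
  have h1 : Module.finrank ℝ (faceTest r) ≤
      2 * Module.finrank ℝ (P 2 ((r : ℤ) - 3)) + Module.finrank ℝ (PHom 2 ((r : ℤ) - 1)) := by
    refine (Submodule.finrank_add_le_finrank_add_finrank _ _).trans ?_
    rw [finrank_VP]
    exact Nat.add_le_add_left (Submodule.finrank_map_le _ _) _
  have h2 := finrank_P_two (k := (r : ℤ) - 3) (by omega)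
  have h3 := finrank_PHom_two (k := (r : ℤ) - 1) (by omega)
  have h4 : (Module.finrank ℝ (faceTest r) : ℤ) ≤
      2 * Module.finrank ℝ (P 2 ((r : ℤ) - 3)) + Module.finrank ℝ (PHom 2 ((r : ℤ) - 1)) := by
    exact_mod_cast h1
  linarith

/-- Gradients of homogeneous polynomials lie in the kernel of the curl. -/
theorem finrank_curl_VPHom {k : ℤ} (hk : 0 ≤ k) :
    Module.finrank ℝ ((VPHom 3 k).map curl) + Module.finrank ℝ (PHom 3 (k + 1)) ≤
      3 * Module.finrank ℝ (PHom 3 k) := by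
  have hrank := (curl.domRestrict (VPHom 3 k)).finrank_range_add_finrank_ker
  rw [LinearMap.range_domRestrict, finrank_VPHom] at hrank
  rw [← hrank]
  refine Nat.add_le_add_left ?_ _
  have hmem : ∀ φ : PHom 3 (k + 1), grad 3 φ.1 ∈ VPHom 3 k := fun φ =>
    mem_VPHom.2 fun i => pderiv_mem_PHom (by ring) i φ.2
  let G : PHom 3 (k + 1) →ₗ[ℝ] LinearMap.ker (curl.domRestrict (VPHom 3 k)) :=
    (((grad 3).domRestrict (PHom 3 (k + 1))).codRestrict (VPHom 3 k) hmem).codRestrict _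
      fun φ => curl_grad φ.1
  refine LinearMap.finrank_le_finrank_of_injective (f := G) ((injective_iff_map_eq_zero G).2 ?_)
  intro φ hφ
  have h0 : grad 3 φ.1 = 0 := congrArg (fun z => z.1.1) hφ
  refine Subtype.ext (eq_zero_of_grad ?_ (Finset.sum_eq_zero fun i _ => ?_))
  · by_contra hne
    have := mem_PHom.1 φ.2 0 hne
    simp at this
    omega
  · rw [← grad_apply, h0, Pi.zero_apply, mul_zero]

theorem finrank_cellTest_two : Module.finrank ℝ (cellTest 2) = 0 := by
  have : cellTest 2 ≤ VP 3 (-1) := Cube.cellTest_le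
  have h1 := Submodule.finrank_mono this
  rw [finrank_VP, finrank_P_of_neg (by norm_num)] at h1
  omega

theorem finrank_cellTest_le {r : ℕ} (hr : 3 ≤ r) :
    2 * (Module.finrank ℝ (cellTest r) : ℤ) ≤
      ((r : ℤ) - 4) * (r - 3) * (r - 2) + 3 * ((r - 2) * (r - 1)) - (r - 1) * r := by
  have h1 : Module.finrank ℝ (cellTest r) ≤ 3 * Module.finrank ℝ (P 3 ((r : ℤ) - 5)) +
      Module.finrank ℝ ((VPHom 3 ((r : ℤ) - 3)).map curl) := by
    refine (Submodule.finrank_add_le_finrank_add_finrank _ _).trans ?_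
    rw [finrank_VP]
  have h2 := finrank_curl_VPHom (k := (r : ℤ) - 3) (by omega)
  have h3 := finrank_P_three (k := (r : ℤ) - 5) (by omega)
  have h4 := finrank_PHom_three (k := (r : ℤ) - 3) (by omega)
  have h5 := finrank_PHom_three (k := (r : ℤ) - 3 + 1) (by omega)
  zify at h1 h2
  linarith

/-- The number of edge, face and interior moments is at most the dimension of `S^1`. Equality holds
because these moments determine a field of `S^1`. -/
theorem le_finrank_S1 {r : ℕ} (hr : 2 ≤ r) :
    12 * r + 6 * Module.finrank ℝ (faceTest r) + Module.finrank ℝ (cellTest r) ≤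
      Module.finrank ℝ (S1 r) := by
  have h1 := finrank_le_finrank_S1 hr
  have hS0 : Module.finrank ℝ (P 3 r) + 3 * r + 2 + (if r = 2 then 1 else 0) ≤
      Module.finrank ℝ (S0' r) := by
    rw [S0', finrank_restrictSupport,
      Set.ncard_sdiff_singleton_of_mem (by simp [superlinearDegree])]
    have := le_ncard_superlinearDegree hr
    omega
  have hcross : 2 * Module.finrank ℝ (P 3 ((r : ℤ) - 1)) +
      Module.finrank ℝ (P 2 ((r : ℤ) - 1)) ≤
      Module.finrank ℝ (crossParam ((r : ℤ) - 1)) := by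
    have hfin : FiniteDimensional ℝ (restrictSupport ℝ
        {m : Fin 3 →₀ ℕ | ((∑ j, m j : ℕ) : ℤ) ≤ (r : ℤ) - 1 ∧ m 2 = 0}) :=
      Submodule.finiteDimensional_of_le (S₂ := P 3 ((r : ℤ) - 1))
        (restrictSupport_mono ℝ fun m hm => hm.1)
    have : ∀ i, FiniteDimensional ℝ (![P 3 ((r : ℤ) - 1), P 3 ((r : ℤ) - 1), restrictSupport ℝ
        {m : Fin 3 →₀ ℕ | ((∑ j, m j : ℕ) : ℤ) ≤ (r : ℤ) - 1 ∧ m 2 = 0}] i) := by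
      intro i
      fin_cases i
      exacts [finite_P _ _, finite_P _ _, hfin]
    have h2 := finrank_P_two_le 2 ((r : ℤ) - 1)
    rw [crossParam, finrank_pi_submodule, Fin.sum_univ_three]
    change _ ≤ Module.finrank ℝ (P 3 ((r : ℤ) - 1)) + Module.finrank ℝ (P 3 ((r : ℤ) - 1)) +
      Module.finrank ℝ (restrictSupport ℝ
        {m : Fin 3 →₀ ℕ | ((∑ j, m j : ℕ) : ℤ) ≤ (r : ℤ) - 1 ∧ m 2 = 0})
    omega
  have hW : 3 * Module.finrank ℝ (PHom 2 ((r : ℤ) - 1)) ≤ Module.finrank ℝ (W ((r : ℤ) - 1)) := by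
    have : ∀ i : Fin 3, FiniteDimensional ℝ (restrictSupport ℝ
        {m : Fin 3 →₀ ℕ | ((∑ j, m j : ℕ) : ℤ) = (r : ℤ) - 1 ∧ m i = 0}) := fun i =>
      Submodule.finiteDimensional_of_le (S₂ := P 3 ((r : ℤ) - 1))
        (restrictSupport_mono ℝ fun m hm => hm.1.le)
    have h2 := fun i => finrank_PHom_two_le i ((r : ℤ) - 1)
    rw [W, finrank_pi_submodule, Fin.sum_univ_three]
    refine le_trans (le_of_eq ?_) (add_le_add (add_le_add (h2 0) (h2 1)) (h2 2))
    ring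
  have a1 := finrank_P_three (k := r) (by omega)
  have a2 := finrank_P_three (k := (r : ℤ) - 1) (by omega)
  have a3 := finrank_P_two (k := (r : ℤ) - 1) (by omega)
  have a4 := finrank_PHom_two (k := (r : ℤ) - 1) (by omega)
  have a5 := finrank_faceTest_le hr
  obtain rfl | hr3 := eq_or_lt_of_le hr
  · rw [finrank_cellTest_two]
    norm_num at *
    omega
  · have a6 := finrank_cellTest_le hr3
    rw [if_neg (by omega)] at hS0
    zify at *
    linarith

theorem finrank_faceTest_two : Module.finrank ℝ (faceTest 2) = 2 := by
  have h1 := finrank_faceTest_le (le_refl 2)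
  have hle : 2 ≤ Module.finrank ℝ (faceTest 2) := by
    have hmem : ∀ φ : PHom 2 1, grad 2 φ.1 ∈ faceTest 2 := fun φ =>
      Submodule.mem_sup_right (Submodule.mem_map_of_mem φ.2)
    have h2 := finrank_PHom_two (k := 1) (by norm_num)
    have hinj : Function.Injective
        (((grad 2).domRestrict (PHom 2 1)).codRestrict (faceTest 2) hmem) := by
      refine (injective_iff_map_eq_zero _).2 ?_
      intro φ hφ
      have h0 : grad 2 φ.1 = 0 := congrArg Subtype.val hφ
      refine Subtype.ext ?_
      have h3 : ∑ i, X i * pderiv i φ.1 = 0 :=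
        Finset.sum_eq_zero fun i _ => by rw [← grad_apply, h0, Pi.zero_apply, mul_zero]
      rw [euler] at h3
      ext m
      by_contra hne
      have h4 := congrArg (coeff m) h3
      have h5 := mem_PHom.1 φ.2 m hne
      rw [coeff_scale, coeff_zero, mul_eq_zero, Nat.cast_eq_zero] at h4
      rcases h4 with h4 | h4
      · omega
      · exact hne h4
    have := LinearMap.finrank_le_finrank_of_injective hinj
    omega
  norm_num at h1
  omega

theorem numDofs_two : numDofs 2 = 48 := by
  have h1 : Module.finrank ℝ (faceCurlTest 2) = 2 := by
    have : faceCurlTest 2 = VP 2 0 := by rw [faceCurlTest]; norm_num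
    rw [this, finrank_VP, finrank_P_zero]
  rw [numDofs, finrank_edgeTest, finrank_faceTest_two, h1, finrank_cellTest_two]
  simp

namespace Cube

variable (K : Cube)

/-! ### The moments as bilinear maps -/

/-- The integral of a polynomial over an edge, as a linear functional. -/
def edgeInt (e : Edge) : Poly 1 →ₗ[ℝ] ℝ where
  toFun p := ∫ t in (K.c e.1 - K.h e.1)..(K.c e.1 + K.h e.1), eval (fun _ => t) p
  map_add' p q := by
    have hint : ∀ p : Poly 1, IntervalIntegrable (fun t => eval (fun _ => t) p) volume
        (K.c e.1 - K.h e.1) (K.c e.1 + K.h e.1) := fun p =>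
      ((MvPolynomial.continuous_eval p).comp
        (continuous_pi fun _ => continuous_id)).intervalIntegrable _ _
    simp only [map_add]
    exact intervalIntegral.integral_add (hint p) (hint q)
  map_smul' a p := by
    simp only [smul_eval]
    exact intervalIntegral.integral_const_mul a _

/-- The edge moments as a bilinear map. -/
def edgeMomentₗ (e : Edge) (s : Bool) : VPoly 3 →ₗ[ℝ] Poly 1 →ₗ[ℝ] ℝ :=
  have h : ∀ u q, K.edgeMoment e (unitVec e.1 s) u q =
      sgn s * K.edgeInt e (K.toEdge e (u e.1) * q) := K.edgeMoment_eq e s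
  LinearMap.mk₂ ℝ (K.edgeMoment e (unitVec e.1 s))
    (fun u v q => by simp only [h, Pi.add_apply, map_add, add_mul, mul_add])
    (fun a u q => by
      simp only [h, Pi.smul_apply, map_smul, smul_mul_assoc, smul_eq_mul]; ring)
    (fun u p q => by simp only [h, map_add, mul_add])
    (fun a u q => by simp only [h, mul_smul_comm, map_smul, smul_eq_mul]; ring)

/-- The face moments as a bilinear map. -/
def faceMomentₗ (f : Face) (s : Bool) : VPoly 3 →ₗ[ℝ] VPoly 2 →ₗ[ℝ] ℝ :=
  LinearMap.mk₂ ℝ (K.faceMoment f (unitVec f.1 s))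
    (fun u v q => by
      obtain ⟨θ, -, h⟩ := K.faceMoment_eq f s
      rw [h, h, h, ← mul_add, ← map_add, map_add, Pi.add_apply, Pi.add_apply]
      ring_nf)
    (fun a u q => by
      obtain ⟨θ, -, h⟩ := K.faceMoment_eq f s
      rw [h, h, map_smul, Pi.smul_apply, Pi.smul_apply, smul_mul_assoc, smul_mul_assoc,
        ← smul_sub, map_smul, smul_eq_mul, smul_eq_mul, mul_left_comm])
    (fun u p q => by
      obtain ⟨θ, -, h⟩ := K.faceMoment_eq f s
      rw [h, h, h, ← mul_add, ← map_add, Pi.add_apply, Pi.add_apply]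
      ring_nf)
    (fun a u q => by
      obtain ⟨θ, -, h⟩ := K.faceMoment_eq f s
      rw [h, h, Pi.smul_apply, Pi.smul_apply, mul_smul_comm, mul_smul_comm, ← smul_sub, map_smul,
        smul_eq_mul, smul_eq_mul, mul_left_comm])

/-- The interior moments as a bilinear map. -/
def cellMomentₗ : VPoly 3 →ₗ[ℝ] VPoly 3 →ₗ[ℝ] ℝ :=
  have h : ∀ u q, K.cellMoment u q = form K.c K.h 1 u q := fun u q => by
    rw [K.cellMoment_eq, form_apply, one_mul]
  LinearMap.mk₂ ℝ K.cellMoment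
    (fun u v q => by simp only [h, map_add, LinearMap.add_apply])
    (fun a u q => by simp only [h, map_smul, LinearMap.smul_apply])
    (fun u p q => by simp only [h, map_add])
    (fun a u q => by simp only [h, map_smul])

/-! ### Unisolvence -/

instance finite_momentSpace (r : ℕ) : FiniteDimensional ℝ
    (((Edge → Module.Dual ℝ (edgeTest r)) × (Face → Module.Dual ℝ (faceTest r))) ×
      Module.Dual ℝ (cellTest r)) := by
  have h1 : FiniteDimensional ℝ (Module.Dual ℝ (edgeTest r)) :=
    Subspace.instModuleDualFiniteDimensional
  have h2 : FiniteDimensional ℝ (Module.Dual ℝ (faceTest r)) :=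
    Subspace.instModuleDualFiniteDimensional
  have h3 : FiniteDimensional ℝ (Module.Dual ℝ (cellTest r)) :=
    Subspace.instModuleDualFiniteDimensional
  exact @Module.Finite.prod ℝ _ _ _ _ _ _ _ (@Module.Finite.prod ℝ _ _ _ _ _ _ _
    (@Module.Finite.pi ℝ _ Edge _ _ _ _ fun _ => h1)
    (@Module.Finite.pi ℝ _ Face _ _ _ _ fun _ => h2)) h3

/-- The edge, face and interior moments of a field, as functionals on the test spaces. -/
def moments (r : ℕ) (σ : Edge → Bool) (ν : Face → Bool) : VPoly 3 →ₗ[ℝ]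
    ((Edge → Module.Dual ℝ (edgeTest r)) × (Face → Module.Dual ℝ (faceTest r))) ×
      Module.Dual ℝ (cellTest r) :=
  ((LinearMap.pi fun e => (edgeTest r).dualRestrict ∘ₗ K.edgeMomentₗ e (σ e)).prod
    (LinearMap.pi fun f => (faceTest r).dualRestrict ∘ₗ K.faceMomentₗ f (ν f))).prod
      ((cellTest r).dualRestrict ∘ₗ K.cellMomentₗ)

theorem moments_eq_iff {r : ℕ} {σ : Edge → Bool} {ν : Face → Bool} {u : VPoly 3}
    {a₁ : Edge → Module.Dual ℝ (edgeTest r)} {a₂ : Face → Module.Dual ℝ (faceTest r)}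
    {a₄ : Module.Dual ℝ (cellTest r)} : K.moments r σ ν u = ((a₁, a₂), a₄) ↔
      (∀ (e : Edge) (q : edgeTest r), K.edgeMoment e (unitVec e.1 (σ e)) u q = a₁ e q) ∧
      (∀ (f : Face) (q : faceTest r), K.faceMoment f (unitVec f.1 (ν f)) u q = a₂ f q) ∧
      (∀ q : cellTest r, K.cellMoment u q = a₄ q) := by
  constructor
  · intro h
    have h1 := congrArg (fun z => z.1.1) h
    have h2 := congrArg (fun z => z.1.2) h
    have h3 := congrArg (fun z => z.2) h
    exact ⟨fun e q => LinearMap.congr_fun (congrFun h1 e) q,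
      fun f q => LinearMap.congr_fun (congrFun h2 f) q, fun q => LinearMap.congr_fun h3 q⟩
  · rintro ⟨h1, h2, h3⟩
    refine Prod.ext (Prod.ext ?_ ?_) ?_
    · exact funext fun e => LinearMap.ext fun q => h1 e q
    · exact funext fun f => LinearMap.ext fun q => h2 f q
    · exact LinearMap.ext fun q => h3 q

theorem moments_of_mem_V {r : ℕ} {v : VPoly 3} (hv : v ∈ K.V ((r : ℤ) - 2)) (σ : Edge → Bool)
    (ν : Face → Bool) : K.moments r σ ν v = 0 :=
  K.moments_eq_iff.2 ⟨fun e q => K.edgeMoment_of_mem_V hv e _ q,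
    fun f q => K.faceMoment_of_mem_V hv f _ q, fun q => K.cellMoment_of_mem_V hv q.2⟩

theorem eq_zero_of_moments_eq_zero {r : ℕ} (hr : 2 ≤ r) {u : VPoly 3} (hu : u ∈ S1 r)
    {σ : Edge → Bool} {ν : Face → Bool} (h : K.moments r σ ν u = 0) : u = 0 := by
  obtain ⟨h1, h2, h4⟩ := K.moments_eq_iff.1 h
  exact K.eq_zero_of_moments hr hu (fun e q hq => h1 e ⟨q, hq⟩) (fun f q hq => h2 f ⟨q, hq⟩)
    fun q hq => h4 ⟨q, hq⟩

/-- The edge, face and interior moments of a field of `S^1` can be prescribed: the moment map is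
injective, and the dimension of `S^1` is at least that of its target. -/
theorem exists_moments {r : ℕ} (hr : 2 ≤ r) (σ : Edge → Bool) (ν : Face → Bool) (a) :
    ∃ u ∈ S1 r, K.moments r σ ν u = a := by
  have hinj : Function.Injective ((K.moments r σ ν).domRestrict (S1 r)) :=
    (injective_iff_map_eq_zero _).2 fun u hu =>
      Subtype.ext (K.eq_zero_of_moments_eq_zero hr u.2 hu)
  have hdim : Module.finrank ℝ (((Edge → Module.Dual ℝ (edgeTest r)) ×
      (Face → Module.Dual ℝ (faceTest r))) × Module.Dual ℝ (cellTest r)) =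
      12 * r + 6 * Module.finrank ℝ (faceTest r) + Module.finrank ℝ (cellTest r) := by
    rw [Module.finrank_prod, Module.finrank_prod, Module.finrank_pi_fintype,
      Module.finrank_pi_fintype]
    simp only [Subspace.dual_finrank_eq, finrank_edgeTest, Finset.sum_const, Finset.card_univ,
      smul_eq_mul]
    rfl
  have hle := LinearMap.finrank_le_finrank_of_injective hinj
  have heq := le_antisymm hle (hdim ▸ le_finrank_S1 hr)
  obtain ⟨u, hu⟩ := (LinearMap.injective_iff_surjective_of_finrank_eq_finrank heq).1 hinj a
  exact ⟨u, u.2, hu⟩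

theorem disjoint_S1_V {r : ℕ} (hr : 2 ≤ r) : Disjoint (S1 r) (K.V ((r : ℤ) - 2)) := by
  rw [Submodule.disjoint_def]
  exact fun u hu hv => K.eq_zero_of_moments_eq_zero hr hu
    (K.moments_of_mem_V hv (fun _ => true) fun _ => true)

theorem faceMoment_curl_add (f : Face) (s : Bool) (u v : VPoly 3) (q : VPoly 2) :
    K.faceMoment f (unitVec f.1 s) (curl (u + v)) q =
      K.faceMoment f (unitVec f.1 s) (curl u) q + K.faceMoment f (unitVec f.1 s) (curl v) q := by
  rw [map_add]
  exact LinearMap.congr_fun ((K.faceMomentₗ f s).map_add _ _) q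

/-- All moments of a field of `S^{+,1}`, as functionals on the test spaces. -/
def allMoments (r : ℕ) (σ : Edge → Bool) (ν : Face → Bool) : VPoly 3 →ₗ[ℝ]
    (((Edge → Module.Dual ℝ (edgeTest r)) × (Face → Module.Dual ℝ (faceTest r))) ×
      Module.Dual ℝ (cellTest r)) × (Face → Module.Dual ℝ (faceCurlTest r)) :=
  (K.moments r σ ν).prod
    (LinearMap.pi fun f => (faceCurlTest r).dualRestrict ∘ₗ K.faceMomentₗ f (ν f) ∘ₗ curl)

theorem allMoments_eq_iff {r : ℕ} {σ : Edge → Bool} {ν : Face → Bool} {u : VPoly 3}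
    {a₁ : Edge → Module.Dual ℝ (edgeTest r)} {a₂ : Face → Module.Dual ℝ (faceTest r)}
    {a₃ : Face → Module.Dual ℝ (faceCurlTest r)}
    {a₄ : Module.Dual ℝ (cellTest r)} : K.allMoments r σ ν u = (((a₁, a₂), a₄), a₃) ↔
      (∀ (e : Edge) (q : edgeTest r), K.edgeMoment e (unitVec e.1 (σ e)) u q = a₁ e q) ∧
      (∀ (f : Face) (q : faceTest r), K.faceMoment f (unitVec f.1 (ν f)) u q = a₂ f q) ∧
      (∀ (f : Face) (q : faceCurlTest r),
        K.faceMoment f (unitVec f.1 (ν f)) (curl u) q = a₃ f q) ∧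
      (∀ q : cellTest r, K.cellMoment u q = a₄ q) := by
  constructor
  · intro h
    obtain ⟨h1, h2, h4⟩ := K.moments_eq_iff.1 (congrArg Prod.fst h)
    have h3 := congrArg Prod.snd h
    exact ⟨h1, h2, fun f q => LinearMap.congr_fun (congrFun h3 f) q, h4⟩
  · rintro ⟨h1, h2, h3, h4⟩
    exact Prod.ext (K.moments_eq_iff.2 ⟨h1, h2, h4⟩)
      (funext fun f => LinearMap.ext fun q => h3 f q)

/-- The moment map is block triangular: the bubble fields only have curl moments. -/
theorem allMoments_bijective {r : ℕ} (hr : 2 ≤ r) (σ : Edge → Bool) (ν : Face → Bool) :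
    Function.Bijective ((K.allMoments r σ ν).domRestrict (K.SPlus r)) := by
  constructor
  · refine (injective_iff_map_eq_zero _).2 ?_
    rintro ⟨u, hu⟩ h
    obtain ⟨s, hs, v, hv, rfl⟩ := Submodule.mem_sup.1 hu
    have h1 : K.moments r σ ν (s + v) = 0 := congrArg Prod.fst h
    rw [map_add, K.moments_of_mem_V hv, add_zero] at h1
    have hs0 := K.eq_zero_of_moments_eq_zero hr hs h1
    subst hs0
    refine Subtype.ext ?_
    change 0 + v = 0
    rw [zero_add]
    refine K.eq_zero_of_curlMoments hv (ν := ν) fun f q hq => ?_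
    have h3 := LinearMap.congr_fun (congrFun (congrArg Prod.snd h) f) ⟨q, hq⟩
    change K.faceMoment f (unitVec f.1 (ν f)) (curl (0 + v)) q = 0 at h3
    rwa [zero_add] at h3
  · rintro ⟨a, a₃⟩
    obtain ⟨s, hs, hsa⟩ := K.exists_moments hr σ ν a
    obtain ⟨v, hv, hva⟩ := K.exists_curlMoments (r := r) ν
      fun f => a₃ f - (faceCurlTest r).dualRestrict (K.faceMomentₗ f (ν f) (curl s))
    refine ⟨⟨s + v, Submodule.add_mem_sup hs hv⟩, Prod.ext ?_ ?_⟩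
    · change K.moments r σ ν (s + v) = a
      rw [map_add, K.moments_of_mem_V hv, add_zero, hsa]
    · refine funext fun f => LinearMap.ext fun q => ?_
      change K.faceMoment f (unitVec f.1 (ν f)) (curl (s + v)) q = a₃ f q
      rw [faceMoment_curl_add, hva]
      exact add_sub_cancel (K.faceMoment f (unitVec f.1 (ν f)) (curl s) q) (a₃ f q)

theorem unisolvent_SPlus {r : ℕ} (hr : 2 ≤ r) (σ : Edge → Bool) (ν : Face → Bool) :
    K.Unisolvent r σ ν (K.SPlus r) := by
  intro a₁ a₂ a₃ a₄
  obtain ⟨u, hu, huniq⟩ := (K.allMoments_bijective hr σ ν).existsUnique (((a₁, a₂), a₄), a₃)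
  refine ⟨u, ⟨u.2, K.allMoments_eq_iff.1 hu⟩, ?_⟩
  rintro w ⟨hw, hwa⟩
  exact congrArg Subtype.val (huniq ⟨w, hw⟩ (K.allMoments_eq_iff.2 hwa))

theorem finrank_SPlus {r : ℕ} (hr : 2 ≤ r) : Module.finrank ℝ (K.SPlus r) = numDofs r := by
  rw [(LinearEquiv.ofBijective _
    (K.allMoments_bijective hr (fun _ => true) fun _ => true)).finrank_eq]
  rw [Module.finrank_prod, Module.finrank_prod, Module.finrank_prod, Module.finrank_pi_fintype,
    Module.finrank_pi_fintype, Module.finrank_pi_fintype, numDofs]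
  simp only [Subspace.dual_finrank_eq, Finset.sum_const, Finset.card_univ, smul_eq_mul]
  ring

end Cube

end

end CurlElement

theorem theorem3p1 (r : ℕ) (hr : 2 ≤ r) (K : CurlElement.Cube)
    (σ : CurlElement.Edge → Bool) (ν : CurlElement.Face → Bool) :
    Disjoint (CurlElement.S1 r) (K.V ((r : ℤ) - 2)) ∧
      K.Unisolvent r σ ν (K.SPlus r) ∧
      Module.finrank ℝ (K.SPlus r) = CurlElement.numDofs r ∧
      CurlElement.numDofs 2 = 48 :=
  ⟨K.disjoint_S1_V hr, K.unisolvent_SPlus hr σ ν, K.finrank_SPlus hr, CurlElement.numDofs_two⟩
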